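/- Work in a model $V$ of $\mathsf{ZF}+V=L(\mathcal P(\mathbb R))+\mathsf{AD}_{\mathbb R}+$ "$\Theta$ is regular", where $\mathbb R=\omega^\omega$; in particular $V$ may be any structure $(M,\varepsilon)$ satisfying these axioms, and everything below is evaluated in $V$. Let $\mathcal H$ be the class of pairs of ordinals $(\alpha,\beta)$ such that the $\alpha$th element of the standard definability order of $\mathrm{HOD}$ is an element of the $\beta$th, where sets are ordered by their lexicographically least definition (an ordinal $\xi$, a formula, a finite sequence of ordinals below $\xi$, the set being definable in $V_\xi$ by the formula from the sequence; formulas, coded as finite sequences of triples of natural numbers, and finite sequences of ordinals are each ordered by length and then by first difference). For an ordinal $\gamma$ put: * $\mathbf C^-_\gamma=L_\gamma(\mathcal H,\gamma^\omega)$, the $\gamma$th stage $J_\gamma$ of the hierarchy $J_0=\emptyset$, $J_{\alpha+1}=J_\alpha\cup\mathrm{Def}(J_\alpha,\in,\mathcal H)\cup\alpha^\omega$, $J_\eta=\bigcup_{\alpha<\eta}J_\alpha$ for limit $\eta$, where $\mathrm{Def}$ denotes the subsets definable with parameters; * $\mathbf C_\gamma=L(\mathcal H\cap(\gamma\times\gamma),\gamma^\omega)$;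 * $\mathbf C^+_\gamma=\mathrm{HOD}_{\gamma^\omega}$, the class of sets hereditarily definable from ordinals and elements of $\gamma^\omega$. For a class $C$, $\Theta^{C}$ is the supremum of the ordinals that are images of $\mathbb R\cap C$ under a surjection in $C$, and $\Theta=\Theta^V$. The Solovay sequence is the continuous sequence $\langle\theta_\alpha\rangle$ of ordinals in which $\theta_0$ is the supremum of the ordinals that are images of $\mathbb R$ under an ordinal definable surjection and, if $\theta_\alpha<\Theta$, $\theta_{\alpha+1}$ is the supremum of the ordinals that are images of $\mathcal P(\theta_\alpha)$ under an ordinal definable surjection. For an ordinal $\alpha$, $\Delta_\alpha$ is the set of subsets of $\omega^\omega$ of Wadge rank less than $\alpha$. For an ordinal $\lambda$, let $\Join_\lambda$ be the statement that, with $\kappa=\Theta^{\mathbf C_\lambda}$, 1. $\kappa$ is a regular cardinal and a member of the Solovay sequence, and $\kappa<\Theta$; 2. $\mathbf C^+_\lambda\models\lambda=\kappa^+\wedge\mathrm{cf}(\lambda)=\lambda$; 3. $\mathbf C^-_\lambda\cap\mathcal P(\mathbb R)=\mathbf C^+_\lambda\cap\mathcal P(\mathbb R)=\Delta_\kappa$;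 4. $\mathcal P(\kappa^\omega)\cap\mathbf C_\lambda=\mathcal P(\kappa^\omega)\cap\mathbf C^+_\lambda$; 5. $\kappa\le\mathrm{cf}(\lambda)$. **Lemma.** Suppose that $\lambda$ is an ordinal for which $\Join_\lambda$ holds. Whenever $b\in\mathbf C^-_\lambda$ and $f\colon b\to\lambda$ is in $\mathbf C^+_\lambda$, there exists a $\gamma<\lambda$ such that $f[b]\subseteq\gamma$. -/

import Mathlib

/-! The theory of sets is interpreted in an arbitrary structure `(M, ε)`; every notion below is the
usual one, evaluated inside that structure. Classes of `(M, ε)` are predicates on `M`, and every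
quantifier ranges over `M`, so that all the classes below are first-order definable. -/

universe u

/-- A structure for the language of set theory. -/
class SetStructure (M : Type u) where
  mem : M → M → Prop

infix:50 " ε " => SetStructure.mem

namespace SetStructure

/-- The relation symbols of the language of set theory: one binary symbol. -/
inductive EpsRel : ℕ → Type
  | mem : EpsRel 2

/-- The first-order language of set theory. -/
def setLang : FirstOrder.Language := ⟨fun _ => Empty, EpsRel⟩

instance instStructure (M : Type u) [SetStructure M] : setLang.Structure M where
  funMap := fun f _ => nomatch f
  RelMap := fun r =>
    match r with
    | EpsRel.mem => fun v => v 0 ε v 1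

section Basic

variable {M : Type u} [SetStructure M]

/-- `x` is the set of all `y` in the class `P`. -/
def IsColl (x : M) (P : M → Prop) : Prop := ∀ y, y ε x ↔ P y

def IsEmp (x : M) : Prop := ∀ y, ¬ y ε x

def Sub (x y : M) : Prop := ∀ z, z ε x → z ε y

/-- `p = {a, b}`. -/
def IsPair (p a b : M) : Prop := ∀ z, z ε p ↔ z = a ∨ z = b

/-- `p = (a, b) = {{a}, {a, b}}`. -/
def IsOPair (p a b : M) : Prop := ∃ u v, IsPair u a a ∧ IsPair v a b ∧ IsPair p u v

/-- `p = (a, (b, c))`. -/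
def IsTriple (p a b c : M) : Prop := ∃ q, IsOPair q b c ∧ IsOPair p a q

/-- `y = x ∪ {x}`. -/
def IsSucc (y x : M) : Prop := ∀ z, z ε y ↔ z ε x ∨ z = x

def IsTrans (x : M) : Prop := ∀ y z, y ε x → z ε y → z ε x

/-- `x` is an ordinal: a transitive set of transitive sets. -/
def IsOrd (x : M) : Prop := IsTrans x ∧ ∀ y, y ε x → IsTrans y

/-- `x` is a nonzero limit ordinal. -/
def IsLimit (x : M) : Prop := IsOrd x ∧ (∃ y, y ε x) ∧ ∀ y, ¬ IsSucc x y

/-- `n` is an element of `ω`. -/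
def IsNat (n : M) : Prop := IsOrd n ∧ ∀ m, m = n ∨ m ε n → IsEmp m ∨ ∃ k, IsSucc m k

/-- `x` is the numeral of `n`. -/
def IsNum : ℕ → M → Prop
  | 0, x => IsEmp x
  | n + 1, x => ∃ y, IsNum n y ∧ IsSucc x y

/-- `(x, y) ∈ f`. -/
def App (f x y : M) : Prop := ∃ p, IsOPair p x y ∧ p ε f

def IsFunction (f : M) : Prop :=
  (∀ p, p ε f → ∃ x y, IsOPair p x y) ∧ ∀ x y y', App f x y → App f x y' → y = y'

/-- `f` is a function with domain `A` and all values in `B`. -/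
def IsMap (f : M) (A B : M → Prop) : Prop :=
  IsFunction f ∧ (∀ x, (∃ y, App f x y) ↔ A x) ∧ ∀ x y, App f x y → B y

def IsSurj (f : M) (A B : M → Prop) : Prop := IsMap f A B ∧ ∀ y, B y → ∃ x, App f x y

def IsBij (f : M) (A B : M → Prop) : Prop :=
  IsSurj f A B ∧ ∀ x x' y, App f x y → App f x' y → x = x'

/-- `s ∈ a ^ ω`. -/
def IsSeq (s a : M) : Prop := IsMap s IsNat (fun v => v ε a)

/-- `x ∈ ω ^ ω`. -/
def IsReal (x : M) : Prop := IsMap x IsNat IsNat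

/-- `s` is a finite sequence of elements of the class `P`. -/
def IsFinSeq (s : M) (P : M → Prop) : Prop := ∃ n, IsNat n ∧ IsMap s (fun i => i ε n) P

/-- `s` is the restriction of the sequence `x` to `n`. -/
def IsRestr (s x n : M) : Prop := IsFunction s ∧ ∀ i v, App s i v ↔ i ε n ∧ App x i v

/-- `A` is a set of reals. -/
def IsRealSet (A : M) : Prop := ∀ x, x ε A → IsReal x

/-- `T` is the transitive closure of `{a}`. -/
def IsTrCl (T a : M) : Prop :=
  IsTrans T ∧ a ε T ∧ ∀ T', IsTrans T' → a ε T' → Sub T T'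

/-- The trivial class of all sets. -/
def Univ (_ : M) : Prop := True

end Basic

/-- `(M, ε)` is a model of `ZF`. The two schemas range over the classes of `M` that are first-order
definable with parameters. -/
structure ModelsZF (M : Type u) [SetStructure M] : Prop where
  extensionality : ∀ x y : M, (∀ z, z ε x ↔ z ε y) → x = y
  foundation : ∀ x : M, (∃ y, y ε x) → ∃ y, y ε x ∧ ∀ z, z ε y → ¬ z ε x
  pairing : ∀ a b : M, ∃ p, IsPair p a b
  union : ∀ a : M, ∃ b, ∀ x, x ε b ↔ ∃ y, y ε a ∧ x ε y
  powerset : ∀ a : M, ∃ b, ∀ x, x ε b ↔ Sub x a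
  infinity : ∃ w : M, (∃ z, IsEmp z ∧ z ε w) ∧ ∀ x, x ε w → ∃ y, IsSucc y x ∧ y ε w
  separation : ∀ P : Set M, Set.Definable₁ Set.univ setLang P →
    ∀ a : M, ∃ b, ∀ x, x ε b ↔ x ε a ∧ x ∈ P
  replacement : ∀ F : Set (M × M), Set.Definable₂ Set.univ setLang F →
    ∀ a : M, (∀ x, x ε a → ∃! y, (x, y) ∈ F) → ∃ b, ∀ y, y ε b ↔ ∃ x, x ε a ∧ (x, y) ∈ F

section Definability

variable {M : Type u} [SetStructure M]

/-! ### Satisfaction in set structures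

A formula (in the sense of `M`) is coded by a formation sequence: a nonempty finite sequence of
instructions `(op, i, j)` with `op, i, j ∈ ω`. The `k`-th instruction stands for the formula
* `vᵢ ∈ vⱼ` if `op = 0`, `vᵢ = vⱼ` if `op = 1`, `H(vᵢ, vⱼ)` if `op = 2`;
* `¬ (φᵢ ∧ φⱼ)` if `op = 3`, where `φᵢ`, `φⱼ` are the formulas of the instructions `i, j < k`;
* `∃ vᵢ φⱼ` if `op = 4`, where `φⱼ` is the formula of instruction `j < k`.
Any other instruction stands for a false formula, as does a reference to an `i` or `j` that is
not `< k`. The formula coded is that of the last instruction. -/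

def IsInstr (t : M) : Prop := ∃ op i j, IsNat op ∧ IsNat i ∧ IsNat j ∧ IsTriple t op i j

/-- `e` codes a formula; its last instruction has index `k`. -/
def IsCodeWithLast (e k : M) : Prop :=
  ∃ n, IsNat k ∧ IsSucc n k ∧ IsMap e (fun i => i ε n) IsInstr

def IsCode (e : M) : Prop := ∃ k, IsCodeWithLast e k

/-- `s ∈ A ^ ω`, seen as an assignment of elements of `A` to the variables `v₀, v₁, …`. -/
def IsAssign (s A : M) : Prop := IsSeq s A

/-- `t` assigns `a` to the variable `i` and agrees with `s` elsewhere. -/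
def IsUpd (t s i a : M) : Prop :=
  ∀ n y, App t n y ↔ (n = i ∧ y = a) ∨ (n ≠ i ∧ App s n y)

/-- The assignment `s` lies in the relation listed by `F` at the place `j < k`. -/
def Earlier (F k j s : M) : Prop := j ε k ∧ ∃ Y, App F j Y ∧ s ε Y

/-- The Tarski clause for the `k`-th instruction `(op, i, j)` over the structure `(A, ∈, H)`, where
`F` lists the relations defined by the earlier instructions. -/
def Clause (A : M) (H : M → M → Prop) (F k op i j s : M) : Prop :=
  (IsNum 0 op ∧ ∃ x y, App s i x ∧ App s j y ∧ x ε y) ∨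
  (IsNum 1 op ∧ ∃ x y, App s i x ∧ App s j y ∧ x = y) ∨
  (IsNum 2 op ∧ ∃ x y, App s i x ∧ App s j y ∧ H x y) ∨
  (IsNum 3 op ∧ ¬ (Earlier F k i s ∧ Earlier F k j s)) ∨
  (IsNum 4 op ∧ ∃ a t, a ε A ∧ IsAssign t A ∧ IsUpd t s i a ∧ Earlier F k j t)

/-- `F` lists, for each instruction of `e`, the relation on `A` that it defines (as a set of
assignments). -/
def IsEval (A : M) (H : M → M → Prop) (e F : M) : Prop :=
  IsFunction F ∧ (∀ k, (∃ X, App F k X) ↔ ∃ t, App e k t) ∧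
  ∀ k X t op i j, App F k X → App e k t → IsTriple t op i j →
    ∀ s, s ε X ↔ IsAssign s A ∧ Clause A H F k op i j s

/-- The structure `(A, ∈, H)` satisfies the formula coded by `e` under the assignment `s`. -/
def Sat (A : M) (H : M → M → Prop) (e s : M) : Prop :=
  ∃ F k X, IsEval A H e F ∧ IsCodeWithLast e k ∧ App F k X ∧ s ε X

/-- `X` is the set of `y ∈ A` such that `(A, ∈, H)` satisfies the formula coded by `e` at `v₀ = y`
and `v_{i+1} = qᵢ`, where `q` is a finite sequence of parameters (variables that get no value in
this way are read existentially). -/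
def DefinesSet (A : M) (H : M → M → Prop) (e q X : M) : Prop :=
  ∀ y, y ε X ↔ y ε A ∧ ∃ t, IsAssign t A ∧ (∀ z, IsEmp z → App t z y) ∧
    (∀ i v, App q i v → ∃ i', IsSucc i' i ∧ App t i' v) ∧ Sat A H e t

/-- `X ∈ Def(A, ∈, H)`: `X` is a subset of `A` definable over `(A, ∈, H)` with parameters. -/
def IsDef (A : M) (H : M → M → Prop) (X : M) : Prop :=
  ∃ e q, IsCode e ∧ IsFinSeq q (fun v => v ε A) ∧ DefinesSet A H e q X

/-- The empty binary predicate. -/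
def NoPred (_ _ : M) : Prop := False

/-! ### Cumulative hierarchies -/

/-- `F` is a function on the ordinal `δ` with `F 0 = base`, with `F (β + 1) = {x | Step β (F β) x}`
and with unions at limits. -/
def IsHier (base : M → Prop) (Step : M → M → M → Prop) (δ F : M) : Prop :=
  IsOrd δ ∧ IsMap F (fun β => β ε δ) Univ ∧
  ∀ β X, App F β X → ∀ x, x ε X ↔
    (IsEmp β ∧ base x) ∨
    (∃ γ Y, IsSucc β γ ∧ App F γ Y ∧ Step γ Y x) ∨
    (IsLimit β ∧ ∃ γ Y, γ ε β ∧ App F γ Y ∧ x ε Y)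

/-- `X` is the `β`-th stage of the hierarchy. -/
def IsStage (base : M → Prop) (Step : M → M → M → Prop) (β X : M) : Prop :=
  ∃ δ F, IsHier base Step δ F ∧ App F β X

/-- `A = V_α`. -/
def IsV (α A : M) : Prop := IsStage (fun _ => False) (fun _ Y x => Sub x Y) α A

/-- The class `L(a)`: `L₀(a)` is the transitive closure of `{a}` and
`L_{β+1}(a) = Def(L_β(a), ∈)`. -/
def InL (a x : M) : Prop :=
  ∃ T, IsTrCl T a ∧ ∃ β X, IsStage (fun y => y ε T) (fun _ Y y => IsDef Y NoPred y) β X ∧ x ε X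

/-! ### Ordinal definability -/

/-- `x` is the element of `V_α` defined over `(V_α, ∈)` by the formula coded by `e` from the finite
sequence of parameters `q`, each of which is an ordinal or in the class `P`. -/
def DefinedBy (P : M → Prop) (x α e q : M) : Prop :=
  IsOrd α ∧ ∃ A, IsV α A ∧ IsCode e ∧ IsFinSeq q (fun v => v ε A ∧ (IsOrd v ∨ P v)) ∧
    ∃ X, IsPair X x x ∧ DefinesSet A NoPred e q X

/-- `x` is definable from ordinals and elements of `P`. -/
def OD (P : M → Prop) (x : M) : Prop := ∃ α e q, DefinedBy P x α e q

/-- `x` is hereditarily definable from ordinals and elements of `P`. -/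
def HOD (P : M → Prop) (x : M) : Prop := ∃ T, IsTrans T ∧ x ε T ∧ ∀ y, y ε T → OD P y

/-- The class with no elements. -/
def NoParam (_ : M) : Prop := False

/-! ### The definability order of `HOD` -/

/-- Finite sequences are ordered by length, then by their values at the first difference. -/
def FinSeqLt (lt : M → M → Prop) (s s' : M) : Prop :=
  ∃ n n', IsNat n ∧ IsNat n' ∧ (∀ i, (∃ v, App s i v) ↔ i ε n) ∧
    (∀ i, (∃ v, App s' i v) ↔ i ε n') ∧
    (n ε n' ∨ (n = n' ∧ ∃ i v v', App s i v ∧ App s' i v' ∧ lt v v' ∧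
      ∀ j, j ε i → ∀ w, App s j w ↔ App s' j w))

/-- The lexicographic order of triples of ordinals. -/
def TripleLt (t t' : M) : Prop :=
  ∃ a b c a' b' c', IsTriple t a b c ∧ IsTriple t' a' b' c' ∧
    (a ε a' ∨ (a = a' ∧ (b ε b' ∨ (b = b' ∧ c ε c'))))

/-- The lexicographic order of definitions `(α, e, q)`. -/
def DataLt (α e q α' e' q' : M) : Prop :=
  α ε α' ∨ (α = α' ∧ (FinSeqLt TripleLt e e' ∨
    (e = e' ∧ FinSeqLt (fun v v' => v ε v') q q')))

/-- `(α, e, q)` is the least ordinal definition of `x`. -/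
def IsLeastDef (x α e q : M) : Prop :=
  DefinedBy NoParam x α e q ∧
    ∀ α' e' q', DefinedBy NoParam x α' e' q' → ¬ DataLt α' e' q' α e q

/-- The definability order: sets are compared through their least ordinal definitions. -/
def HODLt (x y : M) : Prop :=
  ∃ α e q α' e' q', IsLeastDef x α e q ∧ IsLeastDef y α' e' q' ∧ DataLt α e q α' e' q'

/-- `x` is the `α`-th element of `HOD` in the definability order: there is an order isomorphism `F`
of `α` onto the set of predecessors of `x`. -/
def IsNthHOD (α x : M) : Prop :=
  IsOrd α ∧ HOD NoParam x ∧ ∃ F, IsSurj F (fun β => β ε α) (fun y => HOD NoParam y ∧ HODLt y x) ∧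
    ∀ β β' y y', App F β y → App F β' y' → β ε β' → HODLt y y'

/-- The class `ℋ` of pairs of ordinals `(α, β)` such that the `α`-th element of `HOD` is an element
of the `β`-th. -/
def HH (α β : M) : Prop := ∃ x y, IsNthHOD α x ∧ IsNthHOD β y ∧ x ε y

/-! ### The Chang models -/

/-- `x ∈ C⁻_γ = L_γ(ℋ, γ^ω)`: the `γ`-th stage of the hierarchy that starts with `∅` and whose stage
`β + 1` adds to stage `β` its subsets definable over it relative to `ℋ`, and all `ω`-sequences
from `β`. -/
def CMinus (γ x : M) : Prop :=
  ∃ X, IsStage (fun _ => False) (fun β Y y => y ε Y ∨ IsDef Y HH y ∨ IsSeq y β) γ X ∧ x ε X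

/-- `x ∈ C_γ = L(ℋ ↾ γ, γ^ω)`. -/
def CMid (γ x : M) : Prop :=
  ∃ h s a, IsColl h (fun p => ∃ α β, α ε γ ∧ β ε γ ∧ IsOPair p α β ∧ HH α β) ∧
    IsColl s (fun y => IsSeq y γ) ∧ IsOPair a h s ∧ InL a x

/-- `x ∈ C⁺_γ`, the class of sets hereditarily definable from ordinals and elements of `γ^ω`. -/
def CPlus (γ x : M) : Prop := HOD (fun s => IsSeq s γ) x

/-! ### Cardinals and cofinalities, relative to a class `C` -/

/-- `s` is the supremum of the class of ordinals `P`. -/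
def IsSup (s : M) (P : M → Prop) : Prop := IsOrd s ∧ ∀ β, β ε s ↔ ∃ α, P α ∧ β ε α

/-- `κ = Θ^C`: the supremum of the ordinals onto which `ω^ω` can be mapped in `C`. -/
def IsTheta (C : M → Prop) (κ : M) : Prop :=
  IsSup κ (fun α => IsOrd α ∧ ∃ f, C f ∧ IsSurj f (fun x => C x ∧ IsReal x) (fun y => y ε α))

def IsCardinal (C : M → Prop) (α : M) : Prop :=
  IsOrd α ∧ ∀ β f, β ε α → C f → ¬ IsBij f (fun x => x ε β) (fun y => y ε α)

/-- `C ⊨ lam = κ⁺`. -/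
def IsCardSucc (C : M → Prop) (κ lam : M) : Prop :=
  IsCardinal C lam ∧ κ ε lam ∧ ∀ μ, μ ε lam → κ ε μ → ¬ IsCardinal C μ

/-- `f` is a map from `α` to `lam` with cofinal range. -/
def IsCofinalMap (f α lam : M) : Prop :=
  IsMap f (fun x => x ε α) (fun y => y ε lam) ∧
    ∀ ξ, ξ ε lam → ∃ x y, App f x y ∧ (ξ = y ∨ ξ ε y)

/-- `C ⊨ cf(lam) = μ`. -/
def IsCf (C : M → Prop) (lam μ : M) : Prop :=
  IsOrd μ ∧ (∃ f, C f ∧ IsCofinalMap f μ lam) ∧ ∀ ν f, ν ε μ → C f → ¬ IsCofinalMap f ν lam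

/-- `κ` is an (infinite) regular cardinal. -/
def IsRegular (κ : M) : Prop := IsLimit κ ∧ IsCf Univ κ κ

/-! ### The Solovay sequence -/

/-- `t` is an initial segment of the sequence of ordinals `θ_ξ` in which `θ₀` is the supremum of the
ordinals onto which `ω^ω` can be mapped by an ordinal definable function, `θ_{η+1}` is the supremum
of those onto which the power set of `θ_η` can be so mapped, and suprema are taken at limits. Its
members below `Θ` are those of the Solovay sequence. -/
def IsSolovaySeg (t : M) : Prop :=
  (∃ δ, IsOrd δ ∧ IsMap t (fun ξ => ξ ε δ) IsOrd) ∧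
  ∀ ξ θ, App t ξ θ →
    (IsEmp ξ → IsSup θ (fun α => IsOrd α ∧ ∃ f, OD NoParam f ∧ IsSurj f IsReal (fun y => y ε α))) ∧
    (∀ η θ', IsSucc ξ η → App t η θ' → IsSup θ (fun α => IsOrd α ∧
      ∃ f, OD NoParam f ∧ IsSurj f (fun x => Sub x θ') (fun y => y ε α))) ∧
    (IsLimit ξ → IsSup θ (fun α => ∃ η, η ε ξ ∧ App t η α))

/-- `κ` is a member of the Solovay sequence, below `Θ`. -/
def IsSolovayBelowTheta (κ : M) : Prop :=
  (∃ t ξ, IsSolovaySeg t ∧ App t ξ κ) ∧ ∃ Θ, IsTheta Univ Θ ∧ κ ε Θ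

/-! ### The Wadge hierarchy -/

/-- `f : ω^ω → ω^ω` is continuous. -/
def IsContinuous (f : M) : Prop :=
  IsMap f IsReal IsReal ∧ ∀ x y n v, App f x y → App y n v →
    ∃ m, IsNat m ∧ ∀ x' y', App f x' y' → (∀ i w, i ε m → App x i w → App x' i w) → App y' n v

/-- `A ≤_W B`. -/
def WadgeLe (A B : M) : Prop :=
  ∃ f, IsContinuous f ∧ ∀ x y, App f x y → (x ε A ↔ y ε B)

def WadgeLt (A B : M) : Prop := WadgeLe A B ∧ ¬ WadgeLe B A

/-- `ρ` is the rank function of `<_W` on the sets of reals. -/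
def IsWadgeRank (ρ : M) : Prop :=
  IsMap ρ IsRealSet IsOrd ∧ ∀ A α, App ρ A α → ∀ β, β ε α ↔
    ∃ B γ, WadgeLt B A ∧ App ρ B γ ∧ (β = γ ∨ β ε γ)

/-- `A ∈ Δ_κ`: `A` is a set of reals of Wadge rank less than `κ`. -/
def InDelta (κ A : M) : Prop := ∃ ρ α, IsWadgeRank ρ ∧ App ρ A α ∧ α ε κ

/-- The principle `⋈_lam`. -/
def Join (lam : M) : Prop :=
  IsOrd lam ∧ ∃ κ, IsTheta (CMid lam) κ ∧
    (IsRegular κ ∧ IsSolovayBelowTheta κ) ∧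
    (IsCardSucc (CPlus lam) κ lam ∧ IsCf (CPlus lam) lam lam) ∧
    (∀ A, IsRealSet A → (CMinus lam A ↔ CPlus lam A) ∧ (CPlus lam A ↔ InDelta κ A)) ∧
    (∀ A, (∀ s, s ε A → IsSeq s κ) → (CMid lam A ↔ CPlus lam A)) ∧
    (∃ μ, IsCf Univ lam μ ∧ Sub κ μ)

/-! ### Determinacy of games on the reals

In a run of a game the players alternately produce the reals `a₀, b₀, a₁, b₁, …`; player I plays
the sequence `a`, player II plays `b`, and the payoff set `A` is a set of pairs `(a, b)`. A strategy
answers the finite sequence of the moves that the opponent has made so far. -/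

def IsRealSeq (a : M) : Prop := IsMap a IsNat IsReal

def IsStrategy (σ : M) : Prop := IsMap σ (fun s => IsFinSeq s IsReal) IsReal

def PlayerOneWins (A : M) : Prop :=
  ∃ σ, IsStrategy σ ∧ ∀ a b, IsRealSeq a → IsRealSeq b →
    (∀ n s v, IsNat n → IsRestr s b n → App σ s v → App a n v) → ∃ p, IsOPair p a b ∧ p ε A

def PlayerTwoWins (A : M) : Prop :=
  ∃ τ, IsStrategy τ ∧ ∀ a b, IsRealSeq a → IsRealSeq b →
    (∀ n n' s v, IsNat n → IsSucc n' n → IsRestr s a n' → App τ s v → App b n v) →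
      ¬ ∃ p, IsOPair p a b ∧ p ε A

end Definability

/-- `AD_ℝ` holds in `M`. -/
def ModelsADR (M : Type u) [SetStructure M] : Prop :=
  ∀ A : M, PlayerOneWins A ∨ PlayerTwoWins A

/-- `V = L(𝒫(ℝ))` holds in `M`. -/
def ModelsVEqLPR (M : Type u) [SetStructure M] : Prop :=
  ∃ P : M, IsColl P IsRealSet ∧ ∀ x, InL P x

/-- `M` is a model of `ZF + V = L(𝒫(ℝ)) + AD_ℝ + "Θ is regular"`. -/
structure ModelsDagger (M : Type u) [SetStructure M] : Prop where
  zf : ModelsZF M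
  vEqLPR : ModelsVEqLPR M
  adr : ModelsADR M
  thetaRegular : ∃ Θ : M, IsTheta Univ Θ ∧ IsRegular Θ

end SetStructure

/-!
Suppose that `f ∈ C⁺` maps `b ∈ C⁻` to `λ` and is unbounded. A set in `C⁺` is definable from
ordinals and elements of `λ ^ ω` in the internal sense, by a code of a formula and some `V_α` of
the model. The finitely many parameters from `λ ^ ω` and the code can be absorbed into elements of
`λ ^ ω`, and the ordinal parameters can be chosen lexicographically least. Therefore (`exists_sd`)
there is a counterexample `f` that is definable, by a formula of the metatheory, from ordinals and
elements of `λ ^ ω`. This kind of definability, the type class `Dfn`, is closed under the logical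
operations, so that instance search establishes it for every relation below. The converse, that
sets which are definable in this way are ordinal definable in the internal sense from elements of
`λ ^ ω`, rests on the reflection principle and on the correctness of the evaluation of codes of
formulas; it gives that definable subsets of `κ ^ ω` and definable maps on ordinals below `λ`
belong to `C⁺` (`cPlus_of_subset`).

The domain `b` appears first at a successor stage `β + 1 < λ` of the hierarchy of `C⁻`. Either `b`
is an element of `β ^ ω`, in which case it is countable and `f` is bounded as `λ` is regular in
`C⁺`, or `b` is a subset of stage `β`. Each element of stage `β` is given by some `γ < β`, a code
of a formula and finitely many elements of stage `γ`, or else is an element of `γ ^ ω`. By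
recursion, stage `β` is a definable image of a part of `δ ^ ω` for some `δ < λ`
(`codeStage_covers`). Because `λ = κ⁺` in `C⁺`, there is a definable injection of `δ` into `κ`
(`ChangPair.exists_inj`). Consequently it is enough to see that definable maps from `κ ^ ω` to `λ`
are bounded (`ChangPair.exists_bound_of_seq`).

As `κ` is regular and uncountable, `κ ^ ω` is the union of the sets `η ^ ω` for `η < κ`, and by the
regularity of `λ` in `C⁺` it is enough to bound the map on each `η ^ ω`. As `η < κ = Θ^{C_λ}`,
there is a definable map from `ℝ` onto `η` (`ChangPair.exists_codes`). Countable choice for sets of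
reals, which follows from `AD_ℝ` (`countable_choice`), turns it into a definable map from `ℝ` onto
`η ^ ω`. So an unbounded map would give an unbounded definable map from `ℝ` to `λ`, and with the
increasing enumeration of its values, a definable surjection from `ℝ` onto `κ + 1`. Such a
surjection is coded by a subset of `κ ^ ω` in `C⁺`. By the clause of `⋈_λ` on subsets of `κ ^ ω`,
the code belongs to `C_λ`, and then so does the surjection, contrary to `κ = Θ^{C_λ}`
(`ChangPair.not_surj`).
-/

set_option synthInstance.maxHeartbeats 400000
set_option synthInstance.maxSize 4000
set_option linter.unusedSectionVars false
set_option linter.unusedVariables false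

namespace SetStructure

/-! ### Definable relations -/

/-- First-order formulas in the language of set theory, with de Bruijn indices: in `ex φ`, the
variable `0` of `φ` is bound. Negation and conjunction are merged as in the codes of formulas. -/
inductive Fml : Type
  | mem (i j : ℕ) : Fml
  | eq (i j : ℕ) : Fml
  | nand (φ ψ : Fml) : Fml
  | ex (φ : Fml) : Fml

/-- The assignment that takes the value `x` at the variable `0` and is `v` on the shifted
variables. -/
def scons {N : Type u} (x : N) (v : ℕ → N) : ℕ → N
  | 0 => x
  | n + 1 => v n

@[simp] theorem scons_zero {N : Type u} (x : N) (v : ℕ → N) : scons x v 0 = x := rfl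
@[simp] theorem scons_succ {N : Type u} (x : N) (v : ℕ → N) (n : ℕ) :
    scons x v (n + 1) = v n := rfl

namespace Fml

/-- `φ` holds in `N` under the assignment `v`. -/
def Real {N : Type u} [SetStructure N] : Fml → (ℕ → N) → Prop
  | mem i j, v => v i ε v j
  | eq i j, v => v i = v j
  | nand φ ψ, v => ¬ (Real φ v ∧ Real ψ v)
  | ex φ, v => ∃ x, Real φ (scons x v)

/-- The renaming `f` below one quantifier. -/
def lift (f : ℕ → ℕ) : ℕ → ℕ
  | 0 => 0
  | n + 1 => f n + 1

def rename : Fml → (ℕ → ℕ) → Fml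
  | mem i j, f => mem (f i) (f j)
  | eq i j, f => eq (f i) (f j)
  | nand φ ψ, f => nand (rename φ f) (rename ψ f)
  | ex φ, f => ex (rename φ (lift f))

theorem scons_comp_lift {N : Type u} (x : N) (v : ℕ → N) (f : ℕ → ℕ) :
    scons x v ∘ lift f = scons x (v ∘ f) := by
  funext n; cases n <;> rfl

theorem real_rename {N : Type u} [SetStructure N] (φ : Fml) :
    ∀ (f : ℕ → ℕ) (v : ℕ → N), (φ.rename f).Real v ↔ φ.Real (v ∘ f) := by
  induction φ with
  | mem i j => intro f v; rfl
  | eq i j => intro f v; rfl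
  | nand φ ψ h1 h2 => intro f v; simp only [rename, Real, h1, h2]
  | ex φ h => intro f v; simp only [rename, Real, h, scons_comp_lift]

/-- The free variables of the formula are less than `φ.bd`. -/
def bd : Fml → ℕ
  | mem i j => max i j + 1
  | eq i j => max i j + 1
  | nand φ ψ => max (bd φ) (bd ψ)
  | ex φ => bd φ

theorem real_congr {N : Type u} [SetStructure N] (φ : Fml) :
    ∀ (v w : ℕ → N), (∀ i, i < φ.bd → v i = w i) → (φ.Real v ↔ φ.Real w) := by
  induction φ with
  | mem i j =>
    intro v w h
    simp only [bd] at h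
    simp only [Real]
    rw [h i (by omega), h j (by omega)]
  | eq i j =>
    intro v w h
    simp only [bd] at h
    simp only [Real]
    rw [h i (by omega), h j (by omega)]
  | nand φ ψ h1 h2 =>
    intro v w h
    simp only [bd] at h
    simp only [Real]
    rw [h1 v w (fun i hi => h i (by omega)), h2 v w (fun i hi => h i (by omega))]
  | ex φ ih =>
    intro v w h
    simp only [bd] at h
    simp only [Real]
    refine exists_congr fun x => ih _ _ fun i hi => ?_
    cases i with
    | zero => rfl
    | succ i => exact h i (by omega)

open FirstOrder Language in
/-- Formulas as above are formulas in the sense of Mathlib, which the axiom schemas of `ModelsZF`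
refer to. -/
theorem exists_formula {N : Type u} [SetStructure N] (φ : Fml) :
    ∃ ψ : setLang.Formula ℕ, ∀ v : ℕ → N, ψ.Realize v ↔ φ.Real v := by
  induction φ with
  | mem i j =>
    let r : setLang.Relations 2 := EpsRel.mem
    exact ⟨r.formula₂ (Term.var i) (Term.var j), fun v =>
      Formula.realize_rel₂ (R := r) (t₁ := Term.var i) (t₂ := Term.var j) (v := v)⟩
  | eq i j =>
    refine ⟨Term.equal (Term.var i) (Term.var j), fun v => ?_⟩
    rw [Formula.realize_equal]
    rfl
  | nand φ ψ h1 h2 =>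
    obtain ⟨a, ha⟩ := h1
    obtain ⟨b, hb⟩ := h2
    refine ⟨∼(a ⊓ b), fun v => ?_⟩
    rw [Formula.realize_not, Formula.realize_inf, ha, hb]
    rfl
  | ex φ h =>
    obtain ⟨a, ha⟩ := h
    refine ⟨(a.relabel (fun n : ℕ => (match n with
      | 0 => Sum.inr () | k + 1 => Sum.inl k : ℕ ⊕ Unit))).iExs Unit, fun v => ?_⟩
    rw [Formula.realize_iExs]
    simp only [Formula.realize_relabel, ha, Real]
    constructor
    · rintro ⟨i, hi⟩
      refine ⟨i (), ?_⟩
      convert hi using 1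
      funext n; cases n <;> rfl
    · rintro ⟨x, hx⟩
      refine ⟨fun _ => x, ?_⟩
      convert hx using 1
      funext n; cases n <;> rfl

end Fml

section Dfn

variable {M : Type u}

/-- The assignment that takes the values `v` at the even and the values `p` at the odd variables, so
that infinitely many variables and infinitely many parameters are available at the same time. -/
def mix (v p : ℕ → M) (n : ℕ) : M := Sum.elim v p (Equiv.natSumNatEquivNat.symm n)

@[simp] theorem mix_inl (v p : ℕ → M) (n : ℕ) :
    mix v p (Equiv.natSumNatEquivNat (Sum.inl n)) = v n := by
  simp only [mix, Equiv.symm_apply_apply, Sum.elim_inl]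
@[simp] theorem mix_inr (v p : ℕ → M) (n : ℕ) :
    mix v p (Equiv.natSumNatEquivNat (Sum.inr n)) = p n := by
  simp only [mix, Equiv.symm_apply_apply, Sum.elim_inr]

theorem mix_ext {α : Type*} {f g : ℕ → α}
    (h1 : ∀ n, f (Equiv.natSumNatEquivNat (Sum.inl n)) = g (Equiv.natSumNatEquivNat (Sum.inl n)))
    (h2 : ∀ n, f (Equiv.natSumNatEquivNat (Sum.inr n)) = g (Equiv.natSumNatEquivNat (Sum.inr n))) :
    f = g := by
  funext n
  obtain ⟨m, rfl⟩ := Equiv.natSumNatEquivNat.surjective n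
  cases m <;> simp only [h1, h2]

/-- `c` belongs to the class `C`. This is a type class so that constants are accepted in the
search for definability instances. -/
class Cst (C : M → Prop) (c : M) : Prop where
  out : C c

/-- The class `C` is inhabited, so that unused parameters have a value. -/
class Inhab (C : M → Prop) : Prop where
  out : ∃ c, C c

/-- A term: a variable, or a constant in the class `C`. -/
class Trm (C : M → Prop) (f : (ℕ → M) → M) : Prop where
  out : (∃ i, ∀ v, f v = v i) ∨ ∃ c, C c ∧ ∀ v, f v = c

variable {C : M → Prop}

instance [Nonempty M] : Inhab (Univ : M → Prop) := ⟨⟨Classical.arbitrary M, trivial⟩⟩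
instance (c : M) : Cst (Univ : M → Prop) c := ⟨trivial⟩

instance (i : ℕ) : Trm C (fun v => v i) := ⟨Or.inl ⟨i, fun _ => rfl⟩⟩
instance (c : M) [Cst C c] : Trm C (fun _ => c) := ⟨Or.inr ⟨c, Cst.out, fun _ => rfl⟩⟩
instance (priority := low) instTrmComp (f : (ℕ → M) → M) (σ : ℕ → ℕ) [h : Trm C f] :
    Trm C (fun v => f (fun i => v (σ i))) := by
  rcases h.out with ⟨i, hi⟩ | ⟨c, hc, hi⟩
  · exact ⟨Or.inl ⟨σ i, fun v => hi _⟩⟩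
  · exact ⟨Or.inr ⟨c, hc, fun v => hi _⟩⟩

theorem Trm.index {f : (ℕ → M) → M} (hf : Trm C f) [hI : Inhab C] :
    ∃ (i : ℕ → ℕ) (c : M), C c ∧ ∀ v p : ℕ → M, ∀ k, p k = c → f v = mix v p (i k) := by
  rcases hf.out with ⟨i, hi⟩ | ⟨c, hc, hi⟩
  · obtain ⟨c, hc⟩ := hI.out
    exact ⟨fun _ => Equiv.natSumNatEquivNat (Sum.inl i), c, hc,
      fun v p k h => by simp only [mix_inl, hi]⟩
  · exact ⟨fun k => Equiv.natSumNatEquivNat (Sum.inr k), c, hc,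
      fun v p k h => by simp only [mix_inr, hi, h]⟩

variable [SetStructure M]

/-- The relation `P` between the values of the variables is first-order definable over `(M, ε)` from
parameters in the class `C`. Formulas of the metatheory are meant, and instance resolution finds
them by following the shape of `P`. -/
class Dfn (C : M → Prop) (P : (ℕ → M) → Prop) : Prop where
  out : ∃ φ : Fml, ∃ p : ℕ → M, (∀ i, C (p i)) ∧ ∀ v, P v ↔ φ.Real (mix v p)

theorem Dfn.congr {P Q : (ℕ → M) → Prop} (h : Dfn C P) (e : ∀ v, Q v ↔ P v) : Dfn C Q := by
  obtain ⟨φ, p, hp, h⟩ := h.out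
  exact ⟨φ, p, hp, fun v => (e v).trans (h v)⟩

theorem Dfn.comp {P : (ℕ → M) → Prop} (h : Dfn C P) {Q : (ℕ → M) → Prop} (σ : ℕ → ℕ)
    (e : ∀ v, Q v ↔ P (fun i => v (σ i))) : Dfn C Q := by
  obtain ⟨φ, p, hp, h⟩ := h.out
  refine ⟨φ.rename (fun n => match Equiv.natSumNatEquivNat.symm n with
    | Sum.inl n => Equiv.natSumNatEquivNat (Sum.inl (σ n))
    | Sum.inr n => Equiv.natSumNatEquivNat (Sum.inr n)), p, hp, fun v => ?_⟩
  rw [e, h, Fml.real_rename]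
  refine iff_of_eq (congrArg _ (mix_ext (fun n => ?_) fun n => ?_)) <;>
  simp only [Function.comp, Equiv.symm_apply_apply, mix_inl, mix_inr]

theorem Dfn.mono {C C' : M → Prop} {P : (ℕ → M) → Prop} (h : Dfn C P) (hC : ∀ x, C x → C' x) :
    Dfn C' P := by
  obtain ⟨φ, p, hp, h⟩ := h.out
  exact ⟨φ, p, fun i => hC _ (hp i), h⟩

theorem Dfn.nand {P Q : (ℕ → M) → Prop} (hP : Dfn C P) (hQ : Dfn C Q) :
    Dfn C (fun v => ¬ (P v ∧ Q v)) := by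
  obtain ⟨φ, p, hp, h⟩ := hP.out
  obtain ⟨ψ, q, hq, h'⟩ := hQ.out
  refine ⟨Fml.nand
    (φ.rename (fun n => match Equiv.natSumNatEquivNat.symm n with
      | Sum.inl n => Equiv.natSumNatEquivNat (Sum.inl n)
      | Sum.inr n => Equiv.natSumNatEquivNat (Sum.inr (Equiv.natSumNatEquivNat (Sum.inl n)))))
    (ψ.rename (fun n => match Equiv.natSumNatEquivNat.symm n with
      | Sum.inl n => Equiv.natSumNatEquivNat (Sum.inl n)
      | Sum.inr n => Equiv.natSumNatEquivNat (Sum.inr (Equiv.natSumNatEquivNat (Sum.inr n))))),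
    mix p q, fun i => ?_, fun v => ?_⟩
  · obtain ⟨m, rfl⟩ := Equiv.natSumNatEquivNat.surjective i
    cases m <;> simp only [mix_inl, mix_inr, hp, hq]
  · simp only [Fml.Real, Fml.real_rename, h, h']
    have e1 : mix v p = mix v (mix p q) ∘ (fun n => match Equiv.natSumNatEquivNat.symm n with
      | Sum.inl n => Equiv.natSumNatEquivNat (Sum.inl n)
      | Sum.inr n => Equiv.natSumNatEquivNat (Sum.inr (Equiv.natSumNatEquivNat (Sum.inl n)))) := by
      refine mix_ext (fun n => ?_) fun n => ?_ <;>
      simp only [Function.comp, Equiv.symm_apply_apply, mix_inl, mix_inr]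
    have e2 : mix v q = mix v (mix p q) ∘ (fun n => match Equiv.natSumNatEquivNat.symm n with
      | Sum.inl n => Equiv.natSumNatEquivNat (Sum.inl n)
      | Sum.inr n => Equiv.natSumNatEquivNat (Sum.inr (Equiv.natSumNatEquivNat (Sum.inr n)))) := by
      refine mix_ext (fun n => ?_) fun n => ?_ <;>
      simp only [Function.comp, Equiv.symm_apply_apply, mix_inl, mix_inr]
    rw [← e1, ← e2]

instance instDfnEx (Q : (ℕ → M) → M → Prop)
    [h : Dfn C (fun v => Q (fun i => v (i + 1)) (v 0))] : Dfn C (fun v => ∃ x, Q v x) := by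
  obtain ⟨φ, p, hp, h⟩ := h.out
  refine ⟨Fml.ex (φ.rename (fun n => match Equiv.natSumNatEquivNat.symm n with
    | Sum.inl 0 => 0
    | Sum.inl (n + 1) => Equiv.natSumNatEquivNat (Sum.inl n) + 1
    | Sum.inr n => Equiv.natSumNatEquivNat (Sum.inr n) + 1)), p, hp,
    fun v => exists_congr fun x => ?_⟩
  have := h (scons x v)
  simp only [scons_zero, scons_succ] at this
  rw [this, Fml.real_rename]
  refine iff_of_eq (congrArg _ (mix_ext (fun n => ?_) fun n => ?_))
  · cases n <;>
    simp only [Function.comp, Equiv.symm_apply_apply, mix_inl, scons_zero, scons_succ]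
  · simp only [Function.comp, Equiv.symm_apply_apply, mix_inr, scons_succ]

instance instDfnMem (f g : (ℕ → M) → M) [hf : Trm C f] [hg : Trm C g] [Inhab C] :
    Dfn C (fun v => f v ε g v) := by
  obtain ⟨i, c, hc, h1⟩ := hf.index
  obtain ⟨j, d, hd, h2⟩ := hg.index
  refine ⟨Fml.mem (i 0) (j 1), scons c fun _ => d, fun n => ?_, fun v => ?_⟩
  · cases n <;> assumption
  · simp only [Fml.Real]
    rw [← h1 v (scons c fun _ => d) 0 rfl, ← h2 v (scons c fun _ => d) 1 rfl]

instance instDfnEq (f g : (ℕ → M) → M) [hf : Trm C f] [hg : Trm C g] [Inhab C] :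
    Dfn C (fun v => f v = g v) := by
  obtain ⟨i, c, hc, h1⟩ := hf.index
  obtain ⟨j, d, hd, h2⟩ := hg.index
  refine ⟨Fml.eq (i 0) (j 1), scons c fun _ => d, fun n => ?_, fun v => ?_⟩
  · cases n <;> assumption
  · simp only [Fml.Real]
    rw [← h1 v (scons c fun _ => d) 0 rfl, ← h2 v (scons c fun _ => d) 1 rfl]

instance instDfnNot (P : (ℕ → M) → Prop) [h : Dfn C P] : Dfn C (fun v => ¬ P v) :=
  (h.nand h).congr fun v => by tauto
instance instDfnAnd (P Q : (ℕ → M) → Prop) [hP : Dfn C P] [hQ : Dfn C Q] :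
    Dfn C (fun v => P v ∧ Q v) :=
  (instDfnNot _ (h := hP.nand hQ)).congr fun v => by tauto
instance instDfnOr (P Q : (ℕ → M) → Prop) [hP : Dfn C P] [hQ : Dfn C Q] :
    Dfn C (fun v => P v ∨ Q v) :=
  ((instDfnNot P).nand (instDfnNot Q)).congr fun v => by tauto
instance instDfnImp (P Q : (ℕ → M) → Prop) [hP : Dfn C P] [hQ : Dfn C Q] :
    Dfn C (fun v => P v → Q v) :=
  (hP.nand (instDfnNot Q)).congr fun v => by tauto
instance instDfnIff (P Q : (ℕ → M) → Prop) [hP : Dfn C P] [hQ : Dfn C Q] :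
    Dfn C (fun v => P v ↔ Q v) :=
  (instDfnAnd (fun v => P v → Q v) (fun v => Q v → P v)).congr fun v => by tauto
instance instDfnAll (Q : (ℕ → M) → M → Prop)
    [h : Dfn C (fun v => Q (fun i => v (i + 1)) (v 0))] : Dfn C (fun v => ∀ x, Q v x) :=
  (instDfnNot _ (h := instDfnEx (fun v x => ¬ Q v x) (h := instDfnNot _ (h := h)))).congr
    fun v => by push Not; rfl
instance (priority := low) instDfnConst (p : Prop) [Inhab C] : Dfn C (fun _ : ℕ → M => p) := by
  by_cases h : p
  · exact Dfn.congr (P := fun v => v 0 = v 0) inferInstance fun v => by simp [h]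
  · exact Dfn.congr (P := fun v => ¬ v 0 = v 0) inferInstance fun v => by simp [h]

/-- A definable family `A` of classes, indexed by the values of the variables. A single class `Q` is
treated as the constant family `fun _ => Q`. -/
class Dfn1 (C : M → Prop) (A : (ℕ → M) → M → Prop) : Prop where
  out : Dfn C (fun v => A (fun i => v (i + 1)) (v 0))

/-- A definable family of binary relations. -/
class Dfn2 (C : M → Prop) (A : (ℕ → M) → M → M → Prop) : Prop where
  out : Dfn C (fun v => A (fun i => v (i + 1 + 1)) (v 1) (v 0))

/-- A definable family of ternary relations. -/
class Dfn3 (C : M → Prop) (A : (ℕ → M) → M → M → M → Prop) : Prop where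
  out : Dfn C (fun v => A (fun i => v (i + 1 + 1 + 1)) (v 2) (v 1) (v 0))

instance (A : (ℕ → M) → M → Prop) [h : Dfn C (fun v => A (fun i => v (i + 1)) (v 0))] : Dfn1 C A :=
  ⟨h⟩
instance (A : (ℕ → M) → M → M → Prop)
    [h : Dfn C (fun v => A (fun i => v (i + 1 + 1)) (v 1) (v 0))] : Dfn2 C A := ⟨h⟩
instance (A : (ℕ → M) → M → M → M → Prop)
    [h : Dfn C (fun v => A (fun i => v (i + 1 + 1 + 1)) (v 2) (v 1) (v 0))] : Dfn3 C A := ⟨h⟩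

instance (priority := low) instDfnApp1 (A : (ℕ → M) → M → Prop) [h : Dfn1 C A] (σ : ℕ → ℕ)
    (f : (ℕ → M) → M) [Trm C f] [Inhab C] : Dfn C (fun v => A (fun i => v (σ i)) (f v)) := by
  have : Dfn C (fun v => A (fun i => v (σ i + 1)) (v 0)) :=
    h.out.comp (fun n => match n with | 0 => 0 | n + 1 => σ n + 1) fun v => Iff.rfl
  refine Dfn.congr (P := fun v => ∃ x, x = f v ∧ A (fun i => v (σ i)) x) inferInstance
    fun v => by simp

instance (priority := low) instDfnApp2 (A : (ℕ → M) → M → M → Prop) [h : Dfn2 C A] (σ : ℕ → ℕ)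
    (f g : (ℕ → M) → M) [Trm C f] [Trm C g] [Inhab C] :
    Dfn C (fun v => A (fun i => v (σ i)) (f v) (g v)) := by
  have : Dfn C (fun v => A (fun i => v (σ i + 1 + 1)) (v (0 + 1)) (v 0)) :=
    h.out.comp (fun n => match n with | 0 => 0 | 1 => 1 | n + 2 => σ n + 1 + 1) fun v => Iff.rfl
  refine Dfn.congr (P := fun v => ∃ x, ∃ y, (x = f v ∧ y = g v) ∧ A (fun i => v (σ i)) x y)
    inferInstance fun v => by simp

instance (priority := low) instDfnApp3 (A : (ℕ → M) → M → M → M → Prop) [h : Dfn3 C A] (σ : ℕ → ℕ)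
    (f g k : (ℕ → M) → M) [Trm C f] [Trm C g] [Trm C k] [Inhab C] :
    Dfn C (fun v => A (fun i => v (σ i)) (f v) (g v) (k v)) := by
  have : Dfn C (fun v => A (fun i => v (σ i + 1 + 1 + 1)) (v (0 + 1 + 1)) (v (0 + 1)) (v 0)) :=
    h.out.comp (fun n => match n with | 0 => 0 | 1 => 1 | 2 => 2 | n + 3 => σ n + 1 + 1 + 1)
      fun v => Iff.rfl
  refine Dfn.congr
    (P := fun v => ∃ x, ∃ y, ∃ z, (x = f v ∧ y = g v ∧ z = k v) ∧ A (fun i => v (σ i)) x y z)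
    inferInstance fun v => by simp

instance (priority := low) instDfnApp1c (A : M → Prop) [h : Dfn1 C (fun _ => A)]
    (f : (ℕ → M) → M) [Trm C f] [Inhab C] : Dfn C (fun v => A (f v)) :=
  instDfnApp1 (fun _ => A) id f
instance (priority := low) instDfnApp2c (A : M → M → Prop) [h : Dfn2 C (fun _ => A)]
    (f g : (ℕ → M) → M) [Trm C f] [Trm C g] [Inhab C] : Dfn C (fun v => A (f v) (g v)) :=
  instDfnApp2 (fun _ => A) id f g

end Dfn

/-! ### Definability of the notions of set theory -/

section Instances
variable {M : Type u} [SetStructure M] {C : M → Prop} [Inhab C]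
variable (f g h k l m : (ℕ → M) → M) [Trm C f] [Trm C g] [Trm C h] [Trm C k] [Trm C l] [Trm C m]
variable (A B : (ℕ → M) → M → Prop) [Dfn1 C A] [Dfn1 C B]
variable (H : (ℕ → M) → M → M → Prop) [Dfn2 C H]
variable (S : (ℕ → M) → M → M → M → Prop) [Dfn3 C S]

instance : Dfn C (fun v => IsEmp (f v)) := by unfold IsEmp; infer_instance
instance : Dfn C (fun v => Sub (f v) (g v)) := by unfold Sub; infer_instance
instance : Dfn C (fun v => IsPair (f v) (g v) (h v)) := by unfold IsPair; infer_instance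
instance : Dfn C (fun v => IsOPair (f v) (g v) (h v)) := by unfold IsOPair; infer_instance
instance : Dfn C (fun v => IsTriple (f v) (g v) (h v) (k v)) := by
  unfold IsTriple; infer_instance
instance : Dfn C (fun v => IsSucc (f v) (g v)) := by unfold IsSucc; infer_instance
instance : Dfn C (fun v => IsTrans (f v)) := by unfold IsTrans; infer_instance
instance : Dfn C (fun v => IsOrd (f v)) := by unfold IsOrd; infer_instance
instance : Dfn C (fun v => IsLimit (f v)) := by unfold IsLimit; infer_instance
instance : Dfn C (fun v => IsNat (f v)) := by unfold IsNat; infer_instance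
instance instDfnIsNum (n : ℕ) : Dfn C (fun v => IsNum n (f v)) := by
  induction n generalizing f with
  | zero => exact inferInstanceAs (Dfn C fun v => IsEmp (f v))
  | succ n ih => exact inferInstanceAs (Dfn C fun v => ∃ y, IsNum n y ∧ IsSucc (f v) y)
instance : Dfn C (fun v => App (f v) (g v) (h v)) := by unfold App; infer_instance
instance : Dfn C (fun v => IsFunction (f v)) := by unfold IsFunction; infer_instance
instance : Dfn C (fun v => IsMap (f v) (A v) (B v)) := by unfold IsMap; infer_instance
instance : Dfn C (fun v => IsSurj (f v) (A v) (B v)) := by unfold IsSurj; infer_instance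
instance : Dfn C (fun v => IsBij (f v) (A v) (B v)) := by unfold IsBij; infer_instance
instance : Dfn C (fun v => IsSeq (f v) (g v)) := by unfold IsSeq; infer_instance
instance : Dfn C (fun v => IsReal (f v)) := by unfold IsReal; infer_instance
instance : Dfn C (fun v => IsFinSeq (f v) (A v)) := by unfold IsFinSeq; infer_instance
instance : Dfn C (fun v => IsRestr (f v) (g v) (h v)) := by unfold IsRestr; infer_instance
instance : Dfn C (fun v => Univ (f v)) := by unfold Univ; infer_instance
instance : Dfn C (fun v => NoParam (f v)) := by unfold NoParam; infer_instance
instance : Dfn C (fun v => NoPred (f v) (g v)) := by unfold NoPred; infer_instance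
instance : Dfn C (fun v => IsInstr (f v)) := by unfold IsInstr; infer_instance
instance : Dfn C (fun v => IsCodeWithLast (f v) (g v)) := by unfold IsCodeWithLast; infer_instance
instance : Dfn C (fun v => IsCode (f v)) := by unfold IsCode; infer_instance
instance : Dfn C (fun v => IsAssign (f v) (g v)) := by unfold IsAssign; infer_instance
instance : Dfn C (fun v => IsUpd (f v) (g v) (h v) (k v)) := by unfold IsUpd; infer_instance
instance : Dfn C (fun v => Earlier (f v) (g v) (h v) (k v)) := by unfold Earlier; infer_instance
instance (n : (ℕ → M) → M) [Trm C n] :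
    Dfn C (fun v => Clause (f v) (H v) (g v) (h v) (k v) (l v) (m v) (n v)) := by
  unfold Clause; infer_instance
instance : Dfn C (fun v => IsEval (f v) (H v) (g v) (h v)) := by unfold IsEval; infer_instance
instance : Dfn C (fun v => Sat (f v) (H v) (g v) (h v)) := by unfold Sat; infer_instance
instance : Dfn C (fun v => DefinesSet (f v) (H v) (g v) (h v) (k v)) := by
  unfold DefinesSet; infer_instance
instance : Dfn C (fun v => IsDef (f v) (H v) (g v)) := by unfold IsDef; infer_instance
instance : Dfn C (fun v => IsHier (A v) (S v) (f v) (g v)) := by unfold IsHier; infer_instance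
instance : Dfn C (fun v => IsStage (A v) (S v) (f v) (g v)) := by unfold IsStage; infer_instance
instance : Dfn C (fun v => IsV (f v) (g v)) := by unfold IsV; infer_instance
instance : Dfn C (fun v => DefinedBy (A v) (f v) (g v) (h v) (k v)) := by
  unfold DefinedBy; infer_instance
instance : Dfn C (fun v => OD (A v) (f v)) := by unfold OD; infer_instance
instance : Dfn C (fun v => HOD (A v) (f v)) := by unfold HOD; infer_instance
instance : Dfn C (fun v => FinSeqLt (H v) (f v) (g v)) := by unfold FinSeqLt; infer_instance
instance : Dfn C (fun v => TripleLt (f v) (g v)) := by unfold TripleLt; infer_instance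
instance : Dfn C (fun v => DataLt (f v) (g v) (h v) (k v) (l v) (m v)) := by
  unfold DataLt; infer_instance
instance : Dfn C (fun v => IsLeastDef (f v) (g v) (h v) (k v)) := by
  unfold IsLeastDef; infer_instance
instance : Dfn C (fun v => HODLt (f v) (g v)) := by unfold HODLt; infer_instance
instance : Dfn C (fun v => IsNthHOD (f v) (g v)) := by unfold IsNthHOD; infer_instance
instance : Dfn C (fun v => HH (f v) (g v)) := by unfold HH; infer_instance
instance : Dfn C (fun v => CMinus (f v) (g v)) := by unfold CMinus; infer_instance
end Instances

/-! ### Sets in a model of `ZF` -/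

/-- `M` is a model of `ZF`, as a type class. -/
class ZF (M : Type u) [SetStructure M] : Prop where
  out : ModelsZF M

section Basic
variable {M : Type u} [SetStructure M]

/-- Definability by the formulas `Fml` is definability in the sense of Mathlib; the variables from
`k` on get the irrelevant value `c`. -/
theorem Dfn.definable {P : (ℕ → M) → Prop} (h : Dfn Univ P) (k : ℕ) (c : M) :
    Set.Definable Set.univ setLang
      {x : Fin k → M | P (fun i => if h : i < k then x ⟨i, h⟩ else c)} := by
  obtain ⟨φ, p, -, h⟩ := h.out
  obtain ⟨ψ, hψ⟩ := φ.exists_formula (N := M)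
  rw [Set.definable_iff_exists_formula_sum]
  refine ⟨ψ.relabel (fun n => match Equiv.natSumNatEquivNat.symm n with
    | Sum.inl i => if h : i < k then Sum.inr ⟨i, h⟩ else Sum.inl ⟨c, trivial⟩
    | Sum.inr i => Sum.inl ⟨p i, trivial⟩), ?_⟩
  ext x
  simp only [Set.mem_ofPred_eq, FirstOrder.Language.Formula.realize_relabel, h, hψ]
  refine iff_of_eq (congrArg _ (mix_ext (fun n => ?_) fun n => ?_))
  · simp only [Function.comp, Equiv.symm_apply_apply, mix_inl]
    split <;> rfl
  · simp only [Function.comp, Equiv.symm_apply_apply, mix_inr]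
    rfl

variable [hZ : ZF M]

instance : Nonempty M := ⟨hZ.out.infinity.choose⟩

theorem ext {x y : M} (h : ∀ z, z ε x ↔ z ε y) : x = y := hZ.out.extensionality x y h

theorem exists_sep (Q : M → Prop) [h : Dfn1 Univ (fun _ => Q)] (a : M) :
    ∃ b, ∀ x, x ε b ↔ x ε a ∧ Q x :=
  hZ.out.separation {x | Q x} (h.out.definable 1 a) a

theorem IsPair.unique {p q a b : M} (h : IsPair p a b) (h' : IsPair q a b) : p = q :=
  ext fun z => (h z).trans (h' z).symm

theorem exists_pair (a b : M) : ∃ p, IsPair p a b := hZ.out.pairing a b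

theorem exists_opair (a b : M) : ∃ p, IsOPair p a b := by
  obtain ⟨u, hu⟩ := exists_pair a a
  obtain ⟨v, hv⟩ := exists_pair a b
  obtain ⟨p, hp⟩ := exists_pair u v
  exact ⟨p, u, v, hu, hv, hp⟩

theorem IsOPair.unique {p q a b : M} (h : IsOPair p a b) (h' : IsOPair q a b) : p = q := by
  obtain ⟨u, v, hu, hv, hp⟩ := h
  obtain ⟨u', v', hu', hv', hp'⟩ := h'
  rw [hu.unique hu', hv.unique hv'] at hp
  exact hp.unique hp'

theorem IsPair.inj_right {p a b c : M} (h : IsPair p a b) (h' : IsPair p a c) : b = c := by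
  have h1 := (h' b).1 ((h b).2 (Or.inr rfl))
  have h2 := (h c).1 ((h' c).2 (Or.inr rfl))
  rcases h1 with h1 | h1
  · rcases h2 with h2 | h2
    · rw [h1, h2]
    · exact h2.symm
  · exact h1

theorem IsOPair.inj {p a b a' b' : M} (h : IsOPair p a b) (h' : IsOPair p a' b') :
    a = a' ∧ b = b' := by
  obtain ⟨u, v, hu, hv, hp⟩ := h
  obtain ⟨u', v', hu', hv', hp'⟩ := h'
  have ha : a = a' := by
    have h1 := (hp u').1 ((hp' u').2 (Or.inl rfl))
    have h2 := (hu' a').2 (Or.inl rfl)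
    have h3 := (hp' u).1 ((hp u).2 (Or.inl rfl))
    have h4 := (hu a).2 (Or.inl rfl)
    have h5 := (hv' a').2 (Or.inl rfl)
    grind [IsPair]
  subst ha
  have e : u = u' := hu.unique hu'
  subst e
  exact ⟨rfl, hv.inj_right (by rwa [hp.inj_right hp'])⟩

/-- The ordered pair. -/
noncomputable def op (a b : M) : M := (exists_opair a b).choose

theorem isOPair_iff {p a b : M} : IsOPair p a b ↔ p = op a b :=
  ⟨fun h => h.unique (exists_opair a b).choose_spec, fun h => h ▸ (exists_opair a b).choose_spec⟩

theorem op_inj {a b c d : M} : op a b = op c d ↔ a = c ∧ b = d := by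
  refine ⟨fun h => ?_, fun ⟨h1, h2⟩ => by rw [h1, h2]⟩
  exact (isOPair_iff.2 rfl : IsOPair (op a b) a b).inj (isOPair_iff.2 h)

theorem app_iff {f x y : M} : App f x y ↔ op x y ε f := by
  simp only [App, isOPair_iff, exists_eq_left]

theorem exists_union (a : M) : ∃ b, ∀ x, x ε b ↔ ∃ y, y ε a ∧ x ε y := hZ.out.union a

theorem exists_powerset (a : M) : ∃ b, ∀ x, x ε b ↔ Sub x a := hZ.out.powerset a

theorem exists_bunion (a b : M) : ∃ c, ∀ x, x ε c ↔ x ε a ∨ x ε b := by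
  obtain ⟨p, hp⟩ := exists_pair a b
  obtain ⟨c, hc⟩ := exists_union p
  refine ⟨c, fun x => (hc x).trans ?_⟩
  simp only [hp _, or_and_right, exists_or, exists_eq_left]

theorem exists_insert (a b : M) : ∃ c, ∀ x, x ε c ↔ x ε a ∨ x = b := by
  obtain ⟨p, hp⟩ := exists_pair b b
  obtain ⟨c, hc⟩ := exists_bunion a p
  exact ⟨c, fun x => (hc x).trans (by rw [hp, or_self])⟩

theorem exists_emp : ∃ z : M, IsEmp z := by
  obtain ⟨w, ⟨z, hz, -⟩, -⟩ := hZ.out.infinity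
  exact ⟨z, hz⟩

/-- The empty set. -/
noncomputable def emp : M := (exists_emp (M := M)).choose

theorem not_mem_emp (x : M) : ¬ x ε emp := (exists_emp (M := M)).choose_spec x

theorem isEmp_iff {z : M} : IsEmp z ↔ z = emp :=
  ⟨fun h => ext fun x => iff_of_false (h x) (not_mem_emp x), fun h => h ▸ not_mem_emp⟩

theorem exists_mem_of_ne_emp {x : M} (h : x ≠ emp) : ∃ y, y ε x := by
  by_contra h'
  push Not at h'
  exact h (isEmp_iff.1 h')

/-- The successor `a ∪ {a}`. -/
noncomputable def sc (a : M) : M := (exists_insert a a).choose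

theorem mem_sc {a x : M} : x ε sc a ↔ x ε a ∨ x = a := (exists_insert a a).choose_spec x

theorem isSucc_iff {s a : M} : IsSucc s a ↔ s = sc a :=
  ⟨fun h => ext fun x => (h x).trans mem_sc.symm, fun h x => h ▸ mem_sc⟩

theorem mem_sc_self (a : M) : a ε sc a := mem_sc.2 (Or.inr rfl)

/-- Replacement for relations that are functional on `a` but not necessarily total. -/
theorem exists_repl (R : M → M → Prop) [h : Dfn2 Univ (fun _ => R)] (a : M)
    (hf : ∀ x y y', x ε a → R x y → R x y' → y = y') :
    ∃ b, ∀ y, y ε b ↔ ∃ x, x ε a ∧ R x y := by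
  obtain ⟨a', ha'⟩ := exists_sep (fun x => ∃ y, R x y) a
  have hd : Dfn (Univ : M → Prop) (fun v => R (v 0) (v 1)) := inferInstance
  obtain ⟨b, hb⟩ := hZ.out.replacement {p : M × M | R p.1 p.2} (hd.definable 2 a) a' (by
    intro x hx
    obtain ⟨hx, y, hy⟩ := (ha' x).1 hx
    exact ⟨y, hy, fun z hz => hf x _ _ hx hz hy⟩)
  refine ⟨b, fun y => (hb y).trans (exists_congr fun x => ?_)⟩
  rw [ha']
  exact ⟨fun h => ⟨h.1.1, h.2⟩, fun h => ⟨⟨h.1, y, h.2⟩, h.2⟩⟩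

/-! ### Functions -/

theorem fun_ext {f g : M} (hf : IsFunction f) (hg : IsFunction g)
    (h : ∀ x y, App f x y ↔ App g x y) : f = g := by
  refine ext fun p => ⟨fun hp => ?_, fun hp => ?_⟩
  · obtain ⟨x, y, hxy⟩ := hf.1 p hp
    obtain rfl := isOPair_iff.1 hxy
    exact app_iff.1 ((h x y).1 (app_iff.2 hp))
  · obtain ⟨x, y, hxy⟩ := hg.1 p hp
    obtain rfl := isOPair_iff.1 hxy
    exact app_iff.1 ((h x y).2 (app_iff.2 hp))

theorem exists_fun (A : M) (R : M → M → Prop) [Dfn2 Univ (fun _ => R)]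
    (hf : ∀ x y y', x ε A → R x y → R x y' → y = y') :
    ∃ f, IsFunction f ∧ ∀ x y, App f x y ↔ x ε A ∧ R x y := by
  obtain ⟨f, hf'⟩ := exists_repl (fun x p => ∃ y, R x y ∧ IsOPair p x y) A (by
    rintro x p p' hx ⟨y, hy, hp⟩ ⟨y', hy', hp'⟩
    rw [isOPair_iff] at hp hp'
    rw [hp, hp', hf x y y' hx hy hy'])
  have happ : ∀ x y, App f x y ↔ x ε A ∧ R x y := by
    intro x y
    rw [app_iff, hf']
    constructor
    · rintro ⟨x', hx', y', hy, h⟩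
      obtain ⟨rfl, rfl⟩ := op_inj.1 (isOPair_iff.1 h)
      exact ⟨hx', hy⟩
    · rintro ⟨hx, hy⟩
      exact ⟨x, hx, y, hy, isOPair_iff.2 rfl⟩
  refine ⟨f, ⟨fun p hp => ?_, fun x y y' h h' => ?_⟩, happ⟩
  · obtain ⟨x, -, y, -, h⟩ := (hf' p).1 hp
    exact ⟨x, y, h⟩
  · rw [happ] at h h'
    exact hf x y y' h.1 h.2 h'.2

theorem exists_map (A : M) (R : M → M → Prop) [Dfn2 Univ (fun _ => R)] (B : M → Prop)
    (hf : ∀ x y y', x ε A → R x y → R x y' → y = y') (he : ∀ x, x ε A → ∃ y, R x y)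
    (hB : ∀ x y, x ε A → R x y → B y) :
    ∃ f, IsMap f (fun x => x ε A) B ∧ ∀ x y, App f x y ↔ x ε A ∧ R x y := by
  obtain ⟨f, h1, h2⟩ := exists_fun A R hf
  refine ⟨f, ⟨h1, fun x => ⟨?_, fun hx => ?_⟩, fun x y hxy => ?_⟩, h2⟩
  · rintro ⟨y, hy⟩; exact ((h2 x y).1 hy).1
  · obtain ⟨y, hy⟩ := he x hx
    exact ⟨y, (h2 x y).2 ⟨hx, hy⟩⟩
  · exact hB x y ((h2 x y).1 hxy).1 ((h2 x y).1 hxy).2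

theorem exists_prod (A B : M) : ∃ P, ∀ p, p ε P ↔ ∃ x y, x ε A ∧ y ε B ∧ p = op x y := by
  obtain ⟨Q, hQ⟩ := exists_repl (fun x P => ∀ p, p ε P ↔ ∃ y, y ε B ∧ IsOPair p x y) A (by
    intro _ P P' _ h h'
    exact ext fun p => (h p).trans (h' p).symm)
  obtain ⟨P, hP⟩ := exists_union Q
  refine ⟨P, fun p => (hP p).trans ⟨?_, ?_⟩⟩
  · rintro ⟨R, hR, hp⟩
    obtain ⟨x, hx, hR⟩ := (hQ R).1 hR
    obtain ⟨y, hy, h⟩ := (hR p).1 hp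
    exact ⟨x, y, hx, hy, isOPair_iff.1 h⟩
  · rintro ⟨x, y, hx, hy, rfl⟩
    obtain ⟨R, hR⟩ := exists_repl (fun y p => IsOPair p x y) B (by
      intro y p p' _ h h'; exact h.unique h')
    exact ⟨R, (hQ R).2 ⟨x, hx, hR⟩, (hR _).2 ⟨y, hy, isOPair_iff.2 rfl⟩⟩

theorem exists_maps (A B : M) :
    ∃ S, ∀ f, f ε S ↔ IsMap f (fun x => x ε A) (fun y => y ε B) := by
  obtain ⟨P, hP⟩ := exists_prod A B
  obtain ⟨Q, hQ⟩ := exists_powerset P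
  obtain ⟨S, hS⟩ := exists_sep (fun f => IsMap f (fun x => x ε A) (fun y => y ε B)) Q
  refine ⟨S, fun f => (hS f).trans ⟨fun h => h.2, fun h => ⟨(hQ f).2 fun p hp => ?_, h⟩⟩⟩
  obtain ⟨x, y, hxy⟩ := h.1.1 p hp
  obtain rfl := isOPair_iff.1 hxy
  have := app_iff.2 hp
  exact (hP _).2 ⟨x, y, (h.2.1 x).1 ⟨y, this⟩, h.2.2 x y this, rfl⟩

/-! ### Ordinals -/

theorem mem_irrefl (x : M) : ¬ x ε x := by
  intro h
  obtain ⟨p, hp⟩ := exists_pair x x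
  obtain ⟨y, hy, hy'⟩ := hZ.out.foundation p ⟨x, (hp x).2 (Or.inl rfl)⟩
  have : y = x := by rcases (hp y).1 hy with h | h <;> exact h
  subst this
  exact hy' y h hy

theorem mem_asymm {x y : M} (h : x ε y) : ¬ y ε x := by
  intro h'
  obtain ⟨p, hp⟩ := exists_pair x y
  obtain ⟨z, hz, hz'⟩ := hZ.out.foundation p ⟨x, (hp x).2 (Or.inl rfl)⟩
  rcases (hp z).1 hz with rfl | rfl
  · exact hz' _ h' ((hp _).2 (Or.inr rfl))
  · exact hz' _ h ((hp _).2 (Or.inl rfl))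

theorem IsOrd.mem {α β : M} (h : IsOrd α) (hβ : β ε α) : IsOrd β :=
  ⟨h.2 β hβ, fun y hy => h.2 y (h.1 β y hβ hy)⟩

theorem IsOrd.trans {α β γ : M} (h : IsOrd α) (h1 : γ ε β) (h2 : β ε α) : γ ε α := h.1 β γ h2 h1

theorem IsOrd.sc {α : M} (h : IsOrd α) : IsOrd (sc α) := by
  refine ⟨fun y z hy hz => ?_, fun y hy => ?_⟩
  · rw [mem_sc] at hy ⊢
    rcases hy with hy | rfl
    · exact Or.inl (h.trans hz hy)
    · exact Or.inl hz
  · rcases mem_sc.1 hy with hy | rfl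
    · exact h.2 y hy
    · exact h.1

theorem ord_min (Q : M → Prop) [Dfn1 Univ (fun _ => Q)] {α : M} (hα : IsOrd α) (h : Q α) :
    ∃ β, IsOrd β ∧ Q β ∧ ∀ γ, γ ε β → ¬ Q γ := by
  obtain ⟨b, hb⟩ := exists_sep Q (SetStructure.sc α)
  obtain ⟨β, hβ, hm⟩ := hZ.out.foundation b ⟨α, (hb α).2 ⟨mem_sc_self α, h⟩⟩
  have hβ' := (hb β).1 hβ
  refine ⟨β, hα.sc.mem hβ'.1, hβ'.2, fun γ hγ hQ => hm γ hγ ((hb γ).2 ⟨hα.sc.trans hγ hβ'.1, hQ⟩)⟩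

theorem ord_induction (Q : M → Prop) [Dfn1 Univ (fun _ => Q)]
    (h : ∀ α, IsOrd α → (∀ β, β ε α → Q β) → Q α) {α : M} (hα : IsOrd α) : Q α := by
  by_contra hn
  obtain ⟨β, hβ, hn, hm⟩ := ord_min (fun α => ¬ Q α) hα hn
  exact hn (h β hβ fun γ hγ => not_not.1 (hm γ hγ))

theorem ord_tri {α β : M} (hα : IsOrd α) (hβ : IsOrd β) : α ε β ∨ α = β ∨ β ε α := by
  by_contra hn
  obtain ⟨α, hα, ⟨β, hβ, hn⟩, hm⟩ :=
    ord_min (fun α => ∃ β, IsOrd β ∧ ¬ (α ε β ∨ α = β ∨ β ε α)) hα ⟨β, hβ, hn⟩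
  obtain ⟨β, hβ, hn, hm'⟩ := ord_min (fun β => ¬ (α ε β ∨ α = β ∨ β ε α)) hβ hn
  apply hn
  right; left
  refine ext fun z => ⟨fun hz => ?_, fun hz => ?_⟩
  · have := hm z hz
    push Not at this
    rcases this β hβ with h | rfl | h
    · exact h
    · exact (hn (Or.inr (Or.inr hz))).elim
    · exact (hn (Or.inr (Or.inr (hα.trans h hz)))).elim
  · have := hm' z hz
    rcases not_not.1 this with h | rfl | h
    · exact (hn (Or.inl (hβ.trans h hz))).elim
    · exact (hn (Or.inl hz)).elim
    · exact h

theorem sub_iff {α β : M} (hα : IsOrd α) (hβ : IsOrd β) : Sub α β ↔ α = β ∨ α ε β := by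
  constructor
  · intro h
    rcases ord_tri hα hβ with h' | h' | h'
    · exact Or.inr h'
    · exact Or.inl h'
    · exact (mem_irrefl β (h β h')).elim
  · rintro (rfl | h) z hz
    · exact hz
    · exact hβ.trans hz h

theorem not_mem_iff {α β : M} (hα : IsOrd α) (hβ : IsOrd β) : ¬ β ε α ↔ α = β ∨ α ε β := by
  constructor
  · intro h
    rcases ord_tri hα hβ with h' | h' | h'
    · exact Or.inr h'
    · exact Or.inl h'
    · exact (h h').elim
  · rintro (rfl | h)
    · exact mem_irrefl _
    · exact mem_asymm h

theorem isOrd_emp : IsOrd (emp : M) :=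
  ⟨fun y _ h => (not_mem_emp y h).elim, fun y h => (not_mem_emp y h).elim⟩

theorem sc_inj {a b : M} (ha : IsOrd a) (hb : IsOrd b) (h : sc a = sc b) : a = b := by
  have h1 : a ε sc b := h ▸ mem_sc_self a
  have h2 : b ε sc a := h ▸ mem_sc_self b
  rw [mem_sc] at h1 h2
  rcases h1 with h1 | h1
  · rcases h2 with h2 | h2
    · exact (mem_asymm h1 h2).elim
    · exact h2.symm
  · exact h1

theorem sc_ne_emp (a : M) : sc a ≠ emp := fun h => not_mem_emp a (h ▸ mem_sc_self a)

theorem isLimit_iff {α : M} : IsLimit α ↔ IsOrd α ∧ α ≠ emp ∧ ∀ y, α ≠ sc y := by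
  simp only [IsLimit, isSucc_iff]
  exact and_congr_right fun _ => and_congr_left fun _ =>
    ⟨fun ⟨y, hy⟩ h => not_mem_emp y (h ▸ hy), exists_mem_of_ne_emp⟩

theorem zero_succ_limit {α : M} (h : IsOrd α) :
    α = emp ∨ (∃ β, IsOrd β ∧ α = sc β) ∨ IsLimit α := by
  by_cases h0 : α = emp
  · exact Or.inl h0
  by_cases h1 : ∃ β, α = sc β
  · obtain ⟨β, rfl⟩ := h1
    exact Or.inr (Or.inl ⟨β, h.mem (mem_sc_self β), rfl⟩)
  · push Not at h1
    exact Or.inr (Or.inr (isLimit_iff.2 ⟨h, h0, h1⟩))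

theorem sc_sub {α β : M} (hα : IsOrd α) (h : β ε α) : α = sc β ∨ sc β ε α := by
  rcases ord_tri hα (hα.mem h).sc with h' | h' | h'
  · rcases mem_sc.1 h' with h' | rfl
    · exact (mem_asymm h h').elim
    · exact (mem_irrefl _ h).elim
  · exact Or.inl h'
  · exact Or.inr h'

theorem IsLimit.sc_mem {α β : M} (h : IsLimit α) (hβ : β ε α) : sc β ε α :=
  (sc_sub h.1 hβ).resolve_left ((isLimit_iff.1 h).2.2 β)

theorem IsLimit.emp_mem {α : M} (h : IsLimit α) : emp ε α := by
  rcases ord_tri h.1 isOrd_emp with h' | h' | h'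
  · exact (not_mem_emp _ h').elim
  · exact ((isLimit_iff.1 h).2.1 h').elim
  · exact h'

theorem ord_sup (a : M) (ha : ∀ x, x ε a → IsOrd x) :
    ∃ σ, IsOrd σ ∧ ∀ z, z ε σ ↔ ∃ x, x ε a ∧ z ε x := by
  obtain ⟨σ, hσ⟩ := exists_union a
  refine ⟨σ, ⟨fun y z hy hz => ?_, fun y hy => ?_⟩, hσ⟩
  · obtain ⟨x, hx, hy⟩ := (hσ y).1 hy
    exact (hσ z).2 ⟨x, hx, (ha x hx).trans hz hy⟩
  · obtain ⟨x, hx, hy⟩ := (hσ y).1 hy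
    exact (ha x hx).2 y hy

/-- A set of ordinals has a strict upper bound. -/
theorem ord_bound (a : M) : ∃ σ, IsOrd σ ∧ ∀ x, x ε a → IsOrd x → x ε σ := by
  obtain ⟨a', ha'⟩ := exists_sep IsOrd a
  obtain ⟨σ, hσ, h⟩ := ord_sup a' fun x hx => ((ha' x).1 hx).2
  refine ⟨sc σ, hσ.sc, fun x hx ho => mem_sc.2 ?_⟩
  rw [or_comm, ← sub_iff ho hσ]
  exact fun z hz => (h z).2 ⟨x, (ha' x).2 ⟨hx, ho⟩, hz⟩

/-! ### Natural numbers -/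

theorem isNat_emp : IsNat (emp : M) :=
  ⟨isOrd_emp, fun m hm => Or.inl (by
    rcases hm with rfl | h
    · exact not_mem_emp
    · exact (not_mem_emp m h).elim)⟩

theorem IsNat.mem {n m : M} (h : IsNat n) (hm : m ε n) : IsNat m :=
  ⟨h.1.mem hm, fun k hk => h.2 k (Or.inr (by
    rcases hk with rfl | hk
    · exact hm
    · exact h.1.trans hk hm))⟩

theorem IsNat.sc {n : M} (h : IsNat n) : IsNat (sc n) := by
  refine ⟨h.1.sc, fun m hm => ?_⟩
  rcases hm with rfl | hm
  · exact Or.inr ⟨n, isSucc_iff.2 rfl⟩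
  · rcases mem_sc.1 hm with hm | rfl
    · exact h.2 m (Or.inr hm)
    · exact h.2 _ (Or.inl rfl)

theorem IsNat.cases {n : M} (h : IsNat n) : n = emp ∨ ∃ m, IsNat m ∧ n = SetStructure.sc m := by
  rcases h.2 n (Or.inl rfl) with h' | ⟨m, hm⟩
  · exact Or.inl (isEmp_iff.1 h')
  · obtain rfl := isSucc_iff.1 hm
    exact Or.inr ⟨m, h.mem (mem_sc_self m), rfl⟩

theorem nat_induction (Q : M → Prop) [Dfn1 Univ (fun _ => Q)] (h0 : Q emp)
    (hs : ∀ n, IsNat n → Q n → Q (sc n)) {n : M} (hn : IsNat n) : Q n := by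
  by_contra hQ
  obtain ⟨m, -, ⟨hm, hmQ⟩, hmin⟩ := ord_min (fun n => IsNat n ∧ ¬ Q n) hn.1 ⟨hn, hQ⟩
  rcases hm.cases with rfl | ⟨k, hk, rfl⟩
  · exact hmQ h0
  · exact hmQ (hs k hk (by_contra fun h => hmin k (mem_sc_self k) ⟨hk, h⟩))

theorem exists_omega : ∃ w : M, ∀ n, n ε w ↔ IsNat n := by
  obtain ⟨w, ⟨z, hz, hzw⟩, hs⟩ := hZ.out.infinity
  obtain ⟨w', hw'⟩ := exists_sep IsNat w
  refine ⟨w', fun n => (hw' n).trans ⟨fun h => h.2, fun h => ⟨?_, h⟩⟩⟩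
  refine nat_induction (fun n => n ε w) (isEmp_iff.1 hz ▸ hzw) (fun n _ hn => ?_) h
  obtain ⟨y, hy, hyw⟩ := hs n hn
  exact isSucc_iff.1 hy ▸ hyw

/-- The set `ω` of the structure `M`, which may have nonstandard elements. -/
noncomputable def om : M := (exists_omega (M := M)).choose

theorem mem_om {n : M} : n ε om ↔ IsNat n := (exists_omega (M := M)).choose_spec n

theorem isOrd_om : IsOrd (om : M) :=
  ⟨fun y z hy hz => mem_om.2 ((mem_om.1 hy).mem hz), fun y hy => (mem_om.1 hy).1.1⟩

theorem isLimit_om : IsLimit (om : M) := by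
  refine isLimit_iff.2 ⟨isOrd_om, fun h => ?_, fun y h => ?_⟩
  · have h0 : (emp : M) ε om := mem_om.2 isNat_emp
    rw [h] at h0
    exact not_mem_emp _ h0
  have : y ε om := h ▸ mem_sc_self y
  have h2 := mem_om.2 (mem_om.1 this).sc
  rw [h] at h2
  exact mem_irrefl _ h2

/-- The least limit ordinal is `ω`. -/
theorem om_sub_limit {α : M} (h : IsLimit α) {n : M} (hn : IsNat n) : n ε α :=
  nat_induction (fun n => n ε α) h.emp_mem (fun _ _ h' => h.sc_mem h') hn

theorem exists_mapsNat (B : M) : ∃ S, ∀ s, s ε S ↔ IsSeq s B := by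
  obtain ⟨S, hS⟩ := exists_maps om B
  refine ⟨S, fun s => (hS s).trans ?_⟩
  simp only [mem_om, IsSeq]

/-- The numeral of a standard natural number. -/
noncomputable def num : ℕ → M
  | 0 => emp
  | n + 1 => sc (num n)

theorem isNum_iff {n : ℕ} {x : M} : IsNum n x ↔ x = num n := by
  induction n generalizing x with
  | zero => exact isEmp_iff
  | succ n ih => simp only [IsNum, ih, isSucc_iff, exists_eq_left, num]

theorem isNat_num (n : ℕ) : IsNat (num n : M) := by
  induction n with
  | zero => exact isNat_emp
  | succ n ih => exact ih.sc

theorem num_mem_num {m n : ℕ} : (num m : M) ε num n ↔ m < n := by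
  induction n with
  | zero => exact iff_of_false (not_mem_emp _) (by omega)
  | succ n ih =>
    rw [num, mem_sc, ih]
    constructor
    · rintro (h | h)
      · omega
      · by_contra hc
        have h3 : (num n : M) ε num m := by
          clear h ih
          obtain ⟨k, rfl⟩ : ∃ k, m = n + 1 + k := ⟨m - (n + 1), by omega⟩
          clear hc
          induction k with
          | zero => exact mem_sc_self _
          | succ k ih => exact mem_sc.2 (Or.inl ih)
        rw [h] at h3
        exact mem_irrefl _ h3
    · intro h
      rcases Nat.lt_or_ge m n with h | h
      · exact Or.inl h
      · right; congr 1; omega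

theorem num_inj {m n : ℕ} : (num m : M) = num n ↔ m = n := by
  refine ⟨fun h => ?_, fun h => h ▸ rfl⟩
  rcases Nat.lt_trichotomy m n with h' | h' | h'
  · exact (mem_irrefl (num n : M) (by nth_rewrite 1 [← h]; exact num_mem_num.2 h')).elim
  · exact h'
  · exact (mem_irrefl (num m : M) (by nth_rewrite 1 [h]; exact num_mem_num.2 h')).elim

theorem mem_num {n : ℕ} {x : M} : x ε num n ↔ ∃ m, m < n ∧ x = num m := by
  induction n with
  | zero => exact iff_of_false (not_mem_emp _) (by rintro ⟨m, h, -⟩; omega)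
  | succ n ih =>
    rw [num, mem_sc, ih]
    constructor
    · rintro (⟨m, h, rfl⟩ | rfl)
      · exact ⟨m, by omega, rfl⟩
      · exact ⟨n, by omega, rfl⟩
    · rintro ⟨m, h, rfl⟩
      rcases Nat.lt_or_ge m n with h' | h'
      · exact Or.inl ⟨m, h', rfl⟩
      · right; congr 1; omega

end Basic

/-! ### Recursion on the ordinals -/

section Hier
variable {M : Type u} [SetStructure M] [hZ : ZF M]
variable {base : M → Prop} {Step : M → M → M → Prop} [Dfn1 Univ (fun _ => base)]
  [Dfn3 Univ (fun _ => Step)]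

theorem hier_app {δ F β : M} (h : IsHier base Step δ F) (hβ : β ε δ) : ∃ X, App F β X :=
  (h.2.1.2.1 β).2 hβ

theorem hier_mem {δ F β X : M} (h : IsHier base Step δ F) (hβ : App F β X) : β ε δ :=
  (h.2.1.2.1 β).1 ⟨X, hβ⟩

theorem hier_unique {δ F δ' F' β X X' : M} (h : IsHier base Step δ F) (h' : IsHier base Step δ' F')
    (hX : App F β X) (hX' : App F' β X') : X = X' := by
  have key : ∀ β, IsOrd β → ∀ X X', App F β X → App F' β X' → X = X' := by
    intro β hβ
    refine ord_induction (fun β => ∀ X X', App F β X → App F' β X' → X = X') ?_ hβ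
    intro β hβ ih X X' hX hX'
    have t : ∀ γ Y, γ ε β → (App F γ Y ↔ App F' γ Y) := by
      intro γ Y hγ
      obtain ⟨Z, hZ⟩ := hier_app h (h.1.trans hγ (hier_mem h hX))
      obtain ⟨Z', hZ'⟩ := hier_app h' (h'.1.trans hγ (hier_mem h' hX'))
      obtain rfl := ih γ hγ Z Z' hZ hZ'
      constructor
      · intro hY; rwa [h.2.1.1.2 γ Y Z hY hZ]
      · intro hY; rwa [h'.2.1.1.2 γ Y Z hY hZ']
    refine ext fun x => (h.2.2 β X hX x).trans (Iff.trans ?_ (h'.2.2 β X' hX' x).symm)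
    refine or_congr_right (or_congr ?_ ?_)
    · refine exists_congr fun γ => exists_congr fun Y => and_congr_right fun hs => ?_
      rw [t γ Y ((hs γ).2 (Or.inr rfl))]
    · refine and_congr_right fun _ => exists_congr fun γ => exists_congr fun Y =>
        and_congr_right fun hγ => ?_
      rw [t γ Y hγ]
  exact key β (h.1.mem (hier_mem h hX)) X X' hX hX'

theorem IsStage.ord {β X : M} (h : IsStage base Step β X) : IsOrd β := by
  obtain ⟨δ, F, h, hX⟩ := h
  exact h.1.mem (hier_mem h hX)

theorem IsStage.unique {β X X' : M} (h : IsStage base Step β X) (h' : IsStage base Step β X') :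
    X = X' := by
  obtain ⟨δ, F, h, hX⟩ := h
  obtain ⟨δ', F', h', hX'⟩ := h'
  exact hier_unique h h' hX hX'

theorem IsStage.exists_mem {β γ X : M} (h : IsStage base Step β X) (hγ : γ ε β) :
    ∃ Y, IsStage base Step γ Y := by
  obtain ⟨δ, F, h, hX⟩ := h
  obtain ⟨Y, hY⟩ := hier_app h (h.1.trans hγ (hier_mem h hX))
  exact ⟨Y, δ, F, h, hY⟩

theorem IsStage.mem_iff {β X : M} (h : IsStage base Step β X) (x : M) : x ε X ↔
    (IsEmp β ∧ base x) ∨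
    (∃ γ Y, IsSucc β γ ∧ IsStage base Step γ Y ∧ Step γ Y x) ∨
    (IsLimit β ∧ ∃ γ Y, γ ε β ∧ IsStage base Step γ Y ∧ x ε Y) := by
  obtain ⟨δ, F, h, hX⟩ := h
  have t : ∀ γ Y, γ ε β → (App F γ Y ↔ IsStage base Step γ Y) := by
    intro γ Y hγ
    refine ⟨fun hY => ⟨δ, F, h, hY⟩, fun hY => ?_⟩
    obtain ⟨Z, hZ⟩ := hier_app h (h.1.trans hγ (hier_mem h hX))
    rwa [hY.unique ⟨δ, F, h, hZ⟩]
  rw [h.2.2 β X hX x]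
  refine or_congr_right (or_congr ?_ ?_)
  · refine exists_congr fun γ => exists_congr fun Y => and_congr_right fun hs => ?_
    rw [t γ Y ((hs γ).2 (Or.inr rfl))]
  · refine and_congr_right fun _ => exists_congr fun γ => exists_congr fun Y =>
      and_congr_right fun hγ => ?_
    rw [t γ Y hγ]

theorem stage_zero {X : M} (h : IsStage base Step emp X) (x : M) : x ε X ↔ base x := by
  rw [h.mem_iff]
  constructor
  · rintro (h | ⟨γ, Y, hs, -⟩ | ⟨hl, -⟩)
    · exact h.2
    · exact (sc_ne_emp γ (isSucc_iff.1 hs).symm).elim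
    · exact ((isLimit_iff.1 hl).2.1 rfl).elim
  · intro h
    exact Or.inl ⟨isEmp_iff.2 rfl, h⟩

theorem stage_succ {β X Y : M} (hY : IsStage base Step β Y) (h : IsStage base Step (sc β) X)
    (x : M) : x ε X ↔ Step β Y x := by
  rw [h.mem_iff]
  constructor
  · rintro (h' | ⟨γ, Z, hs, hZ, hx⟩ | ⟨hl, -⟩)
    · exact (sc_ne_emp β (isEmp_iff.1 h'.1)).elim
    · obtain rfl := sc_inj hY.ord hZ.ord (isSucc_iff.1 hs)
      rwa [hY.unique hZ]
    · exact ((isLimit_iff.1 hl).2.2 β rfl).elim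
  · intro h
    exact Or.inr (Or.inl ⟨β, Y, isSucc_iff.2 rfl, hY, h⟩)

theorem stage_limit {η X : M} (hη : IsLimit η) (h : IsStage base Step η X) (x : M) :
    x ε X ↔ ∃ γ Y, γ ε η ∧ IsStage base Step γ Y ∧ x ε Y := by
  rw [h.mem_iff]
  constructor
  · rintro (h' | ⟨γ, Z, hs, hZ, hx⟩ | ⟨hl, h⟩)
    · exact ((isLimit_iff.1 hη).2.1 (isEmp_iff.1 h'.1)).elim
    · exact ((isLimit_iff.1 hη).2.2 γ (isSucc_iff.1 hs)).elim
    · exact h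
  · intro h
    exact Or.inr (Or.inr ⟨hη, h⟩)

theorem stage_induction (R : M → M → Prop) [Dfn2 Univ (fun _ => R)]
    (h0 : ∀ X, (∀ x, x ε X ↔ base x) → R emp X)
    (hs : ∀ β Y X, IsStage base Step β Y → R β Y → (∀ x, x ε X ↔ Step β Y x) → R (sc β) X)
    (hl : ∀ η X, IsLimit η → (∀ γ Y, γ ε η → IsStage base Step γ Y → R γ Y) →
      (∀ x, x ε X ↔ ∃ γ Y, γ ε η ∧ IsStage base Step γ Y ∧ x ε Y) → R η X)
    {β X : M} (h : IsStage base Step β X) : R β X := by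
  refine ord_induction (fun β => ∀ X, IsStage base Step β X → R β X) ?_ h.ord X h
  intro β hβ ih X hX
  rcases zero_succ_limit hβ with rfl | ⟨γ, hγ, rfl⟩ | hlim
  · exact h0 X (stage_zero hX)
  · obtain ⟨Y, hY⟩ := hX.exists_mem (mem_sc_self γ)
    exact hs γ Y X hY (ih γ (mem_sc_self γ) Y hY) (stage_succ hY hX)
  · exact hl β X hlim (fun γ Y hγ => ih γ hγ Y) (stage_limit hlim hX)

/-- Transfinite recursion: all stages of a definable hierarchy with set-sized steps exist. -/
theorem exists_stage (hb : ∃ X, ∀ x, x ε X ↔ base x)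
    (hs : ∀ β Y, IsOrd β → ∃ X, ∀ x, x ε X ↔ Step β Y x) {β : M} (hβ : IsOrd β) :
    ∃ X, IsStage base Step β X := by
  refine ord_induction (fun β => ∃ X, IsStage base Step β X) ?_ hβ
  intro β hβ ih
  have hX : ∃ X, ∀ x, x ε X ↔
    (IsEmp β ∧ base x) ∨
    (∃ γ Y, IsSucc β γ ∧ IsStage base Step γ Y ∧ Step γ Y x) ∨
    (IsLimit β ∧ ∃ γ Y, γ ε β ∧ IsStage base Step γ Y ∧ x ε Y) := by
    rcases zero_succ_limit hβ with rfl | ⟨γ, hγ, rfl⟩ | hlim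
    · obtain ⟨X, hX⟩ := hb
      refine ⟨X, fun x => (hX x).trans ⟨fun h => Or.inl ⟨isEmp_iff.2 rfl, h⟩, ?_⟩⟩
      rintro (h | ⟨γ, Y, hs, -⟩ | ⟨hl, -⟩)
      · exact h.2
      · exact (sc_ne_emp γ (isSucc_iff.1 hs).symm).elim
      · exact ((isLimit_iff.1 hl).2.1 rfl).elim
    · obtain ⟨Y, hY⟩ := ih γ (mem_sc_self γ)
      obtain ⟨X, hX⟩ := hs γ Y hγ
      refine ⟨X, fun x => (hX x).trans
        ⟨fun h => Or.inr (Or.inl ⟨γ, Y, isSucc_iff.2 rfl, hY, h⟩), ?_⟩⟩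
      rintro (h' | ⟨γ', Z, hs, hZ, hx⟩ | ⟨hl, -⟩)
      · exact (sc_ne_emp γ (isEmp_iff.1 h'.1)).elim
      · obtain rfl := sc_inj hγ hZ.ord (isSucc_iff.1 hs)
        rwa [hY.unique hZ]
      · exact ((isLimit_iff.1 hl).2.2 γ rfl).elim
    · obtain ⟨S, hS⟩ := exists_repl (fun γ Y => IsStage base Step γ Y) β
        (fun γ Y Y' _ h h' => h.unique h')
      obtain ⟨X, hX⟩ := exists_union S
      refine ⟨X, fun x => (hX x).trans ⟨?_, ?_⟩⟩
      · rintro ⟨Y, hY, hx⟩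
        obtain ⟨γ, hγ, hY⟩ := (hS Y).1 hY
        exact Or.inr (Or.inr ⟨hlim, γ, Y, hγ, hY, hx⟩)
      · rintro (h' | ⟨γ', Z, hs, hZ, hx⟩ | ⟨hl, γ, Y, hγ, hY, hx⟩)
        · exact ((isLimit_iff.1 hlim).2.1 (isEmp_iff.1 h'.1)).elim
        · exact ((isLimit_iff.1 hlim).2.2 _ (isSucc_iff.1 hs)).elim
        · exact ⟨Y, (hS Y).2 ⟨γ, hγ, hY⟩, hx⟩
  obtain ⟨X, hX⟩ := hX
  obtain ⟨F, hF, hF'⟩ := exists_map (sc β)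
    (fun γ Y => (γ ε β ∧ IsStage base Step γ Y) ∨ (γ = β ∧ Y = X)) Univ (by
      rintro γ Y Y' - (⟨h1, h2⟩ | ⟨rfl, rfl⟩) (⟨h3, h4⟩ | ⟨h5, rfl⟩)
      · exact h2.unique h4
      · subst h5; exact (mem_irrefl _ h1).elim
      · exact (mem_irrefl _ h3).elim
      · rfl) (by
      intro γ hγ
      rcases mem_sc.1 hγ with hγ | rfl
      · obtain ⟨Y, hY⟩ := ih γ hγ
        exact ⟨Y, Or.inl ⟨hγ, hY⟩⟩
      · exact ⟨X, Or.inr ⟨rfl, rfl⟩⟩) (fun _ _ _ _ => trivial)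
  have t : ∀ γ Y, γ ε β → (App F γ Y ↔ IsStage base Step γ Y) := by
    intro γ Y hγ
    rw [hF']
    constructor
    · rintro ⟨-, ⟨-, h⟩ | ⟨rfl, -⟩⟩
      · exact h
      · exact (mem_irrefl _ hγ).elim
    · intro h
      exact ⟨mem_sc.2 (Or.inl hγ), Or.inl ⟨hγ, h⟩⟩
  have t2 : ∀ ζ, (ζ = β ∨ ζ ε β) → ∀ Z, (∀ x, x ε Z ↔ (IsEmp ζ ∧ base x) ∨
    (∃ γ Y, IsSucc ζ γ ∧ IsStage base Step γ Y ∧ Step γ Y x) ∨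
    (IsLimit ζ ∧ ∃ γ Y, γ ε ζ ∧ IsStage base Step γ Y ∧ x ε Y)) → ∀ x, x ε Z ↔
    (IsEmp ζ ∧ base x) ∨
    (∃ γ Y, IsSucc ζ γ ∧ App F γ Y ∧ Step γ Y x) ∨
    (IsLimit ζ ∧ ∃ γ Y, γ ε ζ ∧ App F γ Y ∧ x ε Y) := by
    intro ζ hζ Z hZ x
    have hsub : ∀ γ, γ ε ζ → γ ε β := by
      intro γ hγ
      rcases hζ with rfl | hζ
      · exact hγ
      · exact hβ.trans hγ hζ
    rw [hZ]
    refine or_congr_right (or_congr ?_ ?_)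
    · refine exists_congr fun γ => exists_congr fun Y => and_congr_right fun hs => ?_
      rw [t γ Y (hsub γ ((hs γ).2 (Or.inr rfl)))]
    · refine and_congr_right fun _ => exists_congr fun γ => exists_congr fun Y =>
        and_congr_right fun hγ => ?_
      rw [t γ Y (hsub γ hγ)]
  refine ⟨X, sc β, F, ⟨hβ.sc, hF, fun ζ Z hZ => ?_⟩, (hF' β X).2 ⟨mem_sc_self β, Or.inr ⟨rfl, rfl⟩⟩⟩
  rcases ((hF' ζ Z).1 hZ).2 with ⟨h1, h2⟩ | ⟨rfl, rfl⟩
  · exact t2 ζ (Or.inr h1) Z h2.mem_iff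
  · exact t2 ζ (Or.inl rfl) Z hX

/-- Hierarchies with increasing steps are increasing. -/
theorem stage_mono (hm : ∀ β Y x, IsStage base Step β Y → x ε Y → Step β Y x)
    {β γ X Y : M} (hX : IsStage base Step β X) (hY : IsStage base Step γ Y) (h : β = γ ∨ β ε γ) :
    Sub X Y := by
  revert h
  refine stage_induction (base := base) (Step := Step)
    (fun γ Y => (β = γ ∨ β ε γ) → Sub X Y) ?_ ?_ ?_ hY
  · rintro Y h (rfl | h')
    · exact fun x hx => (h x).2 ((stage_zero hX x).1 hx)
    · exact (not_mem_emp _ h').elim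
  · rintro γ Y Z hY ih h (rfl | h')
    · exact fun x hx => (h x).2 ((stage_succ hY hX x).1 hx)
    · intro x hx
      exact (h x).2 (hm _ _ _ hY (ih (mem_sc.1 h').symm x hx))
  · rintro η Y hη ih h (rfl | h')
    · exact fun x hx => (h x).2 ((stage_limit hη hX x).1 hx)
    · exact fun x hx => (h x).2 ⟨β, X, h', hX, hx⟩

end Hier

/-! ### The cumulative hierarchy -/

section Cumul
variable {M : Type u} [SetStructure M] [hZ : ZF M]

theorem exists_transitive (a : M) : ∃ T, IsTrans T ∧ Sub a T := by
  obtain ⟨T, hT⟩ := exists_stage (base := fun y => y ε a)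
    (Step := fun _ Y y => y ε Y ∨ ∃ z, z ε Y ∧ y ε z) ⟨a, fun x => Iff.rfl⟩ (fun β Y _ => by
      obtain ⟨U, hU⟩ := exists_union Y
      obtain ⟨W, hW⟩ := exists_bunion Y U
      exact ⟨W, fun x => by rw [hW, hU]⟩) (isOrd_om (M := M))
  have hm := stage_limit isLimit_om hT
  refine ⟨T, fun y z hy hz => ?_, fun x hx => ?_⟩
  · obtain ⟨n, Y, hn, hY, hyY⟩ := (hm y).1 hy
    have hn' := isLimit_om.sc_mem hn
    obtain ⟨Z, hZ⟩ := hT.exists_mem hn'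
    exact (hm z).2 ⟨_, Z, hn', hZ, (stage_succ hY hZ z).2 (Or.inr ⟨y, hyY, hz⟩)⟩
  · have h0 := (isLimit_om (M := M)).emp_mem
    obtain ⟨Z, hZ⟩ := hT.exists_mem h0
    exact (hm x).2 ⟨_, Z, h0, hZ, (stage_zero hZ x).2 hx⟩

theorem mem_induction (Q : M → Prop) [Dfn1 Univ (fun _ => Q)]
    (h : ∀ x, (∀ y, y ε x → Q y) → Q x) (x : M) : Q x := by
  by_contra hx
  obtain ⟨p, hp⟩ := exists_pair x x
  obtain ⟨T, hT, hpT⟩ := exists_transitive p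
  obtain ⟨B, hB⟩ := exists_sep (fun y => ¬ Q y) T
  obtain ⟨y, hy, hm⟩ := hZ.out.foundation B ⟨x, (hB x).2 ⟨hpT x ((hp x).2 (Or.inl rfl)), hx⟩⟩
  obtain ⟨hyT, hyQ⟩ := (hB y).1 hy
  exact hyQ (h y fun z hz => by_contra fun hzQ => hm z hz ((hB z).2 ⟨hT y z hyT hz, hzQ⟩))

theorem exists_isV {α : M} (hα : IsOrd α) : ∃ A, IsV α A :=
  exists_stage ⟨emp, fun x => iff_of_false (not_mem_emp x) id⟩ (fun _ Y _ => exists_powerset Y) hα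

theorem IsV.unique {α A B : M} (h : IsV α A) (h' : IsV α B) : A = B := IsStage.unique h h'

theorem IsV.ord {α A : M} (h : IsV α A) : IsOrd α := IsStage.ord h

theorem IsV.mem_sc {α A B : M} (h : IsV α A) (h' : IsV (sc α) B) (x : M) : x ε B ↔ Sub x A :=
  stage_succ h h' x

theorem IsV.trans {α A : M} (h : IsV α A) : IsTrans A := by
  refine stage_induction (base := fun _ : M => False) (Step := fun _ Y x => Sub x Y)
    (fun α A => IsTrans A) ?_ ?_ ?_ h
  · intro X hX y z hy
    exact ((hX y).1 hy).elim
  · intro β Y X hY hT hX y z hy hz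
    exact (hX z).2 fun w hw => hT z w ((hX y).1 hy z hz) hw
  · intro η X hη ih hX y z hy hz
    obtain ⟨γ, Y, hγ, hY, hyY⟩ := (hX y).1 hy
    exact (hX z).2 ⟨γ, Y, hγ, hY, ih γ Y hγ hY y z hyY hz⟩

theorem IsV.mono {α β A B : M} (h : IsV α A) (h' : IsV β B) (hαβ : α = β ∨ α ε β) : Sub A B :=
  stage_mono (fun _ _ x hY hx z hz => IsV.trans hY x z hx hz) h h' hαβ

theorem exists_mem_V (x : M) : ∃ α A, IsV α A ∧ x ε A := by
  refine mem_induction (fun x => ∃ α A, IsV α A ∧ x ε A) ?_ x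
  intro x ih
  obtain ⟨S, hS⟩ := exists_repl (fun y α => IsOrd α ∧ (∃ A, IsV α A ∧ y ε A) ∧
      ∀ β, β ε α → ¬ ∃ A, IsV β A ∧ y ε A) x (by
    rintro y α α' hy ⟨hα, h1, h2⟩ ⟨hα', h1', h2'⟩
    rcases ord_tri hα hα' with h | h | h
    · exact (h2' α h h1).elim
    · exact h
    · exact (h2 α' h h1').elim)
  obtain ⟨σ, hσ, hb⟩ := ord_bound S
  obtain ⟨A, hA⟩ := exists_isV hσ
  obtain ⟨B, hB⟩ := exists_isV hσ.sc
  refine ⟨_, B, hB, (hA.mem_sc hB x).2 fun y hy => ?_⟩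
  obtain ⟨α, A', hA', hyA⟩ := ih y hy
  obtain ⟨β, hβ, h1, h2⟩ := ord_min (fun α => ∃ A, IsV α A ∧ y ε A) hA'.ord ⟨A', hA', hyA⟩
  obtain ⟨A₂, hA₂, hy₂⟩ := h1
  exact hA₂.mono hA (Or.inr (hb β ((hS β).2 ⟨y, hy, hβ, ⟨A₂, hA₂, hy₂⟩, h2⟩) hβ)) y hy₂

/-- Collection for a relation to the ordinals that is monotone in the ordinal. -/
theorem collection (R : M → M → Prop) [Dfn2 Univ (fun _ => R)] (a : M)
    (hm : ∀ x γ γ', IsOrd γ' → γ ε γ' → R x γ → R x γ') (h : ∀ x, x ε a → ∃ γ, IsOrd γ ∧ R x γ) :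
    ∃ γ, IsOrd γ ∧ ∀ x, x ε a → R x γ := by
  obtain ⟨S, hS⟩ := exists_repl (fun y α => IsOrd α ∧ R y α ∧ ∀ β, β ε α → ¬ R y β) a (by
    rintro y α α' hy ⟨hα, h1, h2⟩ ⟨hα', h1', h2'⟩
    rcases ord_tri hα hα' with h | h | h
    · exact (h2' α h h1).elim
    · exact h
    · exact (h2 α' h h1').elim)
  obtain ⟨σ, hσ, hb⟩ := ord_bound S
  refine ⟨σ, hσ, fun x hx => ?_⟩
  obtain ⟨γ, hγ, hR⟩ := h x hx
  obtain ⟨β, hβ, h1, h2⟩ := ord_min (fun γ => R x γ) hγ hR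
  exact hm x β σ hσ (hb β ((hS β).2 ⟨x, hx, hβ, h1, h2⟩) hβ) h1

end Cumul

/-! ### Reflection -/

section Reflection
variable {M : Type u} [SetStructure M]

/-- The set `A`, as a structure for the language of set theory. -/
abbrev El (A : M) : Type u := {z : M // z ε A}

instance (A : M) : SetStructure (El A) := ⟨fun x y => x.1 ε y.1⟩

/-- Substitution of infinitely many terms at a time. -/
theorem Dfn.subst {C : M → Prop} [Inhab C] {P : (ℕ → M) → Prop} (h : Dfn C P)
    (g : (ℕ → M) → ℕ → M) (hg : ∀ n, Trm C (fun w => g w n)) : Dfn C (fun w => P (g w)) := by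
  obtain ⟨φ, p, hp, h⟩ := h.out
  choose i c hc hi using fun n => (hg n).index
  let e := Equiv.natSumNatEquivNat
  refine ⟨φ.rename (fun n => match e.symm n with
    | Sum.inl n => i n (e (Sum.inl n))
    | Sum.inr n => e (Sum.inr (e (Sum.inr n)))), mix c p, fun k => ?_, fun v => ?_⟩
  · obtain ⟨m, rfl⟩ := e.surjective k
    cases m <;> simp only [e, mix_inl, mix_inr, hp, hc]
  · rw [h, Fml.real_rename]
    refine iff_of_eq (congrArg _ (mix_ext (fun n => ?_) fun n => ?_))
    · simp only [e, Function.comp, Equiv.symm_apply_apply, mix_inl]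
      exact hi n v _ _ (mix_inl c p n)
    · simp only [e, Function.comp, Equiv.symm_apply_apply, mix_inr]

theorem Dfn.real {C : M → Prop} [hI : Inhab C] (φ : Fml) : Dfn C (fun v => φ.Real v) := by
  obtain ⟨c, hc⟩ := hI.out
  refine ⟨φ.rename (fun n => Equiv.natSumNatEquivNat (Sum.inl n)), fun _ => c, fun _ => hc,
    fun v => ?_⟩
  rw [Fml.real_rename]
  refine iff_of_eq (congrArg _ (funext fun n => ?_))
  simp only [Function.comp, mix_inl]

/-- `P` holds at all the assignments that extend `v` by `k` elements of `A`. -/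
def AllIn (A : M) : ℕ → ((ℕ → M) → Prop) → (ℕ → M) → Prop
  | 0, P, v => P v
  | k + 1, P, v => ∀ x, x ε A → AllIn A k P (scons x v)

theorem AllIn.mono {A : M} {k : ℕ} {P Q : (ℕ → M) → Prop} (h : ∀ v, P v → Q v) :
    ∀ {v}, AllIn A k P v → AllIn A k Q v := by
  induction k with
  | zero => exact fun {v} => h v
  | succ k ih => exact fun {v} hv x hx => ih (hv x hx)

theorem AllIn.apply {A : M} {k : ℕ} {P : (ℕ → M) → Prop} :
    ∀ {u : ℕ → M}, AllIn A k P u → ∀ v : ℕ → M, (∀ i, i < k → v i ε A) →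
      P (fun i => if i < k then v i else u (i - k)) := by
  induction k with
  | zero =>
    intro u h v _
    exact cast (congrArg P (funext fun i => by simp)) h
  | succ k ih =>
    intro u h v hv
    have := ih (h (v k) (hv k (by omega))) v fun i hi => hv i (by omega)
    refine cast (congrArg P (funext fun i => ?_)) this
    rcases Nat.lt_trichotomy i k with h' | h' | h'
    · simp only [h', if_true, show i < k + 1 by omega]
    · subst h'; simp
    · obtain ⟨j, rfl⟩ : ∃ j, i = k + 1 + j := ⟨i - (k + 1), by omega⟩
      rw [if_neg (by omega), if_neg (by omega), show k + 1 + j - k = j + 1 by omega,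
        show k + 1 + j - (k + 1) = j by omega]
      rfl

theorem AllIn.dfn (P : M → (ℕ → M) → Prop) (hP : Dfn Univ (fun w => P (w 0) (fun i => w (i + 2))))
    (k : ℕ) [Nonempty M] :
    Dfn Univ (fun w => AllIn (w 1) k (P (w 0)) (fun i => w (i + 2))) := by
  induction k with
  | zero => exact hP
  | succ k ih =>
    have : Dfn Univ (fun w : ℕ → M =>
        AllIn (w (1 + 1)) k (P (w (0 + 1))) (scons (w 0) (fun i => w (i + 2 + 1)))) :=
      ih.comp (fun n => match n with | 0 => 1 | 1 => 2 | 2 => 0 | n + 3 => n + 3) fun v => by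
        refine iff_of_eq (congrArg _ (funext fun i => ?_))
        cases i <;> rfl
    exact inferInstanceAs (Dfn Univ (fun w : ℕ → M =>
      ∀ x, x ε w 1 → AllIn (w 1) k (P (w 0)) (scons x (fun i => w (i + 2)))))

/-- `B` contains a witness of the existential formula `∃ φ` at `v` if there is one. -/
def Fml.Wit (φ : Fml) (B : M) (v : ℕ → M) : Prop :=
  (∃ x, φ.Real (scons x v)) → ∃ x, x ε B ∧ φ.Real (scons x v)

theorem Fml.Wit.dfn [Nonempty M] (φ : Fml) :
    Dfn Univ (fun w : ℕ → M => φ.Wit (w 0) (fun i => w (i + 2))) := by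
  have h : Dfn Univ (fun w : ℕ → M => φ.Real (scons (w 0) (fun i => w (i + 2 + 1)))) :=
    (Dfn.real φ).comp (fun n => match n with | 0 => 0 | n + 1 => n + 2 + 1) fun v => by
      refine iff_of_eq (congrArg _ (funext fun i => ?_))
      cases i <;> rfl
  exact inferInstanceAs (Dfn Univ (fun w : ℕ → M =>
    (∃ x, φ.Real (scons x (fun i => w (i + 2)))) →
      ∃ x, x ε w 0 ∧ φ.Real (scons x (fun i => w (i + 2)))))

/-- `B` contains witnesses for the existential subformulas of a formula at all assignments
in `A`. -/
def Fml.Closed : Fml → M → M → Prop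
  | mem _ _, _, _ => True
  | eq _ _, _, _ => True
  | nand φ ψ, A, B => φ.Closed A B ∧ ψ.Closed A B
  | ex φ, A, B => φ.Closed A B ∧ AllIn A φ.bd (φ.Wit B) (fun _ => A)

theorem Fml.Closed.mono {φ : Fml} {A B B' : M} (hB : Sub B B') (h : φ.Closed A B) :
    φ.Closed A B' := by
  induction φ with
  | mem i j => trivial
  | eq i j => trivial
  | nand φ ψ h1 h2 => exact ⟨h1 h.1, h2 h.2⟩
  | ex φ ih =>
    refine ⟨ih h.1, h.2.mono fun v hv he => ?_⟩
    obtain ⟨x, hx, h'⟩ := hv he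
    exact ⟨x, hB x hx, h'⟩

instance Fml.Closed.dfn [Nonempty M] (φ : Fml) (f g : (ℕ → M) → M) [Trm Univ f] [Trm Univ g] :
    Dfn Univ (fun v => φ.Closed (f v) (g v)) := by
  induction φ with
  | mem i j => exact inferInstanceAs (Dfn Univ (fun _ : ℕ → M => True))
  | eq i j => exact inferInstanceAs (Dfn Univ (fun _ : ℕ → M => True))
  | nand φ ψ h1 h2 =>
    exact inferInstanceAs (Dfn Univ (fun v => φ.Closed (f v) (g v) ∧ ψ.Closed (f v) (g v)))
  | ex φ ih =>
    have := (AllIn.dfn _ (Fml.Wit.dfn (M := M) φ) φ.bd).subst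
      (fun v n => match n with | 0 => g v | _ + 1 => f v) fun n => by
        cases n <;> exact inferInstanceAs (Trm Univ _)
    exact inferInstanceAs (Dfn Univ (fun v => φ.Closed (f v) (g v) ∧
      AllIn (f v) φ.bd (φ.Wit (g v)) (fun _ => f v)))

variable [hZ : ZF M]

theorem exists_allIn_wit (φ : Fml) (A : M) (k : ℕ) (v : ℕ → M) :
    ∃ γ, IsOrd γ ∧ ∃ B, IsV γ B ∧ AllIn A k (φ.Wit B) v := by
  induction k generalizing v with
  | zero =>
    by_cases h : ∃ x, φ.Real (scons x v)
    · obtain ⟨x, hx⟩ := h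
      obtain ⟨γ, B, hB, hxB⟩ := exists_mem_V x
      exact ⟨γ, hB.ord, B, hB, fun _ => ⟨x, hxB, hx⟩⟩
    · obtain ⟨B, hB⟩ := exists_isV (isOrd_emp (M := M))
      exact ⟨_, isOrd_emp, B, hB, fun h' => (h h').elim⟩
  | succ k ih =>
    have hd : Dfn Univ (fun w : ℕ → M => AllIn A k (φ.Wit (w 0)) (scons (w 2) v)) := by
      refine (AllIn.dfn _ (Fml.Wit.dfn (M := M) φ) k).subst (fun w n => match n with
        | 0 => w 0 | 1 => A | 2 => w 2 | n + 3 => v n) (fun n => ?_) |>.congr fun w => ?_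
      · rcases n with _ | _ | _ | n <;> exact inferInstanceAs (Trm Univ _)
      · refine iff_of_eq (congrArg _ (funext fun i => ?_))
        cases i <;> rfl
    obtain ⟨γ, hγ, h⟩ := collection
      (fun x γ => ∃ B, IsV γ B ∧ AllIn A k (φ.Wit B) (scons x v)) A (by
        rintro x γ γ' hγ' hγ ⟨B, hB, h⟩
        obtain ⟨B', hB'⟩ := exists_isV hγ'
        refine ⟨B', hB', h.mono fun w hw he => ?_⟩
        obtain ⟨y, hy, h'⟩ := hw he
        exact ⟨y, hB.mono hB' (Or.inr hγ) y hy, h'⟩) fun x _ => ih (scons x v)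
    obtain ⟨B, hB⟩ := exists_isV hγ
    refine ⟨γ, hγ, B, hB, fun x hx => ?_⟩
    obtain ⟨B', hB', h'⟩ := h x hx
    rwa [hB.unique hB']

theorem exists_ord_above {γ γ' : M} (h : IsOrd γ) (h' : IsOrd γ') :
    ∃ δ, IsOrd δ ∧ γ ε δ ∧ γ' ε δ := by
  obtain ⟨p, hp⟩ := exists_pair γ γ'
  obtain ⟨σ, hσ, hb⟩ := ord_bound p
  exact ⟨σ, hσ, hb _ ((hp _).2 (Or.inl rfl)) h, hb _ ((hp _).2 (Or.inr rfl)) h'⟩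

theorem exists_closed (φ : Fml) (A : M) : ∃ γ, IsOrd γ ∧ ∃ B, IsV γ B ∧ φ.Closed A B := by
  induction φ with
  | mem i j =>
    obtain ⟨B, hB⟩ := exists_isV (isOrd_emp (M := M))
    exact ⟨_, isOrd_emp, B, hB, trivial⟩
  | eq i j =>
    obtain ⟨B, hB⟩ := exists_isV (isOrd_emp (M := M))
    exact ⟨_, isOrd_emp, B, hB, trivial⟩
  | nand φ ψ h1 h2 =>
    obtain ⟨γ, hγ, B, hB, h⟩ := h1
    obtain ⟨γ', hγ', B', hB', h'⟩ := h2
    obtain ⟨δ, hδ, h3, h4⟩ := exists_ord_above hγ hγ'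
    obtain ⟨D, hD⟩ := exists_isV hδ
    exact ⟨δ, hδ, D, hD, h.mono (hB.mono hD (Or.inr h3)), h'.mono (hB'.mono hD (Or.inr h4))⟩
  | ex φ h1 =>
    obtain ⟨γ, hγ, B, hB, h⟩ := h1
    obtain ⟨γ', hγ', B', hB', h'⟩ := exists_allIn_wit φ A φ.bd (fun _ => A)
    obtain ⟨δ, hδ, h3, h4⟩ := exists_ord_above hγ hγ'
    obtain ⟨D, hD⟩ := exists_isV hδ
    refine ⟨δ, hδ, D, hD, h.mono (hB.mono hD (Or.inr h3)), h'.mono fun w hw he => ?_⟩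
    obtain ⟨y, hy, h'⟩ := hw he
    exact ⟨y, hB'.mono hD (Or.inr h4) y hy, h'⟩

/-- The Tarski–Vaught test. -/
theorem Fml.real_iff_of_closed (φ : Fml) (T : M)
    (h : ∀ (K : ℕ) (v : ℕ → M), (∀ i, i < K → v i ε T) →
      ∃ A B, φ.Closed A B ∧ Sub B T ∧ ∀ i, i < K → v i ε A) (v : ℕ → El T) :
    φ.Real v ↔ φ.Real (fun i => (v i : M)) := by
  induction φ generalizing v with
  | mem i j => exact Iff.rfl
  | eq i j => exact Subtype.ext_iff
  | nand φ ψ h1 h2 =>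
    have e1 := h1 (fun K v hv => by
      obtain ⟨A, B, hc, h'⟩ := h K v hv; exact ⟨A, B, hc.1, h'⟩) v
    have e2 := h2 (fun K v hv => by
      obtain ⟨A, B, hc, h'⟩ := h K v hv; exact ⟨A, B, hc.2, h'⟩) v
    simp only [Fml.Real, e1, e2]
  | ex φ ih =>
    have e1 := ih (fun K v hv => by
      obtain ⟨A, B, hc, h'⟩ := h K v hv; exact ⟨A, B, hc.1, h'⟩)
    have e2 : ∀ x : El T, (fun i => ((scons x v) i : M)) = scons (x : M) (fun i => (v i : M)) := by
      intro x; funext i; cases i <;> rfl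
    simp only [Fml.Real, e1, e2]
    constructor
    · rintro ⟨x, hx⟩; exact ⟨x, hx⟩
    · rintro ⟨x, hx⟩
      obtain ⟨A, B, hc, hB, hv⟩ := h φ.bd (fun i => (v i : M)) fun i _ => (v i).2
      have hw := hc.2.apply (fun i => (v i : M)) hv
      have hcg : ∀ y : M, φ.Real (scons y (fun i => if i < φ.bd then (v i : M) else A)) ↔
          φ.Real (scons y (fun i => (v i : M))) := by
        intro y
        refine φ.real_congr _ _ fun i hi => ?_
        cases i with
        | zero => rfl
        | succ i => simp only [scons_succ, show i < φ.bd by omega, if_true]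
      obtain ⟨y, hy, hy'⟩ := hw ⟨x, (hcg x).2 hx⟩
      exact ⟨⟨y, hB y hy⟩, (hcg y).1 hy'⟩

/-- The reflection principle for a single formula: `θ` is the limit of an `ω`-sequence of ordinals
whose levels contain witnesses for all existential subformulas over the preceding level. -/
theorem reflection (φ : Fml) {α : M} (hα : IsOrd α) :
    ∃ θ A, IsLimit θ ∧ α ε θ ∧ IsV θ A ∧
      ∀ v : ℕ → El A, φ.Real v ↔ φ.Real (fun i => (v i : M)) := by
  let N : M → M → Prop := fun Y γ => Y ε γ ∧ ∃ A B, IsV Y A ∧ IsV γ B ∧ φ.Closed A B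
  have hN : ∀ Y, IsOrd Y → ∃ γ, IsOrd γ ∧ N Y γ := by
    intro Y hY
    obtain ⟨A, hA⟩ := exists_isV hY
    obtain ⟨γ, hγ, B, hB, h⟩ := exists_closed φ A
    obtain ⟨δ, hδ, h3, h4⟩ := exists_ord_above hγ hY
    obtain ⟨D, hD⟩ := exists_isV hδ
    exact ⟨δ, hδ, h4, A, D, hA, hD, h.mono (hB.mono hD (Or.inr h3))⟩
  let LN : M → M → Prop := fun Y γ => IsOrd γ ∧
    (Y ε γ ∧ ∃ A B, IsV Y A ∧ IsV γ B ∧ φ.Closed A B) ∧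
      ∀ β, β ε γ → ¬ (Y ε β ∧ ∃ A B, IsV Y A ∧ IsV β B ∧ φ.Closed A B)
  have hLN : Dfn2 Univ (fun _ => LN) :=
    inferInstanceAs (Dfn2 (Univ : M → Prop) (fun _ Y γ => IsOrd γ ∧
    (Y ε γ ∧ ∃ A B, IsV Y A ∧ IsV γ B ∧ φ.Closed A B) ∧
      ∀ β, β ε γ → ¬ (Y ε β ∧ ∃ A B, IsV Y A ∧ IsV β B ∧ φ.Closed A B)))
  have hLe : ∀ Y, IsOrd Y → ∃ γ, LN Y γ := by
    intro Y hY
    obtain ⟨γ, hγ, h⟩ := hN Y hY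
    obtain ⟨β, hβ, h1, h2⟩ := ord_min
      (fun γ => Y ε γ ∧ ∃ A B, IsV Y A ∧ IsV γ B ∧ φ.Closed A B) hγ h
    exact ⟨β, hβ, h1, h2⟩
  have hLu : ∀ Y γ γ', LN Y γ → LN Y γ' → γ = γ' := by
    intro Y γ γ' h h'
    rcases ord_tri h.1 h'.1 with h1 | h1 | h1
    · exact (h'.2.2 γ h1 h.2.1).elim
    · exact h1
    · exact (h.2.2 γ' h1 h'.2.1).elim
  have hLo : ∀ {Y γ}, LN Y γ → IsOrd γ := fun h => h.1
  have hLm : ∀ {Y γ}, LN Y γ → Y ε γ := fun h => h.2.1.1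
  have hLc : ∀ {Y γ}, LN Y γ → ∃ A B, IsV Y A ∧ IsV γ B ∧ φ.Closed A B := fun h => h.2.1.2
  clear_value LN
  let St : M → M → Prop := IsStage (fun x => x ε sc α) (fun _ Y x => ∃ γ, LN Y γ ∧ x ε γ)
  have hex : ∀ β : M, IsOrd β → ∃ X, St β X := fun β hβ =>
    exists_stage ⟨_, fun x => Iff.rfl⟩ (fun β Y _ => by
      by_cases h : ∃ γ, LN Y γ
      · obtain ⟨γ, hγ⟩ := h
        exact ⟨γ, fun x => ⟨fun hx => ⟨γ, hγ, hx⟩, fun ⟨γ', hγ', hx⟩ => hLu _ _ _ hγ hγ' ▸ hx⟩⟩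
      · exact ⟨emp, fun x => iff_of_false (not_mem_emp x) fun ⟨γ, hγ, _⟩ => h ⟨γ, hγ⟩⟩) hβ
  have hord : ∀ β X, St β X → IsOrd X ∧ α ε X := by
    intro β X hX
    refine stage_induction (base := fun x => x ε sc α) (Step := fun _ Y x => ∃ γ, LN Y γ ∧ x ε γ)
      (fun β X => IsOrd X ∧ α ε X) ?_ ?_ ?_ hX
    · intro X hX
      obtain rfl : X = sc α := ext hX
      exact ⟨hα.sc, mem_sc_self α⟩
    · intro β Y X hY ih hX
      obtain ⟨γ, hγ⟩ := hLe Y ih.1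
      obtain rfl : X = γ := ext fun x => (hX x).trans
        ⟨fun ⟨γ', hγ', hx⟩ => hLu _ _ _ hγ hγ' ▸ hx, fun hx => ⟨γ, hγ, hx⟩⟩
      exact ⟨hLo hγ, (hLo hγ).trans ih.2 (hLm hγ)⟩
    · intro η X hη ih hX
      obtain ⟨Z, hZ⟩ := hex _ (isOrd_emp (M := M))
      refine ⟨⟨fun y z hy hz => ?_, fun y hy => ?_⟩,
        (hX α).2 ⟨_, Z, hη.emp_mem, hZ, (ih _ Z hη.emp_mem hZ).2⟩⟩
      · obtain ⟨γ, Y, hγ, hY, hyY⟩ := (hX y).1 hy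
        exact (hX z).2 ⟨γ, Y, hγ, hY, (ih γ Y hγ hY).1.trans hz hyY⟩
      · obtain ⟨γ, Y, hγ, hY, hyY⟩ := (hX y).1 hy
        exact (ih γ Y hγ hY).1.2 y hyY
  have hsucc : ∀ β X X', St β X → St (sc β) X' → LN X X' := by
    intro β X X' hX hX'
    obtain ⟨γ, hγ⟩ := hLe X (hord _ _ hX).1
    obtain rfl : X' = γ := ext fun x => (stage_succ hX hX' x).trans
      ⟨fun ⟨γ', hγ', hx⟩ => hLu _ _ _ hγ hγ' ▸ hx, fun hx => ⟨γ, hγ, hx⟩⟩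
    exact hγ
  have hmono : ∀ β γ X Y, St β X → St γ Y → (β = γ ∨ β ε γ) → Sub X Y := by
    intro β γ X Y hX hY h
    refine stage_mono (fun β Y x hY hx => ?_) hX hY h
    obtain ⟨γ, hγ⟩ := hLe Y (hord _ _ hY).1
    exact ⟨γ, hγ, (hLo hγ).trans hx (hLm hγ)⟩
  obtain ⟨θ, hθ⟩ := hex _ (isOrd_om (M := M))
  have hm := stage_limit isLimit_om hθ
  have hmem : ∀ n X, IsNat n → St n X → X ε θ := by
    intro n X hn hX
    obtain ⟨X', hX'⟩ := hex _ hn.sc.1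
    exact (hm X).2 ⟨_, X', mem_om.2 hn.sc, hX', hLm (hsucc n X X' hX hX')⟩
  have hθl : IsLimit θ := by
    refine isLimit_iff.2 ⟨(hord _ _ hθ).1, fun h => not_mem_emp α (h ▸ (hord _ _ hθ).2), ?_⟩
    intro y hy
    obtain ⟨n, X, hn, hX, hyX⟩ := (hm y).1 (hy ▸ mem_sc_self y)
    have := hmem n X (mem_om.1 hn) hX
    rw [hy, mem_sc] at this
    rcases this with h | rfl
    · exact mem_asymm h hyX
    · exact mem_irrefl _ hyX
  obtain ⟨T, hT⟩ := exists_isV hθl.1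
  refine ⟨θ, T, hθl, (hord _ _ hθ).2, hT, fun v => φ.real_iff_of_closed T (fun K v hv => ?_) v⟩
  have key : ∃ n X A, IsNat n ∧ St n X ∧ IsV X A ∧ ∀ i, i < K → v i ε A := by
    induction K with
    | zero =>
      obtain ⟨X, hX⟩ := hex _ (isOrd_emp (M := M))
      obtain ⟨A, hA⟩ := exists_isV (hord _ _ hX).1
      exact ⟨_, X, A, isNat_emp, hX, hA, fun i hi => by omega⟩
    | succ K ih =>
      obtain ⟨n, X, A, hn, hX, hA, h⟩ := ih fun i hi => hv i (by omega)
      obtain ⟨γ, A', hγ, hA', h'⟩ := (stage_limit hθl hT (v K)).1 (hv K (by omega))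
      obtain ⟨m, Y, hm', hY, hγY⟩ := (hm γ).1 hγ
      have hm' := mem_om.1 hm'
      obtain ⟨B, hB⟩ := exists_isV (hord _ _ hY).1
      have hKB : v K ε B := IsV.mono hA' hB (Or.inr hγY) _ h'
      rcases ord_tri hn.1 hm'.1 with hnm | rfl | hnm
      · refine ⟨m, Y, B, hm', hY, hB, fun i hi => ?_⟩
        rcases Nat.lt_or_ge i K with hi' | hi'
        · exact hA.mono hB ((sub_iff (hord _ _ hX).1 (hord _ _ hY).1).1
            (hmono _ _ _ _ hX hY (Or.inr hnm))) _ (h i hi')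
        · obtain rfl : i = K := by omega
          exact hKB
      · obtain rfl := hX.unique hY
        obtain rfl := hA.unique hB
        refine ⟨n, X, A, hn, hX, hA, fun i hi => ?_⟩
        rcases Nat.lt_or_ge i K with hi' | hi'
        · exact h i hi'
        · obtain rfl : i = K := by omega
          exact hKB
      · refine ⟨n, X, A, hn, hX, hA, fun i hi => ?_⟩
        rcases Nat.lt_or_ge i K with hi' | hi'
        · exact h i hi'
        · obtain rfl : i = K := by omega
          exact hB.mono hA ((sub_iff (hord _ _ hY).1 (hord _ _ hX).1).1
            (hmono _ _ _ _ hY hX (Or.inr hnm))) _ hKB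
  obtain ⟨n, X, A, hn, hX, hA, h⟩ := key
  obtain ⟨X', hX'⟩ := hex _ hn.sc.1
  obtain ⟨A₂, B, hA₂, hB, hc⟩ := hLc (hsucc n X X' hX hX')
  obtain rfl := hA.unique hA₂
  exact ⟨A, B, hc, hB.mono hT (Or.inr (hmem _ _ hn.sc hX')), h⟩

end Reflection

/-! ### Coded formulas -/

section Code
variable {M : Type u} [SetStructure M] [hZ : ZF M]

theorem exists_extend {f x y : M} (hf : IsFunction f) (hx : ∀ y, ¬ App f x y) :
    ∃ g, IsFunction g ∧ ∀ u v, App g u v ↔ App f u v ∨ (u = x ∧ v = y) := by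
  obtain ⟨g, hg⟩ := exists_insert f (op x y)
  have h : ∀ u v, App g u v ↔ App f u v ∨ (u = x ∧ v = y) := fun u v => by
    simp only [app_iff, hg, op_inj]
  refine ⟨g, ⟨fun p hp => ?_, fun u v v' h1 h2 => ?_⟩, h⟩
  · rcases (hg p).1 hp with h | rfl
    · exact hf.1 p h
    · exact ⟨x, y, isOPair_iff.2 rfl⟩
  · rcases (h _ _).1 h1 with h1 | ⟨rfl, rfl⟩
    · rcases (h _ _).1 h2 with h2 | ⟨rfl, rfl⟩
      · exact hf.2 _ _ _ h1 h2
      · exact (hx _ h1).elim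
    · rcases (h _ _).1 h2 with h2 | ⟨-, rfl⟩
      · exact (hx _ h2).elim
      · rfl

theorem exists_finseq (p : ℕ → M) (K : ℕ) :
    ∃ f, IsFunction f ∧ ∀ x y, App f x y ↔ ∃ i, i < K ∧ x = num i ∧ y = p i := by
  induction K with
  | zero =>
    have h : ∀ x y : M, ¬ App emp x y := fun x y h => not_mem_emp _ (app_iff.1 h)
    exact ⟨emp, ⟨fun p hp => (not_mem_emp p hp).elim, fun x y y' h' => (h x y h').elim⟩,
      fun x y => iff_of_false (h x y) (by rintro ⟨i, hi, -⟩; omega)⟩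
  | succ K ih =>
    obtain ⟨f, hf, h⟩ := ih
    obtain ⟨g, hg, h'⟩ := exists_extend (x := num K) (y := p K) hf (by
      intro y hy
      obtain ⟨i, hi, h1, -⟩ := (h _ _).1 hy
      rw [num_inj] at h1
      omega)
    refine ⟨g, hg, fun x y => ?_⟩
    rw [h', h]
    constructor
    · rintro (⟨i, hi, rfl, rfl⟩ | ⟨rfl, rfl⟩)
      · exact ⟨i, by omega, rfl, rfl⟩
      · exact ⟨K, by omega, rfl, rfl⟩
    · rintro ⟨i, hi, rfl, rfl⟩
      rcases Nat.lt_or_ge i K with hi' | hi'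
      · exact Or.inl ⟨i, hi', rfl, rfl⟩
      · obtain rfl : i = K := by omega
        exact Or.inr ⟨rfl, rfl⟩

theorem exists_upd {s A i a : M} (hs : IsAssign s A) (hi : IsNat i) (ha : a ε A) :
    ∃ t, IsAssign t A ∧ IsUpd t s i a := by
  obtain ⟨t, ht, h⟩ := exists_map om (fun n y => (n = i ∧ y = a) ∨ (n ≠ i ∧ App s n y))
    (fun y => y ε A) (by
      rintro n y y' - (⟨rfl, rfl⟩ | ⟨h1, h2⟩) (⟨h3, h4⟩ | ⟨h3, h4⟩)
      · exact h4.symm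
      · exact (h3 rfl).elim
      · exact (h1 h3).elim
      · exact hs.1.2 _ _ _ h2 h4) (by
      intro n hn
      by_cases h : n = i
      · exact ⟨a, Or.inl ⟨h, rfl⟩⟩
      · obtain ⟨y, hy⟩ := (hs.2.1 n).2 (mem_om.1 hn)
        exact ⟨y, Or.inr ⟨h, hy⟩⟩) (by
      rintro n y - (⟨rfl, rfl⟩ | ⟨h1, h2⟩)
      · exact ha
      · exact hs.2.2 _ _ h2)
  simp only [mem_om] at ht h
  refine ⟨t, ht, fun n y => (h n y).trans ⟨fun h => h.2, fun h => ⟨?_, h⟩⟩⟩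
  rcases h with ⟨rfl, -⟩ | ⟨-, h⟩
  · exact hi
  · exact (hs.2.1 n).1 ⟨y, h⟩

/-- The internal assignment `s` takes the values `v` at the standard natural numbers. -/
def Vals {A : M} (s : M) (v : ℕ → El A) : Prop := ∀ n, App s (num n) (v n)

theorem exists_vals {s A : M} (hs : IsAssign s A) : ∃ v : ℕ → El A, Vals s v := by
  have : ∀ n : ℕ, ∃ y : El A, App s (num n) y := fun n => by
    obtain ⟨y, hy⟩ := (hs.2.1 (num n)).2 (isNat_num n)
    exact ⟨⟨y, hs.2.2 _ _ hy⟩, hy⟩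
  choose v hv using this
  exact ⟨v, hv⟩

theorem exists_assign {A : M} (u : ℕ → El A) (K : ℕ) :
    ∃ t, IsAssign t A ∧ ∀ i, i < K → App t (num i) (u i) := by
  induction K with
  | zero =>
    obtain ⟨t, ht, -⟩ := exists_map om (fun n y => y = (u 0 : M)) (fun y => y ε A)
      (fun _ _ _ _ h h' => h.trans h'.symm) (fun x _ => ⟨_, rfl⟩)
      (fun _ _ _ h => h ▸ (u 0).2)
    simp only [mem_om] at ht
    exact ⟨t, ht, fun i hi => by omega⟩
  | succ K ih =>
    obtain ⟨t, ht, h⟩ := ih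
    obtain ⟨t', ht', h'⟩ := exists_upd ht (isNat_num K) (u K).2
    refine ⟨t', ht', fun i hi => (h' _ _).2 ?_⟩
    rcases Nat.lt_or_ge i K with hi' | hi'
    · exact Or.inr ⟨by rw [ne_eq, num_inj]; omega, h i hi'⟩
    · obtain rfl : i = K := by omega
      exact Or.inl ⟨rfl, rfl⟩

namespace Fml

/-- The renaming `f` below the quantifier that binds `v_d`. -/
def push (f : ℕ → ℕ) (d : ℕ) : ℕ → ℕ
  | 0 => d
  | n + 1 => f n

/-- The formation sequence of `φ`, appended to `l`: the free variable `i` becomes `v_{f i}` and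
the bound variables are `v_d, v_{d + 1}, …`. -/
def compile : Fml → (ℕ → ℕ) → ℕ → List (ℕ × ℕ × ℕ) → List (ℕ × ℕ × ℕ)
  | mem i j, f, _, l => l ++ [(0, f i, f j)]
  | eq i j, f, _, l => l ++ [(1, f i, f j)]
  | nand φ ψ, f, d, l =>
    ψ.compile f d (φ.compile f d l) ++
      [(3, (φ.compile f d l).length - 1, (ψ.compile f d (φ.compile f d l)).length - 1)]
  | ex φ, f, d, l =>
    φ.compile (push f d) (d + 1) l ++ [(4, d, (φ.compile (push f d) (d + 1) l).length - 1)]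

theorem compile_prefix (φ : Fml) : ∀ f d l, l <+: φ.compile f d l := by
  induction φ with
  | mem i j => exact fun f d l => List.prefix_append _ _
  | eq i j => exact fun f d l => List.prefix_append _ _
  | nand φ ψ h1 h2 =>
    exact fun f d l => ((h1 f d l).trans (h2 f d _)).trans (List.prefix_append _ _)
  | ex φ h => exact fun f d l => (h _ _ l).trans (List.prefix_append _ _)

theorem compile_pos (φ : Fml) (f d l) : 0 < (φ.compile f d l).length := by
  cases φ <;> simp only [compile, List.length_append, List.length_singleton] <;> omega

end Fml

/-- `e` carries the instructions in the list `L`. -/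
def Carries (e : M) (L : List (ℕ × ℕ × ℕ)) : Prop :=
  ∀ k op i j, L[k]? = some (op, i, j) → ∃ t, App e (num k) t ∧
    IsTriple t (num op) (num i) (num j)

theorem IsEval.clause {A e F : M} {H : M → M → Prop} {L : List (ℕ × ℕ × ℕ)}
    (hF : IsEval A H e F) (he : Carries e L) {k op i j : ℕ} (hk : L[k]? = some (op, i, j)) {s : M}
    (hs : IsAssign s A) : (∃ X, App F (num k) X ∧ s ε X) ↔
      Clause A H F (num k) (num op) (num i) (num j) s := by
  obtain ⟨t, ht, ht'⟩ := he k op i j hk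
  obtain ⟨X, hX⟩ := (hF.2.1 (num k)).2 ⟨t, ht⟩
  have := hF.2.2 _ X t _ _ _ hX ht ht' s
  constructor
  · rintro ⟨X', hX', h⟩
    rw [hF.1.2 _ _ _ hX' hX] at h
    exact (this.1 h).2
  · intro h
    exact ⟨X, hX, this.2 ⟨hs, h⟩⟩

theorem prefix_get {L l : List (ℕ × ℕ × ℕ)} {a : ℕ × ℕ × ℕ} (h : l ++ [a] <+: L) :
    L[l.length]? = some a := by
  obtain ⟨r, rfl⟩ := h
  simp

/-- The relation that an evaluation attaches to the last instruction of `φ.compile f d l` is the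
truth of `φ`. The variables from `d` on are free for the quantifiers of `φ`. -/
theorem IsEval.real {A e F : M} {H : M → M → Prop} {L : List (ℕ × ℕ × ℕ)}
    (hF : IsEval A H e F) (he : Carries e L) (φ : Fml) :
    ∀ (f : ℕ → ℕ) (d : ℕ) (l : List (ℕ × ℕ × ℕ)), φ.compile f d l <+: L →
      (∀ i, i < φ.bd → f i < d) → ∀ (s : M) (v : ℕ → El A), IsAssign s A → Vals s v →
      ((∃ X, App F (num ((φ.compile f d l).length - 1)) X ∧ s ε X) ↔ φ.Real (v ∘ f)) := by
  induction φ with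
  | mem i j =>
    intro f d l hl hf s v hs hv
    simp only [Fml.compile] at hl ⊢
    rw [List.length_append, List.length_singleton, Nat.add_sub_cancel,
      hF.clause he (prefix_get hl) hs]
    simp only [Clause, isNum_iff, num_inj]
    constructor
    · rintro (⟨-, x, y, hx, hy, h⟩ | ⟨h, -⟩ | ⟨h, -⟩ | ⟨h, -⟩ | ⟨h, -⟩)
      · rw [hs.1.2 _ _ _ hx (hv _), hs.1.2 _ _ _ hy (hv _)] at h
        exact h
      all_goals omega
    · intro h
      exact Or.inl ⟨trivial, _, _, hv _, hv _, h⟩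
  | eq i j =>
    intro f d l hl hf s v hs hv
    simp only [Fml.compile] at hl ⊢
    rw [List.length_append, List.length_singleton, Nat.add_sub_cancel,
      hF.clause he (prefix_get hl) hs]
    simp only [Clause, isNum_iff, num_inj]
    constructor
    · rintro (⟨h, -⟩ | ⟨-, x, y, hx, hy, h⟩ | ⟨h, -⟩ | ⟨h, -⟩ | ⟨h, -⟩)
      · omega
      · rw [hs.1.2 _ _ _ hx (hv _), hs.1.2 _ _ _ hy (hv _)] at h
        exact Subtype.ext h
      all_goals omega
    · intro h
      exact Or.inr (Or.inl ⟨trivial, _, _, hv _, hv _, congrArg Subtype.val h⟩)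
  | nand φ ψ h1 h2 =>
    intro f d l hl hf s v hs hv
    simp only [Fml.compile] at hl ⊢
    rw [List.length_append, List.length_singleton, Nat.add_sub_cancel,
      hF.clause he (prefix_get hl) hs]
    have hl2 := (List.prefix_append _ _).trans hl
    have hl1 := (ψ.compile_prefix f d (φ.compile f d l)).trans hl2
    have p1 := φ.compile_pos f d l
    have p2 := (ψ.compile_prefix f d (φ.compile f d l)).length_le
    have e1 := h1 f d l hl1 (fun i hi => hf i (lt_max_of_lt_left hi)) s v hs hv
    have e2 := h2 f d _ hl2 (fun i hi => hf i (lt_max_of_lt_right hi)) s v hs hv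
    simp only [Clause, isNum_iff, num_inj, Earlier, num_mem_num, e1, e2, Fml.Real]
    constructor
    · rintro (⟨h, -⟩ | ⟨h, -⟩ | ⟨h, -⟩ | ⟨-, h⟩ | ⟨h, -⟩)
      · omega
      · omega
      · omega
      · exact fun h' => h ⟨⟨by omega, h'.1⟩, by omega, h'.2⟩
      · omega
    · exact fun h => Or.inr (Or.inr (Or.inr (Or.inl ⟨trivial, fun h' => h ⟨h'.1.2, h'.2.2⟩⟩)))
  | ex φ h1 =>
    intro f d l hl hf s v hs hv
    simp only [Fml.compile] at hl ⊢
    rw [List.length_append, List.length_singleton, Nat.add_sub_cancel,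
      hF.clause he (prefix_get hl) hs]
    have hl1 := (List.prefix_append _ _).trans hl
    have p1 := φ.compile_pos (Fml.push f d) (d + 1) l
    have hf' : ∀ i, i < φ.bd → Fml.push f d i < d + 1 := by
      intro i hi
      cases i with
      | zero => exact Nat.lt_succ_self d
      | succ i => exact Nat.lt_succ_of_lt (hf i (by simp only [Fml.bd]; omega))
    have key : ∀ (a : El A) t, IsAssign t A → IsUpd t s (num d) a →
        ((∃ X, App F (num ((φ.compile (Fml.push f d) (d + 1) l).length - 1)) X ∧ t ε X) ↔
          φ.Real (scons a (v ∘ f))) := by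
      intro a t ht hu
      have hvt : Vals t (Function.update v d a) := by
        intro n
        refine (hu _ _).2 ?_
        by_cases h : n = d
        · subst h; exact Or.inl ⟨rfl, by rw [Function.update_self]⟩
        · right
          rw [ne_eq, num_inj, Function.update_of_ne h]
          exact ⟨h, hv n⟩
      rw [h1 (Fml.push f d) (d + 1) l hl1 hf' t _ ht hvt]
      refine φ.real_congr _ _ fun i hi => ?_
      cases i with
      | zero => simp only [Function.comp, Fml.push, Function.update_self, scons_zero]
      | succ i =>
        have := hf i (by simp only [Fml.bd]; omega)
        simp only [Function.comp, Fml.push, scons_succ]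
        rw [Function.update_of_ne (by omega)]
    simp only [Clause, isNum_iff, num_inj, Earlier, num_mem_num, Fml.Real]
    constructor
    · rintro (⟨h, -⟩ | ⟨h, -⟩ | ⟨h, -⟩ | ⟨h, -⟩ | ⟨-, a, t, ha, ht, hu, -, h⟩)
      · omega
      · omega
      · omega
      · omega
      · exact ⟨⟨a, ha⟩, (key ⟨a, ha⟩ t ht hu).1 h⟩
    · rintro ⟨a, ha⟩
      obtain ⟨t, ht, hu⟩ := exists_upd hs (isNat_num d) a.2
      exact Or.inr (Or.inr (Or.inr (Or.inr
        ⟨trivial, a, t, a.2, ht, hu, by omega, (key a t ht hu).2 ha⟩)))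

/-- The ordered triple. -/
noncomputable def triple (a b c : M) : M := op a (op b c)

theorem isTriple_iff {t a b c : M} : IsTriple t a b c ↔ t = triple a b c := by
  simp only [IsTriple, isOPair_iff, exists_eq_left, triple]

theorem triple_inj {a b c a' b' c' : M} :
    triple a b c = triple a' b' c' ↔ a = a' ∧ b = b' ∧ c = c' := by
  simp only [triple, op_inj]

/-- The internal code of a list of instructions. -/
theorem exists_code (L : List (ℕ × ℕ × ℕ)) : ∃ e : M, IsFunction e ∧ ∀ x t, App e x t ↔
    ∃ k op i j, L[k]? = some (op, i, j) ∧ x = num k ∧ t = triple (num op) (num i) (num j) := by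
  obtain ⟨e, he, h⟩ := exists_finseq (M := M) (fun k => match L[k]? with
    | some (op, i, j) => triple (num op) (num i) (num j)
    | none => emp) L.length
  refine ⟨e, he, fun x t => (h x t).trans ⟨?_, ?_⟩⟩
  · rintro ⟨k, hk, rfl, rfl⟩
    rw [List.getElem?_eq_getElem hk]
    exact ⟨k, L[k].1, L[k].2.1, L[k].2.2, List.getElem?_eq_getElem hk, rfl, rfl⟩
  · rintro ⟨k, op, i, j, hk, rfl, rfl⟩
    refine ⟨k, (List.getElem?_eq_some_iff.1 hk).1, rfl, ?_⟩
    rw [hk]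

/-- For finite lists of instructions of standard length, the evaluation is built by an induction in
the metatheory. -/
theorem exists_eval (A : M) (L : List (ℕ × ℕ × ℕ)) (K : ℕ) :
    ∃ F, IsFunction F ∧ (∀ k, (∃ X, App F k X) ↔ ∃ i, i < K ∧ i < L.length ∧ k = num i) ∧
      ∀ k X op i j, App F (num k) X → L[k]? = some (op, i, j) → ∀ s, s ε X ↔ IsAssign s A ∧
        Clause A NoPred F (num k) (num op) (num i) (num j) s := by
  obtain ⟨S, hS⟩ := exists_mapsNat A
  induction K with
  | zero =>
    have h : ∀ x y : M, ¬ App emp x y := fun x y h => not_mem_emp _ (app_iff.1 h)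
    exact ⟨emp, ⟨fun p hp => (not_mem_emp p hp).elim, fun x y y' h' => (h x y h').elim⟩,
      fun k => iff_of_false (fun ⟨X, hX⟩ => h _ _ hX) (by rintro ⟨i, hi, -⟩; omega),
      fun k X op i j hX => (h _ _ hX).elim⟩
  | succ K ih =>
    obtain ⟨F, hF, hd, hc⟩ := ih
    rcases Nat.lt_or_ge K L.length with hK | hK
    · obtain ⟨⟨o, a, b⟩, hLK⟩ : ∃ c, L[K]? = some c := ⟨_, List.getElem?_eq_getElem hK⟩
      obtain ⟨X, hX⟩ := exists_sep (fun s =>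
        Clause A NoPred F (num K) (num o) (num a) (num b) s) S
      obtain ⟨G, hG, hG'⟩ := exists_extend (x := num K) (y := X) hF (by
        intro y hy
        obtain ⟨i, hi, -, h⟩ := (hd _).1 ⟨y, hy⟩
        rw [num_inj] at h
        omega)
      have hE : ∀ k j s, k ≤ K → (Earlier G (num k) j s ↔ Earlier F (num k) j s) := by
        intro k j s hk
        refine and_congr_right fun hj => exists_congr fun Y => and_congr_left fun _ => ?_
        rw [hG']
        constructor
        · rintro (h | ⟨rfl, -⟩)
          · exact h
          · rw [num_mem_num] at hj; omega
        · exact Or.inl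
      refine ⟨G, hG, fun k => ?_, fun k Y op i j hY hL s => ?_⟩
      · constructor
        · rintro ⟨Y, hY⟩
          rcases (hG' _ _).1 hY with h | ⟨rfl, -⟩
          · obtain ⟨i, h1, h2, h3⟩ := (hd _).1 ⟨Y, h⟩
            exact ⟨i, by omega, h2, h3⟩
          · exact ⟨K, by omega, hK, rfl⟩
        · rintro ⟨i, h1, h2, rfl⟩
          rcases Nat.lt_or_ge i K with hi | hi
          · obtain ⟨Y, hY⟩ := (hd _).2 ⟨i, hi, h2, rfl⟩
            exact ⟨Y, (hG' _ _).2 (Or.inl hY)⟩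
          · obtain rfl : i = K := by omega
            exact ⟨X, (hG' _ _).2 (Or.inr ⟨rfl, rfl⟩)⟩
      · rcases (hG' _ _).1 hY with h | ⟨h, rfl⟩
        · have hk : k < K := by
            obtain ⟨i, h1, h2, h3⟩ := (hd _).1 ⟨Y, h⟩
            rw [num_inj] at h3
            omega
          rw [hc k Y op i j h hL s]
          simp only [Clause, hE k _ _ hk.le]
        · rw [num_inj] at h
          subst h
          obtain ⟨rfl, rfl, rfl⟩ : o = op ∧ a = i ∧ b = j := by simpa [hLK] using hL
          rw [hX, hS]
          simp only [Clause, hE k _ _ le_rfl]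
          rfl
    · refine ⟨F, hF, fun k => (hd k).trans (exists_congr fun i => ?_), hc⟩
      constructor
      · rintro ⟨h1, h2, h3⟩; exact ⟨by omega, h2, h3⟩
      · rintro ⟨h1, h2, h3⟩; exact ⟨by omega, h2, h3⟩

/-- Every formula has a code, and satisfaction of the code is truth of the formula. -/
theorem exists_code_sat (φ : Fml) : ∃ e : M, IsCode e ∧
    ∀ (A s : M) (v : ℕ → El A), IsAssign s A → Vals s v → (Sat A NoPred e s ↔ φ.Real v) := by
  let L := φ.compile id φ.bd []
  have hpos : 0 < L.length := φ.compile_pos _ _ _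
  obtain ⟨e, he, he'⟩ := exists_code (M := M) L
  have hdom : ∀ x, (∃ t, App e x t) ↔ ∃ k, k < L.length ∧ x = num k := by
    intro x
    constructor
    · rintro ⟨t, ht⟩
      obtain ⟨k, op, i, j, h, rfl, -⟩ := (he' _ _).1 ht
      exact ⟨k, (List.getElem?_eq_some_iff.1 h).1, rfl⟩
    · rintro ⟨k, hk, rfl⟩
      exact ⟨_, (he' _ _).2 ⟨k, L[k].1, L[k].2.1, L[k].2.2, List.getElem?_eq_getElem hk, rfl, rfl⟩⟩
  have hcar : Carries e L := fun k op i j h =>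
    ⟨_, (he' _ _).2 ⟨k, op, i, j, h, rfl, rfl⟩, isTriple_iff.2 rfl⟩
  have hL : L.length = L.length - 1 + 1 := by omega
  have hlast : IsCodeWithLast e (num (L.length - 1)) := by
    refine ⟨num L.length, isNat_num _, isSucc_iff.2 (by rw [hL]; rfl), he, fun x => ?_,
      fun x t ht => ?_⟩
    · exact (hdom x).trans mem_num.symm
    · obtain ⟨k, op, i, j, h, rfl, rfl⟩ := (he' _ _).1 ht
      exact ⟨_, _, _, isNat_num _, isNat_num _, isNat_num _, isTriple_iff.2 rfl⟩
  have hlast' : ∀ k, IsCodeWithLast e k → k = num (L.length - 1) := by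
    rintro k ⟨n, hk, hn, hm⟩
    obtain rfl := isSucc_iff.1 hn
    have h1 : ∀ x, x ε sc k ↔ x ε num L.length := by
      intro x
      rw [mem_num, ← hdom]
      exact (hm.2.1 x).symm
    have h2 : sc k = sc (num (L.length - 1)) := by
      rw [ext h1, hL]; rfl
    exact sc_inj hk.1 (isNat_num _).1 h2
  refine ⟨e, ⟨_, hlast⟩, fun A s v hs hv => ?_⟩
  have main : ∀ F, IsEval A NoPred e F →
      ((∃ X, App F (num (L.length - 1)) X ∧ s ε X) ↔ φ.Real v) := fun F hF =>
    hF.real hcar φ id φ.bd [] (List.prefix_refl _) (fun i hi => hi) s v hs hv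
  constructor
  · rintro ⟨F, k, X, hF, hk, hX, h⟩
    rw [hlast' k hk] at hX
    exact (main F hF).1 ⟨X, hX, h⟩
  · intro h
    obtain ⟨F, hF, hd, hc⟩ := exists_eval A L L.length
    have hE : IsEval A NoPred e F := by
      refine ⟨hF, fun k => ?_, fun k X t op i j hX ht hti => ?_⟩
      · rw [hd, hdom]
        exact exists_congr fun i => ⟨fun h => h.2, fun h => ⟨h.1, h⟩⟩
      · obtain ⟨k, op', i', j', h', rfl, rfl⟩ := (he' _ _).1 ht
        obtain ⟨rfl, rfl, rfl⟩ := triple_inj.1 (isTriple_iff.1 hti)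
        exact hc k X _ _ _ hX h'
    obtain ⟨X, hX, hs'⟩ := (main F hE).2 h
    exact ⟨F, _, X, hE, hlast, hX, hs'⟩

/-- A formula with parameters `p`, seen as an internal formula with parameters. -/
theorem exists_definesSet (φ : Fml) (A : M) (p : ℕ → El A) : ∃ e q, IsCode e ∧
    (∃ n, IsNat n ∧ IsMap q (fun i => i ε n) (fun v => ∃ j, v = (p j : M))) ∧
    ∀ X, (∀ y, y ε X ↔ ∃ h : y ε A, φ.Real (mix (scons ⟨y, h⟩ fun _ => p 0) p)) →
      DefinesSet A NoPred e q X := by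
  obtain ⟨e, he, hsat⟩ := exists_code_sat (M := M) (φ.rename (fun n =>
    match Equiv.natSumNatEquivNat.symm n with
    | Sum.inl 0 => 0
    | Sum.inl (_ + 1) => 1
    | Sum.inr n => n + 1))
  set ψ := φ.rename (fun n =>
    match Equiv.natSumNatEquivNat.symm n with
    | Sum.inl 0 => 0
    | Sum.inl (_ + 1) => 1
    | Sum.inr n => n + 1) with hψ
  have hreal : ∀ x : El A, φ.Real (mix (scons x fun _ => p 0) p) ↔ ψ.Real (scons x p) := by
    intro x
    rw [hψ, Fml.real_rename]
    refine iff_of_eq (congrArg _ (mix_ext (fun n => ?_) fun n => ?_))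
    · cases n <;> simp only [Function.comp, Equiv.symm_apply_apply, mix_inl] <;> rfl
    · simp only [Function.comp, Equiv.symm_apply_apply, mix_inr]; rfl
  simp only [hreal]
  clear_value ψ
  clear hreal hψ
  obtain ⟨q, hq, hq'⟩ := exists_finseq (fun i => (p i : M)) ψ.bd
  refine ⟨e, q, he, ⟨num ψ.bd, isNat_num _, hq, fun x => ?_, fun x y hxy => ?_⟩,
    fun X hX y => (hX y).trans ?_⟩
  · refine Iff.trans ?_ mem_num.symm
    constructor
    · rintro ⟨y, hy⟩
      obtain ⟨i, hi, h, -⟩ := (hq' _ _).1 hy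
      exact ⟨i, hi, h⟩
    · rintro ⟨i, hi, h⟩
      exact ⟨_, (hq' _ _).2 ⟨i, hi, h, rfl⟩⟩
  · obtain ⟨i, -, -, h⟩ := (hq' _ _).1 hxy
    exact ⟨i, h⟩
  · constructor
    · rintro ⟨hy, h⟩
      obtain ⟨t, ht, htv⟩ := exists_assign (scons ⟨y, hy⟩ p) (ψ.bd + 1)
      obtain ⟨v, hv⟩ := exists_vals ht
      refine ⟨hy, t, ht, fun z hz => ?_, fun i w hi => ?_, (hsat A t v ht hv).2 ?_⟩
      · rw [isEmp_iff.1 hz]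
        exact htv 0 (by omega)
      · obtain ⟨i, hi, rfl, rfl⟩ := (hq' _ _).1 hi
        exact ⟨_, isSucc_iff.2 rfl, htv (i + 1) (by omega)⟩
      · refine (ψ.real_congr _ _ fun i hi => ?_).1 h
        exact Subtype.ext (ht.1.2 _ _ _ (htv i (by omega)) (hv i))
    · rintro ⟨hy, t, ht, h0, h1, hs⟩
      refine ⟨hy, ?_⟩
      obtain ⟨v, hv⟩ := exists_vals ht
      refine (ψ.real_congr _ _ fun i hi => ?_).1 ((hsat A t v ht hv).1 hs)
      refine Subtype.ext (ht.1.2 _ _ _ (hv i) ?_)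
      cases i with
      | zero => exact h0 _ (isEmp_iff.2 rfl)
      | succ i =>
        obtain ⟨i', hi', h⟩ := h1 (num i) (p i) ((hq' _ _).2 ⟨i, by omega, rfl, rfl⟩)
        rwa [isSucc_iff.1 hi'] at h

/-- A class that is definable over the structure `A` is definable in the internal sense. -/
theorem isDef_of_dfn {A X : M} (Q : El A → Prop) [h : Dfn1 Univ (fun _ => Q)]
    (hX : ∀ y, y ε X ↔ ∃ h : y ε A, Q ⟨y, h⟩) : IsDef A NoPred X := by
  obtain ⟨φ, p, -, h⟩ := h.out.out
  obtain ⟨e, q, he, ⟨n, hn, hq⟩, hd⟩ := exists_definesSet φ A p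
  refine ⟨e, q, he, ⟨n, hn, hq.1, hq.2.1, fun x y hxy => ?_⟩, hd X fun y => (hX y).trans ?_⟩
  · obtain ⟨j, rfl⟩ := hq.2.2 x y hxy
    exact (p j).2
  · refine exists_congr fun hy => ?_
    have := h (scons ⟨y, hy⟩ fun _ => p 0)
    exact this

end Code

/-! ### Definability from ordinals and parameters -/

section SD
variable {M : Type u} [SetStructure M] [hZ : ZF M]

/-- The class of ordinals and elements of `P`. -/
def OrdOr (P : M → Prop) (x : M) : Prop := IsOrd x ∨ P x

/-- `x` is definable in `(M, ε)`, by a formula of the metatheory, from ordinals and elements of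
`P`. -/
def SD (P : M → Prop) (x : M) : Prop :=
  ∃ Q : M → Prop, Dfn (OrdOr P) (fun v => Q (v 0)) ∧ Q x ∧ ∀ y, Q y → y = x

variable {P : M → Prop}

instance : Inhab (OrdOr P) := ⟨⟨emp, Or.inl isOrd_emp⟩⟩

theorem SD.of_param {x : M} (h : OrdOr P x) : SD P x := by
  have : Cst (OrdOr P) x := ⟨h⟩
  exact ⟨fun y => y = x, inferInstance, rfl, fun y h => h⟩

theorem SD.of_ord {x : M} (h : IsOrd x) : SD P x := SD.of_param (Or.inl h)
theorem SD.of_mem {x : M} (h : P x) : SD P x := SD.of_param (Or.inr h)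

instance : Inhab (SD P) := ⟨⟨emp, SD.of_ord isOrd_emp⟩⟩

/-- A constant that is definable from `OrdOr P` can be replaced by its definition. -/
theorem Trm.graph {f : (ℕ → M) → M} (hf : Trm (SD P) f) :
    Dfn1 (OrdOr P) (fun v x => x = f v) := by
  rcases hf.out with ⟨i, hi⟩ | ⟨c, ⟨Q, hQ, hc, hu⟩, h⟩
  · simp only [hi]; infer_instance
  · simp only [h]
    refine ⟨hQ.congr fun v => ⟨?_, hu _⟩⟩
    rintro h'
    rwa [h']

theorem Dfn.ex_mem {C : M → Prop} [Inhab C] (A B : (ℕ → M) → M → Prop) [Dfn1 C A] [Dfn1 C B] :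
    Dfn C (fun v => ∃ x y, (A v x ∧ B v y) ∧ x ε y) := inferInstance

theorem Dfn.ex_eq {C : M → Prop} [Inhab C] (A B : (ℕ → M) → M → Prop) [Dfn1 C A] [Dfn1 C B] :
    Dfn C (fun v => ∃ x y, (A v x ∧ B v y) ∧ x = y) := inferInstance

theorem Fml.dfn_subst (φ : Fml) : ∀ g : (ℕ → M) → ℕ → M, (∀ n, Trm (SD P) (fun w => g w n)) →
    Dfn (OrdOr P) (fun w => φ.Real (g w)) := by
  induction φ with
  | mem i j =>
    intro g hg
    have h1 := (hg i).graph
    have h2 := (hg j).graph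
    exact (Dfn.ex_mem (fun v x => x = g v i) (fun v x => x = g v j)).congr
      fun v => by simp [Fml.Real]
  | eq i j =>
    intro g hg
    have h1 := (hg i).graph
    have h2 := (hg j).graph
    exact (Dfn.ex_eq (fun v x => x = g v i) (fun v x => x = g v j)).congr
      fun v => by simp [Fml.Real]
  | nand φ ψ h1 h2 =>
    intro g hg
    exact (h1 g hg).nand (h2 g hg)
  | ex φ h =>
    intro g hg
    have := h (fun w => scons (w 0) (g (fun i => w (i + 1)))) fun n => by
      cases n with
      | zero => exact inferInstanceAs (Trm (SD P) (fun w => w 0))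
      | succ n =>
        exact instTrmComp (C := SD P) (fun w => g w n) (fun i => i + 1)
    exact instDfnEx (fun v x => φ.Real (scons x (g v)))

/-- Parameters that are themselves definable from ordinals and elements of `P` can be eliminated. -/
theorem Dfn.of_SD {R : (ℕ → M) → Prop} (h : Dfn (SD P) R) : Dfn (OrdOr P) R := by
  obtain ⟨φ, p, hp, h⟩ := h.out
  refine Dfn.congr (φ.dfn_subst (P := P) (fun v => mix v p) fun n => ?_) h
  obtain ⟨m, rfl⟩ := (Equiv.natSumNatEquivNat).surjective n
  cases m with
  | inl n => simp only [mix_inl]; infer_instance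
  | inr n =>
    simp only [mix_inr]
    have : Cst (SD P) (p n) := ⟨hp n⟩
    infer_instance

theorem SD.of_unique (Q : M → Prop) [h : Dfn1 (SD P) (fun _ => Q)] {x : M} (hx : Q x)
    (hu : ∀ y, Q y → y = x) : SD P x := ⟨Q, h.out.of_SD, hx, hu⟩

theorem SD.cst {x : M} (h : SD P x) : Cst (SD P) x := ⟨h⟩

theorem exists_mem_V_fin (p : ℕ → M) (K : ℕ) : ∃ α A, IsV α A ∧ ∀ i, i < K → p i ε A := by
  induction K with
  | zero =>
    obtain ⟨A, hA⟩ := exists_isV (isOrd_emp (M := M))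
    exact ⟨_, A, hA, fun i hi => by omega⟩
  | succ K ih =>
    obtain ⟨α, A, hA, h⟩ := ih
    obtain ⟨β, B, hB, hpK⟩ := exists_mem_V (p K)
    obtain ⟨δ, hδ, h3, h4⟩ := exists_ord_above hA.ord hB.ord
    obtain ⟨D, hD⟩ := exists_isV hδ
    refine ⟨δ, D, hD, fun i hi => ?_⟩
    rcases Nat.lt_or_ge i K with hi' | hi'
    · exact hA.mono hD (Or.inr h3) _ (h i hi')
    · obtain rfl : i = K := by omega
      exact hB.mono hD (Or.inr h4) _ hpK

/-- Definability by a formula of the metatheory implies ordinal definability in the internal sense: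
by reflection, the formula defines the set over some `V_θ`. -/
theorem SD.od {x : M} (h : SD P x) : OD P x := by
  obtain ⟨Q, hQ, hx, hu⟩ := h
  obtain ⟨φ, p, hp, h⟩ := hQ.out
  obtain ⟨α, A, hA, hAp⟩ := exists_mem_V_fin (scons x p) (φ.bd + 2)
  obtain ⟨θ, T, hθ, hαθ, hT, hr⟩ := reflection φ hA.ord
  have hsub := hA.mono hT (Or.inr hαθ)
  have hxT : x ε T := hsub _ (hAp 0 (by omega))
  let p' : ℕ → El T := fun i => if hi : i ≤ φ.bd then ⟨p i, hsub _ (hAp (i + 1) (by omega))⟩ else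
    ⟨p 0, hsub _ (hAp 1 (by omega))⟩
  have hp' : ∀ i, OrdOr P (p' i : M) := by
    intro i
    simp only [p']
    split <;> exact hp _
  have hpp : ∀ i, i < φ.bd → (p' i : M) = p i := fun i hi => by
    simp only [p', dif_pos hi.le]
  have key : ∀ y (hy : y ε T), φ.Real (mix (scons (⟨y, hy⟩ : El T) fun _ => p' 0) p') ↔ y = x := by
    intro y hy
    rw [hr]
    have e : (fun i => ((mix (scons (⟨y, hy⟩ : El T) fun _ => p' 0) p' i : El T) : M)) =
        mix (scons y fun _ => (p' 0 : M)) (fun i => (p' i : M)) := by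
      refine mix_ext (fun n => ?_) fun n => ?_
      · simp only [mix_inl]; cases n <;> rfl
      · simp only [mix_inr]
    have e2 : φ.Real (mix (scons y fun _ => (p' 0 : M)) (fun i => (p' i : M))) ↔
        φ.Real (mix (scons y fun _ => (p' 0 : M)) p) := by
      refine φ.real_congr _ _ fun i hi => ?_
      obtain ⟨m, rfl⟩ := (Equiv.natSumNatEquivNat).surjective i
      cases m with
      | inl n => simp only [mix_inl]
      | inr n =>
        simp only [mix_inr]
        refine hpp n ?_
        simp only [Equiv.natSumNatEquivNat_apply, Sum.elim_inr] at hi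
        omega
    rw [e, e2, ← h]
    exact ⟨hu y, fun h => h ▸ hx⟩
  obtain ⟨e, q, he, ⟨n, hn, hq⟩, hd⟩ := exists_definesSet φ T p'
  obtain ⟨X, hX⟩ := exists_pair x x
  refine ⟨θ, e, q, hθ.1, T, hT, he, ⟨n, hn, hq.1, hq.2.1, fun i v hv => ?_⟩, X, hX,
    hd X fun y => (hX y).trans ?_⟩
  · obtain ⟨j, rfl⟩ := hq.2.2 i v hv
    exact ⟨(p' j).2, hp' j⟩
  · rw [or_self]
    exact ⟨fun h => ⟨h ▸ hxT, (key y (h ▸ hxT)).2 h⟩, fun ⟨hy, h⟩ => (key y hy).1 h⟩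

end SD

/-! ### Coding by sequences of ordinals -/

section Rows
variable {M : Type u} [SetStructure M]

/-- The successor of a pair of natural numbers in an enumeration of `ω × ω`, which runs through the
borders `(0, N), …, (N, N), …, (N, 0)` of the squares. -/
def PairNext (p p' : M) : Prop := ∃ i j, IsOPair p i j ∧
  ((i ε j ∧ ∃ i', IsSucc i' i ∧ IsOPair p' i' j) ∨
   (¬ i ε j ∧ ∃ j', IsSucc j j' ∧ IsOPair p' i j') ∨
   (IsEmp j ∧ ∃ i', IsSucc i' i ∧ IsOPair p' j i'))

/-- The `m`-th pair of natural numbers is `(i, j)`. -/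
def Pr (m i j : M) : Prop := IsNat m ∧ ∃ p,
  IsStage (fun x => ∃ p z, IsEmp z ∧ IsOPair p z z ∧ x ε p)
    (fun _ Y x => ∃ p', PairNext Y p' ∧ x ε p') m p ∧ IsOPair p i j

/-- `r` is the `i`-th row of `s ∈ δ ^ ω`, seen as a matrix in `δ ^ (ω × ω)`. -/
def Row (δ s i r : M) : Prop :=
  IsSeq s δ ∧ IsSeq r δ ∧ ∀ m j v, Pr m i j → (App s m v ↔ App r j v)

/-- `y` is the value at `n` of the sequence that starts with `a`, `b` and continues with the
constant value `c`. -/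
def Three (a b c n y : M) : Prop :=
  (IsNum 0 n ∧ y = a) ∨ (IsNum 1 n ∧ y = b) ∨ (¬ IsNum 0 n ∧ ¬ IsNum 1 n ∧ y = c)

/-- The rows of `s ∈ δ ^ ω` code, through `p`, the finite sequence `q`; row `0` starts with the
length of `q`. -/
def FinCode (δ : M) (p : M → M → Prop) (s q : M) : Prop :=
  ∃ r n z, IsEmp z ∧ Row δ s z r ∧ App r z n ∧ IsNat n ∧ IsFunction q ∧
    (∀ i, (∃ v, App q i v) ↔ i ε n) ∧
    ∀ i v, App q i v → ∃ i' r, IsSucc i' i ∧ Row δ s i' r ∧ p r v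

/-- `t` is the triple of the first three values of `r`. -/
def InstrOf (r t : M) : Prop := ∃ x y z a b c, IsNum 0 x ∧ IsNum 1 y ∧ IsNum 2 z ∧
  App r x a ∧ App r y b ∧ App r z c ∧ IsTriple t a b c

section Inst
variable {C : M → Prop} [Inhab C]
variable (f g h k l : (ℕ → M) → M) [Trm C f] [Trm C g] [Trm C h] [Trm C k] [Trm C l]
instance : Dfn C (fun v => PairNext (f v) (g v)) := by unfold PairNext; infer_instance
instance : Dfn C (fun v => Pr (f v) (g v) (h v)) := by unfold Pr; infer_instance
instance : Dfn C (fun v => Row (f v) (g v) (h v) (k v)) := by unfold Row; infer_instance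
instance (H : (ℕ → M) → M → M → Prop) [Dfn2 C H] :
    Dfn C (fun v => FinCode (f v) (H v) (g v) (h v)) := by unfold FinCode; infer_instance
instance : Dfn C (fun v => Three (f v) (g v) (h v) (k v) (l v)) := by
  unfold Three; infer_instance
instance : Dfn C (fun v => InstrOf (f v) (g v)) := by unfold InstrOf; infer_instance
end Inst

variable [hZ : ZF M]

theorem pairNext_unique {p q q' : M} (h : PairNext p q) (h' : PairNext p q') : q = q' := by
  obtain ⟨i, j, hp, h⟩ := h
  obtain ⟨i', j', hp', h'⟩ := h'
  obtain ⟨rfl, rfl⟩ := hp.inj hp'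
  simp only [isSucc_iff, isOPair_iff, isEmp_iff, exists_eq_left] at h h'
  rcases h with ⟨h1, rfl⟩ | ⟨h1, j', hj, rfl⟩ | ⟨h1, rfl⟩
  · rcases h' with ⟨-, rfl⟩ | ⟨h2, -⟩ | ⟨h2, -⟩
    · rfl
    · exact (h2 h1).elim
    · exact (not_mem_emp _ (h2 ▸ h1)).elim
  · rcases h' with ⟨h2, -⟩ | ⟨h2, j'', hj', rfl⟩ | ⟨h2, -⟩
    · exact (h1 h2).elim
    · rw [hj] at hj'
      have : j' = j'' := by
        rcases mem_sc.1 (hj' ▸ mem_sc_self j') with h | h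
        · rcases mem_sc.1 (hj'.symm ▸ mem_sc_self j'') with h2 | h2
          · exact (mem_asymm h h2).elim
          · exact h2.symm
        · exact h
      rw [this]
    · exact (sc_ne_emp _ (hj.symm.trans h2)).elim
  · rcases h' with ⟨h2, -⟩ | ⟨h2, j'', hj', -⟩ | ⟨h2, rfl⟩
    · exact (not_mem_emp _ (h1 ▸ h2)).elim
    · exact (sc_ne_emp _ (hj'.symm.trans h1)).elim
    · rfl

theorem exists_pairStage {α : M} (hα : IsOrd α) :
    ∃ X, IsStage (fun x => ∃ p z, IsEmp z ∧ IsOPair p z z ∧ x ε p)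
      (fun _ Y x => ∃ p', PairNext Y p' ∧ x ε p') α X :=
  exists_stage (base := fun x : M => ∃ p z, IsEmp z ∧ IsOPair p z z ∧ x ε p)
    (Step := fun _ Y x => ∃ p', PairNext Y p' ∧ x ε p')
    ⟨op emp emp, fun x => by simp [isEmp_iff, isOPair_iff]⟩ (fun β Y _ => by
      by_cases h : ∃ γ, PairNext Y γ
      · obtain ⟨γ, hγ⟩ := h
        exact ⟨γ, fun x => ⟨fun hx => ⟨γ, hγ, hx⟩,
          fun ⟨γ', hγ', hx⟩ => pairNext_unique hγ hγ' ▸ hx⟩⟩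
      · exact ⟨emp, fun x => iff_of_false (not_mem_emp x) fun ⟨γ, hγ, _⟩ => h ⟨γ, hγ⟩⟩) hα

theorem pairNext_step {m p q i j : M} (hm : IsNat m) (hp : Pr m i j) (hn : PairNext (op i j) q) :
    ∀ a b, q = op a b → Pr (sc m) a b := by
  rintro a b rfl
  obtain ⟨-, p, hs, hp⟩ := hp
  obtain rfl := isOPair_iff.1 hp
  refine ⟨hm.sc, op a b, ?_, isOPair_iff.2 rfl⟩
  obtain ⟨X, hX⟩ := exists_pairStage hm.sc.1
  obtain rfl : X = op a b := ext fun x => (stage_succ hs hX x).trans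
    ⟨fun ⟨γ', hγ', hx⟩ => pairNext_unique hn hγ' ▸ hx, fun hx => ⟨_, hn, hx⟩⟩
  exact hX

theorem pr_zero : Pr (emp : M) emp emp := by
  refine ⟨isNat_emp, op emp emp, ?_, isOPair_iff.2 rfl⟩
  obtain ⟨X, hX⟩ := exists_pairStage (isOrd_emp (M := M))
  obtain rfl : X = op emp emp := ext fun x => (stage_zero hX x).trans
    (by simp [isEmp_iff, isOPair_iff])
  exact hX

theorem pr_unique {m i j i' j' : M} (h : Pr m i j) (h' : Pr m i' j') : i = i' ∧ j = j' := by
  obtain ⟨-, p, hs, hp⟩ := h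
  obtain ⟨-, p', hs', hp'⟩ := h'
  obtain rfl := hs.unique hs'
  exact hp.inj hp'

theorem exists_pr {m : M} (hm : IsNat m) : ∃ i j, IsNat i ∧ IsNat j ∧ Pr m i j := by
  refine nat_induction (fun m => ∃ i j, IsNat i ∧ IsNat j ∧ Pr m i j)
    ⟨emp, emp, isNat_emp, isNat_emp, pr_zero⟩ ?_ hm
  rintro m hm ⟨i, j, hi, hj, h⟩
  by_cases hij : i ε j
  · exact ⟨sc i, j, hi.sc, hj, pairNext_step (p := m) (q := op (sc i) j) hm h
      ⟨i, j, isOPair_iff.2 rfl, Or.inl ⟨hij, _, isSucc_iff.2 rfl, isOPair_iff.2 rfl⟩⟩ _ _ rfl⟩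
  · rcases hj.cases with rfl | ⟨j, hj', rfl⟩
    · exact ⟨emp, sc i, hj, hi.sc, pairNext_step (p := m) (q := op emp (sc i)) hm h
        ⟨i, emp, isOPair_iff.2 rfl,
          Or.inr (Or.inr ⟨isEmp_iff.2 rfl, _, isSucc_iff.2 rfl, isOPair_iff.2 rfl⟩)⟩ _ _ rfl⟩
    · exact ⟨i, j, hi, hj', pairNext_step (p := m) (q := op i j) hm h
        ⟨i, sc j, isOPair_iff.2 rfl,
          Or.inr (Or.inl ⟨hij, _, isSucc_iff.2 rfl, isOPair_iff.2 rfl⟩)⟩ _ _ rfl⟩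

/-- Every pair of natural numbers is enumerated: by induction on `N`, the enumeration reaches
`(0, N)`, whence `(i, N)` for all `i ≤ N` and then `(N, j)` for all `j ≤ N`. -/
theorem pr_surj {i j : M} (hi : IsNat i) (hj : IsNat j) : ∃ m, Pr m i j := by
  have s1 : ∀ i j : M, i ε j → (∃ m, Pr m i j) → ∃ m, Pr m (sc i) j := by
    rintro i j hij ⟨m, h⟩
    exact ⟨_, pairNext_step (p := m) (q := op (sc i) j) h.1 h
      ⟨i, j, isOPair_iff.2 rfl, Or.inl ⟨hij, _, isSucc_iff.2 rfl, isOPair_iff.2 rfl⟩⟩ _ _ rfl⟩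
  have s2 : ∀ i j : M, ¬ i ε sc j → (∃ m, Pr m i (sc j)) → ∃ m, Pr m i j := by
    rintro i j hij ⟨m, h⟩
    exact ⟨_, pairNext_step (p := m) (q := op i j) h.1 h
        ⟨i, sc j, isOPair_iff.2 rfl,
          Or.inr (Or.inl ⟨hij, _, isSucc_iff.2 rfl, isOPair_iff.2 rfl⟩)⟩ _ _ rfl⟩
  have s3 : ∀ i : M, (∃ m, Pr m i emp) → ∃ m, Pr m emp (sc i) := by
    rintro i ⟨m, h⟩
    exact ⟨_, pairNext_step (p := m) (q := op emp (sc i)) h.1 h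
        ⟨i, emp, isOPair_iff.2 rfl,
          Or.inr (Or.inr ⟨isEmp_iff.2 rfl, _, isSucc_iff.2 rfl, isOPair_iff.2 rfl⟩)⟩ _ _ rfl⟩
  have a1 : ∀ N : M, IsNat N → (∃ m, Pr m emp N) → ∀ i, IsNat i → i ε sc N → ∃ m, Pr m i N := by
    intro N hN h i hi
    refine nat_induction (fun i => i ε sc N → ∃ m, Pr m i N) (fun _ => h) ?_ hi
    intro i hi ih hiN
    have : i ε N := by
      rcases mem_sc.1 hiN with h | h
      · exact hN.1.trans (mem_sc_self i) h
      · exact h ▸ mem_sc_self i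
    exact s1 i N this (ih (mem_sc.2 (Or.inl this)))
  have a2 : ∀ N : M, IsNat N → (∃ m, Pr m emp N) → ∀ j, IsNat j → j ε sc N → ∃ m, Pr m N j := by
    intro N hN h j hj hjN
    by_contra hn
    have key := nat_induction (fun k : M => (j ε k ∨ j = k) → k ε sc N → ¬ ∃ m, Pr m N k) ?_ ?_ hN
    · exact key (mem_sc.1 hjN) (mem_sc_self N) (a1 N hN h N hN (mem_sc_self N))
    · intro h0 _
      rcases h0 with h0 | rfl
      · exact (not_mem_emp _ h0).elim
      · exact hn
    · intro k hk ih hjk hkN hp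
      rcases hjk with hjk | rfl
      · have : k ε N := by
          rcases mem_sc.1 hkN with h | h
          · exact hN.1.trans (mem_sc_self k) h
          · exact h ▸ mem_sc_self k
        refine ih (mem_sc.1 hjk) (mem_sc.2 (Or.inl this)) (s2 N k (fun h => ?_) hp)
        rcases mem_sc.1 h with h | rfl
        · exact mem_asymm h this
        · exact mem_irrefl _ this
      · exact hn hp
  have a3 : ∀ N : M, IsNat N → ∃ m, Pr m emp N := by
    intro N hN
    refine nat_induction (fun N => ∃ m, Pr m emp N) ⟨_, pr_zero⟩ ?_ hN
    intro N hN ih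
    refine s3 N (a2 N hN ih emp isNat_emp ?_)
    rcases ord_tri isOrd_emp hN.sc.1 with h | h | h
    · exact h
    · exact (sc_ne_emp _ h.symm).elim
    · exact (not_mem_emp _ h).elim
  rcases ord_tri hi.1 hj.1 with h | rfl | h
  · exact a1 j hj (a3 j hj) i hi (mem_sc.2 (Or.inl h))
  · exact a1 i hi (a3 i hi) i hi (mem_sc_self i)
  · exact a2 i hi (a3 i hi) j hj (mem_sc.2 (Or.inl h))

theorem IsSeq.val {s a n : M} (h : IsSeq s a) (hn : IsNat n) : ∃ v, v ε a ∧ App s n v := by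
  obtain ⟨v, hv⟩ := (h.2.1 n).2 hn
  exact ⟨v, h.2.2 _ _ hv, hv⟩

theorem IsSeq.nat {s a n v : M} (h : IsSeq s a) (hv : App s n v) : IsNat n := (h.2.1 n).1 ⟨v, hv⟩

theorem IsSeq.ext {s s' a b : M} (h : IsSeq s a) (h' : IsSeq s' b)
    (e : ∀ n v, IsNat n → App s n v → App s' n v) : s = s' := by
  refine fun_ext h.1 h'.1 fun n v => ⟨fun hv => e n v (h.nat hv) hv, fun hv => ?_⟩
  obtain ⟨w, -, hw⟩ := h.val (h'.nat hv)
  rwa [h'.1.2 _ _ _ hv (e n w (h'.nat hv) hw)]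

theorem IsSeq.mono {s a b : M} (h : IsSeq s a) (hab : ∀ n v, App s n v → v ε b) : IsSeq s b :=
  ⟨h.1, h.2.1, hab⟩

theorem exists_seq (a : M) (R : M → M → Prop) [Dfn2 Univ (fun _ => R)]
    (hf : ∀ n y y', IsNat n → R n y → R n y' → y = y') (he : ∀ n, IsNat n → ∃ y, y ε a ∧ R n y) :
    ∃ s, IsSeq s a ∧ ∀ n y, App s n y ↔ IsNat n ∧ R n y := by
  obtain ⟨s, hs, h⟩ := exists_map om R (fun y => y ε a) (fun n y y' hn => hf n y y' (mem_om.1 hn))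
    (fun n hn => (he n (mem_om.1 hn)).imp fun _ h => h.2) (fun n y hn hy => by
      obtain ⟨y', hy', h⟩ := he n (mem_om.1 hn)
      rwa [hf n y y' (mem_om.1 hn) hy h])
  simp only [mem_om] at hs h
  exact ⟨s, hs, h⟩

theorem exists_const {a x : M} (hx : x ε a) :
    ∃ s, IsSeq s a ∧ ∀ n y, App s n y ↔ IsNat n ∧ y = x :=
  exists_seq a (fun _ y => y = x) (fun _ _ _ _ h h' => h.trans h'.symm) fun _ _ => ⟨x, hx, rfl⟩

theorem Three.unique {a b c n y y' : M} (h : Three a b c n y) (h' : Three a b c n y') :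
    y = y' := by
  have h01 : ¬ (IsNum 0 n ∧ IsNum 1 n) := fun ⟨h, h'⟩ => by
    rw [isNum_iff] at h h'
    rw [h, num_inj] at h'
    omega
  rcases h with ⟨h1, h2⟩ | ⟨h1, h2⟩ | ⟨h1, h1', h2⟩ <;>
    rcases h' with ⟨h3, h4⟩ | ⟨h3, h4⟩ | ⟨h3, h3', h4⟩ <;> first
      | exact h2.trans h4.symm
      | exact (h01 ⟨h1, h3⟩).elim
      | exact (h01 ⟨h3, h1⟩).elim
      | contradiction

theorem exists_three (Q : M → Prop) {a b c : M} (ha : Q a) (hb : Q b) (hc : Q c) (n : M) :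
    ∃ y, Q y ∧ Three a b c n y := by
  by_cases h0 : IsNum 0 n
  · exact ⟨a, ha, Or.inl ⟨h0, rfl⟩⟩
  by_cases h1 : IsNum 1 n
  · exact ⟨b, hb, Or.inr (Or.inl ⟨h1, rfl⟩)⟩
  · exact ⟨c, hc, Or.inr (Or.inr ⟨h0, h1, rfl⟩)⟩

theorem three_zero (a b c : M) : Three a b c (num 0) a := Or.inl ⟨isNum_iff.2 rfl, rfl⟩

theorem three_one (a b c : M) : Three a b c (num 1) b := Or.inr (Or.inl ⟨isNum_iff.2 rfl, rfl⟩)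

theorem three_two (a b c : M) : Three a b c (num 2) c := by
  refine Or.inr (Or.inr ⟨?_, ?_, rfl⟩) <;>
  · rw [isNum_iff, num_inj]; omega

theorem exists_seq_three {δ a b c : M} (ha : a ε δ) (hb : b ε δ) (hc : c ε δ) :
    ∃ r, IsSeq r δ ∧ App r (num 0) a ∧ App r (num 1) b ∧ App r (num 2) c := by
  obtain ⟨r, hr, h⟩ := exists_seq δ (Three a b c) (fun _ _ _ _ h h' => h.unique h')
    fun n _ => exists_three (fun y => y ε δ) ha hb hc n
  exact ⟨r, hr, (h _ _).2 ⟨isNat_num _, three_zero a b c⟩,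
    (h _ _).2 ⟨isNat_num _, three_one a b c⟩, (h _ _).2 ⟨isNat_num _, three_two a b c⟩⟩

theorem Row.unique {δ s i r r' : M} (hi : IsNat i) (h : Row δ s i r) (h' : Row δ s i r') :
    r = r' := by
  refine h.2.1.ext h'.2.1 fun n v hn hv => ?_
  obtain ⟨m, hm⟩ := pr_surj hi hn
  exact (h'.2.2 m n v hm).1 ((h.2.2 m n v hm).2 hv)

/-- Countably many definably chosen elements of `δ ^ ω` are the rows of one element of `δ ^ ω`. -/
theorem exists_rows (δ : M) (R : M → M → Prop) [Dfn2 Univ (fun _ => R)]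
    (hf : ∀ i r r', IsNat i → R i r → R i r' → r = r')
    (he : ∀ i, IsNat i → ∃ r, IsSeq r δ ∧ R i r) :
    ∃ s, IsSeq s δ ∧ ∀ i r, IsNat i → R i r → Row δ s i r := by
  obtain ⟨s, hs, h⟩ := exists_seq δ (fun m v => ∃ i j r, IsNat i ∧ Pr m i j ∧ R i r ∧ App r j v) (by
    rintro m v v' hm ⟨i, j, r, hi, hp, hR, hv⟩ ⟨i', j', r', hi', hp', hR', hv'⟩
    obtain ⟨rfl, rfl⟩ := pr_unique hp hp'
    obtain rfl := hf i r r' hi hR hR'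
    obtain ⟨r', hr', h2⟩ := he i hi
    obtain rfl := hf i r r' hi hR h2
    exact hr'.1.2 _ _ _ hv hv') (by
    intro m hm
    obtain ⟨i, j, hi, hj, hp⟩ := exists_pr hm
    obtain ⟨r, hr, hR⟩ := he i hi
    obtain ⟨v, hv, hv'⟩ := hr.val hj
    exact ⟨v, hv, i, j, r, hi, hp, hR, hv'⟩)
  refine ⟨s, hs, fun i r hi hR => ?_⟩
  obtain ⟨r', hr', h2⟩ := he i hi
  obtain rfl := hf i r r' hi hR h2
  refine ⟨hs, hr', fun m j v hp => ?_⟩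
  rw [h]
  constructor
  · rintro ⟨hm, i', j', r', hi', hp', hR', hv⟩
    obtain ⟨rfl, rfl⟩ := pr_unique hp hp'
    rwa [hf i r r' hi hR hR']
  · intro hv
    exact ⟨hp.1, i, j, r, hi, hp, hR, hv⟩

/-- Choice for finitely many nonempty classes, by induction on their number; the theory has no axiom
of choice. -/
theorem finite_choice {n : M} (hn : IsNat n) (R : M → M → Prop) [Dfn2 Univ (fun _ => R)]
    (h : ∀ i, i ε n → ∃ y, R i y) : ∃ σ, IsFunction σ ∧ (∀ i, (∃ y, App σ i y) ↔ i ε n) ∧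
      ∀ i y, App σ i y → R i y := by
  revert h
  refine nat_induction (fun n => (∀ i, i ε n → ∃ y, R i y) → ∃ σ, IsFunction σ ∧
    (∀ i, (∃ y, App σ i y) ↔ i ε n) ∧ ∀ i y, App σ i y → R i y) (fun _ => ?_) ?_ hn
  · have h : ∀ x y : M, ¬ App emp x y := fun x y h => not_mem_emp _ (app_iff.1 h)
    exact ⟨emp, ⟨fun p hp => (not_mem_emp p hp).elim, fun x y y' h' => (h x y h').elim⟩,
      fun k => iff_of_false (fun ⟨X, hX⟩ => h _ _ hX) (not_mem_emp _),
      fun i y h' => (h i y h').elim⟩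
  · intro n hn ih h
    obtain ⟨σ, hσ, hd, hR⟩ := ih fun i hi => h i (mem_sc.2 (Or.inl hi))
    obtain ⟨y, hy⟩ := h n (mem_sc_self n)
    obtain ⟨τ, hτ, h'⟩ := exists_extend (x := n) (y := y) hσ fun z hz =>
      mem_irrefl n ((hd n).1 ⟨z, hz⟩)
    refine ⟨τ, hτ, fun i => ?_, fun i z hz => ?_⟩
    · rw [mem_sc, ← hd]
      constructor
      · rintro ⟨z, hz⟩
        rcases (h' _ _).1 hz with hz | ⟨rfl, -⟩
        · exact Or.inl ⟨z, hz⟩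
        · exact Or.inr rfl
      · rintro (⟨z, hz⟩ | rfl)
        · exact ⟨z, (h' _ _).2 (Or.inl hz)⟩
        · exact ⟨y, (h' _ _).2 (Or.inr ⟨rfl, rfl⟩)⟩
    · rcases (h' _ _).1 hz with hz | ⟨rfl, rfl⟩
      · exact hR i z hz
      · exact hy

theorem FinCode.unique {δ s q q' : M} {p : M → M → Prop}
    (hp : ∀ r v v', IsSeq r δ → p r v → p r v' → v = v') (h : FinCode δ p s q)
    (h' : FinCode δ p s q') : q = q' := by
  obtain ⟨r, n, z, hz, hr, hn, hn', hq, hd, hc⟩ := h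
  obtain ⟨r', n', z', hz', hr', hm, hm', hq', hd', hc'⟩ := h'
  obtain rfl := isEmp_iff.1 hz
  obtain rfl := isEmp_iff.1 hz'
  obtain rfl := hr.unique isNat_emp hr'
  obtain rfl := hr.2.1.1.2 _ _ _ hn hm
  refine fun_ext hq hq' ?_
  have key : ∀ i v v', App q i v → App q' i v' → v = v' := by
    intro i v v' hv hv'
    obtain ⟨j, r, hj, hr, hpr⟩ := hc i v hv
    obtain ⟨j', r', hj', hr', hpr'⟩ := hc' i v' hv'
    obtain rfl := isSucc_iff.1 hj
    obtain rfl := isSucc_iff.1 hj'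
    obtain rfl := hr.unique (hn'.mem ((hd i).1 ⟨v, hv⟩)).sc hr'
    exact hp _ _ _ hr.2.1 hpr hpr'
  intro i v
  constructor
  · intro hv
    obtain ⟨v', hv'⟩ := (hd' i).2 ((hd i).1 ⟨v, hv⟩)
    rwa [key i v v' hv hv']
  · intro hv
    obtain ⟨v', hv'⟩ := (hd i).2 ((hd' i).1 ⟨v, hv⟩)
    rwa [← key i v' v hv' hv]

/-- A finite sequence whose values all have codes in `δ ^ ω` has a code in `δ ^ ω`. The unused rows
are filled with the constant sequence that serves as row `0`. -/
theorem exists_finCode {δ n q : M} (p : M → M → Prop) [Dfn2 Univ (fun _ => p)]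
    (hδ : ∀ n, IsNat n → n ε δ) (hn : IsNat n) (hq : IsFunction q)
    (hd : ∀ i, (∃ v, App q i v) ↔ i ε n) (hc : ∀ i v, App q i v → ∃ r, IsSeq r δ ∧ p r v) :
    ∃ s, IsSeq s δ ∧ FinCode δ p s q := by
  obtain ⟨σ, hσ, hσd, hσ'⟩ := finite_choice hn
    (fun i r => IsSeq r δ ∧ ∃ v, App q i v ∧ p r v) (fun i hi => by
      obtain ⟨v, hv⟩ := (hd i).2 hi
      obtain ⟨r, hr, h⟩ := hc i v hv
      exact ⟨r, hr, v, hv, h⟩)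
  obtain ⟨c, hcs, hc'⟩ := exists_const (hδ n hn)
  obtain ⟨s, hs, h⟩ := exists_rows δ (fun i r =>
    (∃ j, IsSucc i j ∧ App σ j r) ∨ ((¬ ∃ j r, IsSucc i j ∧ App σ j r) ∧ r = c)) (by
      rintro i r r' hi (⟨j, hj, h⟩ | ⟨h, h1⟩) (⟨j', hj', h'⟩ | ⟨h', h1'⟩)
      · obtain rfl := isSucc_iff.1 hj
        obtain rfl := sc_inj (hi.mem (mem_sc_self j)).1
          (hi.mem ((hj' j').2 (Or.inr rfl))).1 (isSucc_iff.1 hj')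
        exact hσ.2 _ _ _ h h'
      · exact (h' ⟨j, r, hj, h⟩).elim
      · exact (h ⟨j', r', hj', h'⟩).elim
      · rw [h1, h1']) (by
      intro i hi
      by_cases h : ∃ j r, IsSucc i j ∧ App σ j r
      · obtain ⟨j, r, hj, h⟩ := h
        exact ⟨r, (hσ' j r h).1, Or.inl ⟨j, hj, h⟩⟩
      · exact ⟨c, hcs, Or.inr ⟨h, rfl⟩⟩)
  refine ⟨s, hs, c, n, emp, isEmp_iff.2 rfl, h _ _ isNat_emp (Or.inr ⟨?_, rfl⟩),
    (hc' _ _).2 ⟨isNat_emp, rfl⟩, hn, hq, hd, fun i v hv => ?_⟩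
  · rintro ⟨j, r, hj, -⟩
    exact sc_ne_emp j (isSucc_iff.1 hj).symm
  · obtain ⟨r, hr⟩ := (hσd i).2 ((hd i).1 ⟨v, hv⟩)
    obtain ⟨-, v', hv', hp⟩ := hσ' i r hr
    rw [hq.2 _ _ _ hv hv']
    exact ⟨sc i, r, isSucc_iff.2 rfl,
      h _ _ (hn.mem ((hd i).1 ⟨v, hv⟩)).sc (Or.inl ⟨i, isSucc_iff.2 rfl, hr⟩), hp⟩

theorem InstrOf.unique {r t t' : M} (hr : IsFunction r) (h : InstrOf r t) (h' : InstrOf r t') :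
    t = t' := by
  obtain ⟨x, y, z, a, b, c, hx, hy, hz, ha, hb, hc, ht⟩ := h
  obtain ⟨x', y', z', a', b', c', hx', hy', hz', ha', hb', hc', ht'⟩ := h'
  rw [isNum_iff] at hx hy hz hx' hy' hz'
  subst hx hy hz hx' hy' hz'
  rw [isTriple_iff] at ht ht'
  rw [ht, ht', hr.2 _ _ _ ha ha', hr.2 _ _ _ hb hb', hr.2 _ _ _ hc hc']

theorem exists_instrOf {δ t : M} (hδ : ∀ n, IsNat n → n ε δ) (ht : IsInstr t) :
    ∃ r, IsSeq r δ ∧ InstrOf r t := by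
  obtain ⟨a, b, c, ha, hb, hc, ht⟩ := ht
  obtain ⟨r, hr, h0, h1, h2⟩ := exists_seq_three (hδ a ha) (hδ b hb) (hδ c hc)
  exact ⟨r, hr, num 0, num 1, num 2, a, b, c, isNum_iff.2 rfl, isNum_iff.2 rfl, isNum_iff.2 rfl,
    h0, h1, h2, ht⟩

/-- Codes of formulas, being finite sequences of triples of natural numbers, are coded by elements
of `δ ^ ω`. -/
theorem exists_code_row {δ e : M} (hδ : ∀ n, IsNat n → n ε δ) (he : IsCode e) :
    ∃ s, IsSeq s δ ∧ FinCode δ InstrOf s e := by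
  obtain ⟨k, n, hk, hn, hm⟩ := he
  obtain rfl := isSucc_iff.1 hn
  exact exists_finCode InstrOf hδ hk.sc hm.1 hm.2.1 fun i v hv => exists_instrOf hδ (hm.2.2 i v hv)

end Rows

/-! ### Definable witnesses -/

section Least
variable {M : Type u} [SetStructure M]

/-- `t` precedes `t'` lexicographically: at the first difference, the value of `t` is smaller. -/
def LexLt (t t' : M) : Prop := ∃ i v v', App t i v ∧ App t' i v' ∧ v ε v' ∧
  ∀ j, j ε i → ∀ w, App t j w ↔ App t' j w

/-- `q` takes the value `v` where `t` takes the value `v + 1`, and the value of `σ` where `t` takes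
the value `0`. -/
def Merge (σ t q : M) : Prop := IsFunction q ∧
  ∀ i v, App q i v ↔ ∃ w, App t i w ∧ ((IsEmp w ∧ App σ i v) ∨ IsSucc w v)

section Inst
variable {C : M → Prop} [Inhab C]
variable (f g h : (ℕ → M) → M) [Trm C f] [Trm C g] [Trm C h]
instance : Dfn C (fun v => LexLt (f v) (g v)) := by unfold LexLt; infer_instance
instance : Dfn C (fun v => Merge (f v) (g v) (h v)) := by unfold Merge; infer_instance
end Inst

variable [hZ : ZF M]

/-- A nonempty definable class of sequences of ordinals of a fixed length `n < ω` has a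
lexicographically least element: the first `m` values are minimized by induction on `m ≤ n`. -/
theorem exists_lex_least {n : M} (hn : IsNat n) (R : M → Prop) [Dfn1 Univ (fun _ => R)]
    (hR : ∀ t, R t → IsMap t (fun i => i ε n) IsOrd) (h : ∃ t, R t) :
    ∃ t, R t ∧ ∀ t', R t' → t' = t ∨ LexLt t t' := by
  have key : ∀ m, IsNat m → (m ε n ∨ m = n) → ∃ t, R t ∧ ∀ t', R t' → LexLt t t' ∨
      ∀ j, j ε m → ∀ w, App t j w ↔ App t' j w := by
    intro m hm
    refine nat_induction (fun m => (m ε n ∨ m = n) → ∃ t, R t ∧ ∀ t', R t' → LexLt t t' ∨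
      ∀ j, j ε m → ∀ w, App t j w ↔ App t' j w) ?_ ?_ hm
    · intro _
      obtain ⟨t, ht⟩ := h
      exact ⟨t, ht, fun t' _ => Or.inr fun j hj => (not_mem_emp j hj).elim⟩
    · intro m hm ih hmn
      have hmn : m ε n := by
        rcases hmn with h | h
        · exact hn.1.trans (mem_sc_self m) h
        · exact h ▸ mem_sc_self m
      obtain ⟨t, ht, hl⟩ := ih (Or.inl hmn)
      obtain ⟨α, hα⟩ := ((hR t ht).2.1 m).2 hmn
      obtain ⟨β, hβ, ⟨u, hu, hut, huβ⟩, hmin⟩ := ord_min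
        (fun α => ∃ u, R u ∧ (∀ j, j ε m → ∀ w, App t j w ↔ App u j w) ∧ App u m α)
        ((hR t ht).2.2 _ _ hα) ⟨t, ht, fun _ _ _ => Iff.rfl, hα⟩
      refine ⟨u, hu, fun t' ht' => ?_⟩
      rcases hl t' ht' with ⟨i, v, v', hv, hv', hvv, hj⟩ | hj
      · by_cases him : i ε m
        · refine Or.inl ⟨i, v, v', (hut i him v).1 hv, hv', hvv, fun j hji w => ?_⟩
          rw [← hut j (hm.1.trans hji him), hj j hji]
        · have hin := (((hR t ht).2.1 i).1 ⟨v, hv⟩)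
          rcases (not_mem_iff hm.1 (hn.1.mem hin)).1 him with rfl | hmi
          · refine Or.inl ⟨m, β, v', huβ, hv', ?_, fun j hji w => ?_⟩
            · rcases ord_tri hβ ((hR t' ht').2.2 _ _ hv') with h | rfl | h
              · exact h
              · exact (hmin v hvv ⟨t, ht, fun _ _ _ => Iff.rfl, hv⟩).elim
              · exact (hmin v (hβ.trans hvv h) ⟨t, ht, fun _ _ _ => Iff.rfl, hv⟩).elim
            · rw [← hut j hji, hj j hji]
          · obtain ⟨v', hv'⟩ := ((hR t' ht').2.1 m).2 hmn
            have := (hj m hmi v').2 hv'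
            rcases ord_tri hβ ((hR t' ht').2.2 _ _ hv') with h | rfl | h
            · exact Or.inl ⟨m, β, v', huβ, hv', h, fun j hjm w => by
                rw [← hut j hjm, hj j ((hn.1.mem hin).trans hjm hmi)]⟩
            · refine Or.inr fun j hjm w => ?_
              rcases mem_sc.1 hjm with hjm | rfl
              · rw [← hut j hjm, hj j ((hn.1.mem hin).trans hjm hmi)]
              · exact ⟨fun h => (hR u hu).1.2 _ _ _ huβ h ▸ hv',
                  fun h => (hR t' ht').1.2 _ _ _ hv' h ▸ huβ⟩
            · exact (hmin v' h ⟨t, ht, fun _ _ _ => Iff.rfl, this⟩).elim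
      · obtain ⟨v', hv'⟩ := ((hR t' ht').2.1 m).2 hmn
        rcases ord_tri hβ ((hR t' ht').2.2 _ _ hv') with h | rfl | h
        · exact Or.inl ⟨m, β, v', huβ, hv', h, fun j hjm w => by rw [← hut j hjm, hj j hjm]⟩
        · refine Or.inr fun j hjm w => ?_
          rcases mem_sc.1 hjm with hjm | rfl
          · rw [← hut j hjm, hj j hjm]
          · exact ⟨fun h => (hR u hu).1.2 _ _ _ huβ h ▸ hv',
              fun h => (hR t' ht').1.2 _ _ _ hv' h ▸ huβ⟩
        · exact (hmin v' h ⟨t', ht', hj, hv'⟩).elim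
  obtain ⟨t, ht, hl⟩ := key n hn (Or.inr rfl)
  refine ⟨t, ht, fun t' ht' => ?_⟩
  rcases hl t' ht' with h | h
  · exact Or.inr h
  · refine Or.inl (fun_ext (hR t' ht').1 (hR t ht).1 fun i w => ?_)
    by_cases hi : i ε n
    · exact (h i hi w).symm
    · exact iff_of_false (fun hw => hi (((hR t' ht').2.1 i).1 ⟨w, hw⟩))
        fun hw => hi (((hR t ht).2.1 i).1 ⟨w, hw⟩)

theorem LexLt.asymm {n t t' : M} (hn : IsNat n) (ht : IsMap t (fun i => i ε n) IsOrd)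
    (ht' : IsMap t' (fun i => i ε n) IsOrd) (h : LexLt t t') : ¬ LexLt t' t := by
  rintro ⟨i', u', u, hu', hu, huu, hj'⟩
  obtain ⟨i, v, v', hv, hv', hvv, hj⟩ := h
  rcases ord_tri (hn.1.mem ((ht.2.1 i).1 ⟨v, hv⟩)) (hn.1.mem ((ht.2.1 i').1 ⟨u, hu⟩))
    with h | rfl | h
  · obtain rfl := ht.1.2 _ _ _ hv ((hj' i h _).1 hv')
    exact mem_irrefl _ hvv
  · obtain rfl := ht.1.2 _ _ _ hv hu
    obtain rfl := ht'.1.2 _ _ _ hv' hu'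
    exact mem_asymm hvv huu
  · obtain rfl := ht.1.2 _ _ _ hu ((hj i' h _).2 hu')
    exact mem_irrefl _ huu

theorem Merge.unique {σ t q q' : M} (h : Merge σ t q) (h' : Merge σ t q') : q = q' :=
  fun_ext h.1 h'.1 fun i v => (h.2 i v).trans (h'.2 i v).symm

theorem DefinedBy.unique {P : M → Prop} {x y α e q : M} (h : DefinedBy P x α e q)
    (h' : DefinedBy P y α e q) : x = y := by
  obtain ⟨-, A, hA, -, -, X, hX, hd⟩ := h
  obtain ⟨-, A', hA', -, -, X', hX', hd'⟩ := h'
  obtain rfl := hA.unique hA'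
  obtain rfl : X = X' := ext fun y => (hd y).trans (hd' y).symm
  have := (hX' x).1 ((hX x).2 (Or.inl rfl))
  rwa [or_self] at this

/-- A class that is definable from ordinals and elements of `λ ^ ω` and that has a member in
`OD_{λ ^ ω}` has a member definable from ordinals and elements of `λ ^ ω` by a formula of the
metatheory: the finite sequence of parameters from `λ ^ ω` and the code of the formula are absorbed
into elements of `λ ^ ω`, and the ordinal parameters are chosen lexicographically least. -/
theorem exists_sd {lam : M} (hl : IsOrd lam) (hω : ∀ n, IsNat n → n ε lam) (Q : M → Prop)
    [hd : Dfn1 (SD (fun s => IsSeq s lam)) (fun _ => Q)]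
    (h : ∃ x, OD (fun s => IsSeq s lam) x ∧ Q x) :
    ∃ x, SD (fun s => IsSeq s lam) x ∧ Q x := by
  obtain ⟨x, ⟨α, e, q, hD⟩, hQ⟩ := h
  have : Dfn1 Univ (fun _ => Q) := ⟨hd.out.mono fun _ _ => trivial⟩
  have := (SD.of_ord (P := fun s => IsSeq s lam) hl).cst
  obtain ⟨hα, A, hA, he, ⟨n, hn, hq⟩, X, hX, hd⟩ := id hD
  obtain ⟨z, hz, -⟩ := exists_const (hω emp isNat_emp)
  obtain ⟨σ, hσ, hσ'⟩ := exists_map n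
    (fun i v => (App q i v ∧ IsSeq v lam) ∨ (¬ (∃ v, App q i v ∧ IsSeq v lam) ∧ v = z))
    (fun v => IsSeq v lam) (by
      rintro i v v' hi (⟨h1, h2⟩ | ⟨h1, h2⟩) (⟨h3, h4⟩ | ⟨h3, h4⟩)
      · exact hq.1.2 _ _ _ h1 h3
      · exact (h3 ⟨_, h1, h2⟩).elim
      · exact (h1 ⟨_, h3, h4⟩).elim
      · rw [h2, h4]) (by
      intro i hi
      by_cases h : ∃ v, App q i v ∧ IsSeq v lam
      · exact h.imp fun v h => Or.inl h
      · exact ⟨z, Or.inr ⟨h, rfl⟩⟩) (by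
      rintro i v hi (⟨h1, h2⟩ | ⟨h1, rfl⟩)
      · exact h2
      · exact hz)
  obtain ⟨t, ht, ht'⟩ := exists_map n
    (fun i w => ∃ v, App q i v ∧ ((IsSeq v lam ∧ IsEmp w) ∨ (¬ IsSeq v lam ∧ IsSucc w v))) IsOrd (by
      rintro i w w' hi ⟨v, hv, h⟩ ⟨v', hv', h'⟩
      obtain rfl := hq.1.2 _ _ _ hv hv'
      rcases h with ⟨h1, h2⟩ | ⟨h1, h2⟩ <;> rcases h' with ⟨h3, h4⟩ | ⟨h3, h4⟩
      · rw [isEmp_iff.1 h2, isEmp_iff.1 h4]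
      · exact (h3 h1).elim
      · exact (h1 h3).elim
      · rw [isSucc_iff.1 h2, isSucc_iff.1 h4]) (by
      intro i hi
      obtain ⟨v, hv⟩ := (hq.2.1 i).2 hi
      by_cases h : IsSeq v lam
      · exact ⟨emp, v, hv, Or.inl ⟨h, isEmp_iff.2 rfl⟩⟩
      · exact ⟨sc v, v, hv, Or.inr ⟨h, isSucc_iff.2 rfl⟩⟩) (by
      rintro i w hi ⟨v, hv, ⟨h1, h2⟩ | ⟨h1, h2⟩⟩
      · rw [isEmp_iff.1 h2]; exact isOrd_emp
      · rw [isSucc_iff.1 h2]; exact ((hq.2.2 i v hv).2.resolve_right h1).sc)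
  have hm : Merge σ t q := by
    refine ⟨hq.1, fun i v => ⟨fun hv => ?_, ?_⟩⟩
    · have hi := (hq.2.1 i).1 ⟨v, hv⟩
      by_cases h : IsSeq v lam
      · exact ⟨emp, (ht' _ _).2 ⟨hi, v, hv, Or.inl ⟨h, isEmp_iff.2 rfl⟩⟩,
          Or.inl ⟨isEmp_iff.2 rfl, (hσ' _ _).2 ⟨hi, Or.inl ⟨hv, h⟩⟩⟩⟩
      · exact ⟨sc v, (ht' _ _).2 ⟨hi, v, hv, Or.inr ⟨h, isSucc_iff.2 rfl⟩⟩,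
          Or.inr (isSucc_iff.2 rfl)⟩
    · rintro ⟨w, hw, h⟩
      obtain ⟨hi, v', hv', h'⟩ := (ht' _ _).1 hw
      rcases h' with ⟨h1, h2⟩ | ⟨h1, h2⟩
      · rcases h with ⟨-, h⟩ | h
        · rcases ((hσ' _ _).1 h).2 with h | h
          · exact h.1
          · exact (h.1 ⟨_, hv', h1⟩).elim
        · exact (sc_ne_emp v ((isSucc_iff.1 h).symm.trans (isEmp_iff.1 h2))).elim
      · rcases h with ⟨h, -⟩ | h
        · exact (sc_ne_emp v' ((isSucc_iff.1 h2).symm.trans (isEmp_iff.1 h))).elim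
        · obtain rfl := isSucc_iff.1 h
          have hv'' := (hq.2.2 i v' hv').2.resolve_right h1
          have : IsOrd v := ((isSucc_iff.1 h2).symm ▸ hv''.sc : IsOrd (sc v)).mem (mem_sc_self v)
          rwa [sc_inj this hv'' (isSucc_iff.1 h2)]
  obtain ⟨sσ, hsσ, hcσ⟩ := exists_finCode (fun r v => r = v) hω hn hσ.1 hσ.2.1
    (fun i v hv => ⟨v, hσ.2.2 i v hv, rfl⟩)
  obtain ⟨se, hse, hce⟩ := exists_code_row hω he
  have c1 := (SD.of_mem (P := fun s => IsSeq s lam) hsσ).cst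
  have c2 := (SD.of_mem (P := fun s => IsSeq s lam) hse).cst
  have c3 : Cst (SD (fun s => IsSeq s lam)) σ := (SD.of_unique
    (fun σ => FinCode lam (fun r v => r = v) sσ σ) hcσ fun y hy =>
      hy.unique (fun r v v' _ h h' => h.symm.trans h') hcσ).cst
  have c4 : Cst (SD (fun s => IsSeq s lam)) e := (SD.of_unique
    (fun e => FinCode lam InstrOf se e) hce fun y hy =>
      hy.unique (fun r v v' hr h h' => h.unique hr.1 h') hce).cst
  have c5 : Cst (SD (fun s => IsSeq s lam)) α := (SD.of_ord hα).cst
  have c6 : Cst (SD (fun s => IsSeq s lam)) n := (SD.of_ord hn.1).cst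
  obtain ⟨T, ⟨hT, q', hq', y, hQy, hy⟩, hmin⟩ := exists_lex_least hn
    (fun t => IsMap t (fun i => i ε n) IsOrd ∧ ∃ q, Merge σ t q ∧ ∃ y, Q y ∧
      DefinedBy (fun s => IsSeq s lam) y α e q) (fun t h => h.1) ⟨t, ht, q, hm, x, hQ, hD⟩
  have c7 : Cst (SD (fun s => IsSeq s lam)) T := (SD.of_unique
    (fun T => (IsMap T (fun i => i ε n) IsOrd ∧ ∃ q, Merge σ T q ∧ ∃ y, Q y ∧
      DefinedBy (fun s => IsSeq s lam) y α e q) ∧ ∀ t', (IsMap t' (fun i => i ε n) IsOrd ∧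
      ∃ q, Merge σ t' q ∧ ∃ y, Q y ∧ DefinedBy (fun s => IsSeq s lam) y α e q) →
        t' = T ∨ LexLt T t')
    ⟨⟨hT, q', hq', y, hQy, hy⟩, hmin⟩ (by
      rintro T' ⟨hT', hmin'⟩
      rcases hmin T' hT' with h | h
      · exact h
      rcases hmin' T ⟨hT, q', hq', y, hQy, hy⟩ with h' | h'
      · exact h'.symm
      · exact (h.asymm hn hT hT'.1 h').elim)).cst
  have c8 : Cst (SD (fun s => IsSeq s lam)) q' := (SD.of_unique (fun q => Merge σ T q) hq'
    fun y hy => hy.unique hq').cst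
  exact ⟨y, SD.of_unique (fun y => DefinedBy (fun s => IsSeq s lam) y α e q') hy
    fun y' h => h.unique hy, hQy⟩

end Least

/-! ### Definability in the upper Chang model -/

section Chang
variable {M : Type u} [SetStructure M]

/-- `x` is definable from ordinals and elements of `λ ^ ω` by a formula of the metatheory. -/
abbrev SDL (lam : M) : M → Prop := SD (fun s => IsSeq s lam)

/-- The consequences of `⋈_λ` on which the proof rests. -/
structure ChangPair (lam κ : M) : Prop where
  ord : IsOrd lam
  theta : IsTheta (CMid lam) κ
  regular : IsRegular κ
  succ : IsCardSucc (CPlus lam) κ lam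
  cf : IsCf (CPlus lam) lam lam
  mid : ∀ A, (∀ s, s ε A → IsSeq s κ) → (CMid lam A ↔ CPlus lam A)

theorem Dfn1.univ {C : M → Prop} {Q : M → Prop} (h : Dfn1 C (fun _ => Q)) :
    Dfn1 Univ (fun _ => Q) := ⟨h.out.mono fun _ _ => trivial⟩

theorem Dfn2.univ {C : M → Prop} {Q : M → M → Prop} (h : Dfn2 C (fun _ => Q)) :
    Dfn2 Univ (fun _ => Q) := ⟨h.out.mono fun _ _ => trivial⟩

variable [hZ : ZF M] {lam κ : M}

/-- A set that is definable from ordinals and elements of `λ ^ ω` belongs to `C⁺` as soon as its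
elements lie in the transitive set formed by `λ`, the pairs of elements of `λ`, and `λ ^ ω`. -/
theorem cPlus_of_subset (hl : IsOrd lam) (hω : ∀ n, IsNat n → n ε lam) {h : M} (hh : SDL lam h)
    (hz : ∀ z, z ε h → z ε lam ∨ (∃ a b, a ε lam ∧ b ε lam ∧ IsPair z a b) ∨
      (∃ a b, a ε lam ∧ b ε lam ∧ IsOPair z a b) ∨ IsSeq z lam) : CPlus lam h := by
  obtain ⟨P, hP⟩ := exists_powerset lam
  obtain ⟨P', hP'⟩ := exists_sep (fun z => ∃ a b, a ε lam ∧ b ε lam ∧ IsPair z a b) P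
  obtain ⟨R, hR⟩ := exists_prod lam lam
  obtain ⟨S, hS⟩ := exists_mapsNat lam
  obtain ⟨T1, hT1⟩ := exists_bunion lam P'
  obtain ⟨T2, hT2⟩ := exists_bunion R S
  obtain ⟨T3, hT3⟩ := exists_bunion T1 T2
  obtain ⟨T, hT⟩ := exists_insert T3 h
  have hT3' : ∀ z, z ε T3 ↔ z ε lam ∨ (∃ a b, a ε lam ∧ b ε lam ∧ IsPair z a b) ∨
      (∃ a b, a ε lam ∧ b ε lam ∧ IsOPair z a b) ∨ IsSeq z lam := by
    intro z
    rw [hT3, hT1, hT2, hP', hR, hS, or_assoc]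
    refine or_congr Iff.rfl (or_congr ⟨fun h => h.2, ?_⟩ (or_congr ?_ Iff.rfl))
    · rintro ⟨a, b, ha, hb, h⟩
      refine ⟨(hP z).2 fun w hw => ?_, a, b, ha, hb, h⟩
      rcases (h w).1 hw with rfl | rfl
      · exact ha
      · exact hb
    · simp only [isOPair_iff]
  have htr : ∀ z w, z ε T3 → w ε z → w ε T3 := by
    intro z w hz hw
    rw [hT3'] at hz ⊢
    rcases hz with hz | ⟨a, b, ha, hb, h⟩ | ⟨a, b, ha, hb, u, v, hu, hv, h⟩ | hz
    · exact Or.inl (hl.trans hw hz)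
    · left
      rcases (h w).1 hw with rfl | rfl
      · exact ha
      · exact hb
    · right; left
      rcases (h w).1 hw with rfl | rfl
      · exact ⟨a, a, ha, ha, hu⟩
      · exact ⟨a, b, ha, hb, hv⟩
    · right; right; left
      obtain ⟨n, v, hnv⟩ := hz.1.1 w hw
      have : App z n v := ⟨w, hnv, hw⟩
      exact ⟨n, v, hω n (hz.nat this), hz.2.2 _ _ this, hnv⟩
  refine ⟨T, fun z w hz' hw => ?_, (hT h).2 (Or.inr rfl), fun z hz' => ?_⟩
  · rw [hT] at hz' ⊢
    left
    rcases hz' with hz' | rfl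
    · exact htr z w hz' hw
    · exact (hT3' w).2 (hz w hw)
  · refine SD.od ?_
    rw [hT] at hz'
    rcases hz' with hz' | rfl
    · rcases (hT3' z).1 hz' with hz | ⟨a, b, ha, hb, hz⟩ | ⟨a, b, ha, hb, hz⟩ | hz
      · exact SD.of_ord (hl.mem hz)
      · have := (SD.of_ord (P := fun s => IsSeq s lam) (hl.mem ha)).cst
        have := (SD.of_ord (P := fun s => IsSeq s lam) (hl.mem hb)).cst
        exact SD.of_unique (fun z => IsPair z a b) hz fun y hy => hy.unique hz
      · have := (SD.of_ord (P := fun s => IsSeq s lam) (hl.mem ha)).cst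
        have := (SD.of_ord (P := fun s => IsSeq s lam) (hl.mem hb)).cst
        exact SD.of_unique (fun z => IsOPair z a b) hz fun y hy => hy.unique hz
      · exact SD.of_mem hz
    · exact hh

namespace ChangPair

theorem limit_κ (J : ChangPair lam κ) : IsLimit κ := J.regular.1
theorem κ_mem (J : ChangPair lam κ) : κ ε lam := J.succ.2.1
theorem nat_κ (J : ChangPair lam κ) {n : M} (hn : IsNat n) : n ε κ := om_sub_limit J.limit_κ hn
theorem nat_lam (J : ChangPair lam κ) (n : M) (hn : IsNat n) : n ε lam :=
  J.ord.trans (J.nat_κ hn) J.κ_mem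
theorem κ_sub (J : ChangPair lam κ) {x : M} (hx : x ε κ) : x ε lam := J.ord.trans hx J.κ_mem

theorem cst_lam (J : ChangPair lam κ) : Cst (SDL lam) lam := (SD.of_ord J.ord).cst
theorem cst_mem (J : ChangPair lam κ) {x : M} (hx : x ε lam) : Cst (SDL lam) x :=
  (SD.of_ord (J.ord.mem hx)).cst

/-- Definable maps from `ν < λ` to `λ` are bounded, since `λ` is regular in `C⁺`. -/
theorem exists_bound_map (J : ChangPair lam κ) {ν r : M} (hν : ν ε lam) (hr : SDL lam r)
    (hm : IsMap r (fun x => x ε ν) (fun y => y ε lam)) :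
    ∃ γ, γ ε lam ∧ ∀ x y, App r x y → y ε γ := by
  have hc : CPlus lam r := by
    refine cPlus_of_subset J.ord J.nat_lam hr fun z hz => Or.inr (Or.inr (Or.inl ?_))
    obtain ⟨x, y, hxy⟩ := hm.1.1 z hz
    have h : App r x y := ⟨z, hxy, hz⟩
    exact ⟨x, y, J.ord.trans ((hm.2.1 x).1 ⟨y, h⟩) hν, hm.2.2 _ _ h, hxy⟩
  by_contra hn
  refine J.cf.2.2 ν r hν hc ⟨hm, fun ξ hξ => ?_⟩
  by_contra hn'
  refine hn ⟨ξ, hξ, fun x y hxy => ?_⟩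
  have hy := J.ord.mem (hm.2.2 _ _ hxy)
  by_contra h
  rw [not_mem_iff (J.ord.mem hξ) hy] at h
  exact hn' ⟨x, y, hxy, h⟩

/-- The form of `exists_bound_map` for partial maps given by a definable relation. -/
theorem exists_bound_of_mem (J : ChangPair lam κ) {ν : M} (hν : ν ε lam) (R : M → M → Prop)
    [hd : Dfn2 (SDL lam) (fun _ => R)] (hf : ∀ x y y', x ε ν → R x y → R x y' → y = y')
    (hR : ∀ x y, x ε ν → R x y → y ε lam) :
    ∃ γ, γ ε lam ∧ ∀ x y, x ε ν → R x y → y ε γ := by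
  have := hd.univ
  have := J.cst_mem hν
  obtain ⟨r, hr, h⟩ := exists_map ν (fun x y => R x y ∨ ((¬ ∃ y, R x y) ∧ IsEmp y))
    (fun y => y ε lam) (by
      rintro x y y' hx (h1 | ⟨h1, h2⟩) (h3 | ⟨h3, h4⟩)
      · exact hf x y y' hx h1 h3
      · exact (h3 ⟨_, h1⟩).elim
      · exact (h1 ⟨_, h3⟩).elim
      · rw [isEmp_iff.1 h2, isEmp_iff.1 h4]) (by
      intro x hx
      by_cases h : ∃ y, R x y
      · exact h.imp fun _ h => Or.inl h
      · exact ⟨emp, Or.inr ⟨h, isEmp_iff.2 rfl⟩⟩) (by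
      rintro x y hx (h | ⟨-, h⟩)
      · exact hR x y hx h
      · rw [isEmp_iff.1 h]; exact J.nat_lam _ isNat_emp)
  obtain ⟨γ, hγ, hb⟩ := J.exists_bound_map hν (r := r) (SD.of_unique
    (fun r => IsFunction r ∧ ∀ x y, App r x y ↔ x ε ν ∧ (R x y ∨ ((¬ ∃ y, R x y) ∧ IsEmp y)))
    ⟨hr.1, h⟩ fun y hy => fun_ext hy.1 hr.1 fun a b => (hy.2 a b).trans (h a b).symm) hr
  exact ⟨γ, hγ, fun x y hx hxy => hb x y ((h x y).2 ⟨hx, Or.inl hxy⟩)⟩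

theorem limit_lam (J : ChangPair lam κ) : IsLimit lam := by
  rcases zero_succ_limit J.ord with h | ⟨μ, hμ, h⟩ | h
  · exact (not_mem_emp κ (h ▸ J.κ_mem)).elim
  · have hμl : μ ε lam := h ▸ mem_sc_self μ
    have := J.cst_mem hμl
    obtain ⟨γ, hγ, hb⟩ := J.exists_bound_of_mem (J.nat_lam _ isNat_emp.sc) (fun x y => y = μ)
      (fun x y y' _ h h' => h.trans h'.symm) (fun x y _ h => h ▸ hμl)
    have := hb emp μ (mem_sc_self _) rfl
    rw [h, mem_sc] at hγ
    rcases hγ with hγ | rfl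
    · exact (mem_asymm hγ this).elim
    · exact (mem_irrefl _ this).elim
  · exact h

end ChangPair
end Chang

/-! ### Sequences with a prefixed value -/

section Shift
variable {M : Type u} [SetStructure M]

/-- `x n = s (n + 1)`. -/
def Shift (s x : M) : Prop := ∀ n v, App x n v ↔ ∃ n', IsSucc n' n ∧ App s n' v

/-- `w` is the first value of `s`. -/
def First (s w : M) : Prop := ∃ z, IsEmp z ∧ App s z w

section Inst
variable {C : M → Prop} [Inhab C]
variable (f g h : (ℕ → M) → M) [Trm C f] [Trm C g] [Trm C h]
instance : Dfn C (fun v => Shift (f v) (g v)) := by unfold Shift; infer_instance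
instance : Dfn C (fun v => First (f v) (g v)) := by unfold First; infer_instance
end Inst

variable [hZ : ZF M]

theorem Shift.unique {s x x' : M} (hx : IsFunction x) (hx' : IsFunction x') (h : Shift s x)
    (h' : Shift s x') : x = x' :=
  fun_ext hx hx' fun n v => (h n v).trans (h' n v).symm

theorem first_iff {s w : M} : First s w ↔ App s emp w :=
  ⟨fun ⟨_, hz, h⟩ => isEmp_iff.1 hz ▸ h, fun h => ⟨_, isEmp_iff.2 rfl, h⟩⟩

theorem First.unique {s w w' : M} (hs : IsFunction s) (h : First s w) (h' : First s w') : w = w' :=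
  hs.2 _ _ _ (first_iff.1 h) (first_iff.1 h')

theorem exists_cons {a w x : M} (hw : w ε a) (hx : IsSeq x a) :
    ∃ s, IsSeq s a ∧ First s w ∧ Shift s x := by
  obtain ⟨s, hs, h⟩ := exists_seq a (fun n y => (IsEmp n ∧ y = w) ∨ ∃ m, IsSucc n m ∧ App x m y) (by
    rintro n y y' hn (⟨h1, h2⟩ | ⟨m, h1, h2⟩) (⟨h3, h4⟩ | ⟨m', h3, h4⟩)
    · rw [h2, h4]
    · exact (h1 m' ((h3 m').2 (Or.inr rfl))).elim
    · exact (h3 m ((h1 m).2 (Or.inr rfl))).elim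
    · have hm := (hn.mem ((h1 m).2 (Or.inr rfl))).1
      have hm' := (hn.mem ((h3 m').2 (Or.inr rfl))).1
      obtain rfl := sc_inj hm hm' ((isSucc_iff.1 h1).symm.trans (isSucc_iff.1 h3))
      exact hx.1.2 _ _ _ h2 h4) (by
    intro n hn
    rcases hn.cases with rfl | ⟨m, hm, rfl⟩
    · exact ⟨w, hw, Or.inl ⟨isEmp_iff.2 rfl, rfl⟩⟩
    · obtain ⟨v, hv, hv'⟩ := hx.val hm
      exact ⟨v, hv, Or.inr ⟨m, isSucc_iff.2 rfl, hv'⟩⟩)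
  refine ⟨s, hs, first_iff.2 ((h _ _).2 ⟨isNat_emp, Or.inl ⟨isEmp_iff.2 rfl, rfl⟩⟩), fun n v => ?_⟩
  constructor
  · intro hv
    exact ⟨_, isSucc_iff.2 rfl, (h _ _).2 ⟨(hx.nat hv).sc, Or.inr ⟨n, isSucc_iff.2 rfl, hv⟩⟩⟩
  · rintro ⟨n', hn', hv⟩
    obtain ⟨hn, ⟨h1, -⟩ | ⟨m, h1, h2⟩⟩ := (h _ _).1 hv
    · exact (h1 n ((hn' n).2 (Or.inr rfl))).elim
    · have e := (isSucc_iff.1 hn').symm.trans (isSucc_iff.1 h1)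
      obtain rfl := isSucc_iff.1 hn'
      have hm : IsOrd m := hn.1.mem (e ▸ mem_sc_self m)
      rwa [sc_inj (hn.1.mem (mem_sc_self n)) hm e]

/-! ### Absoluteness for transitive sets -/

variable {X : M} (hX : IsTrans X)
include hX

theorem El.isEmp {p : El X} : IsEmp p ↔ IsEmp p.1 :=
  ⟨fun h z hz => h ⟨z, hX _ _ p.2 hz⟩ hz, fun h z hz => h z.1 hz⟩

theorem El.isPair {p a b : El X} : IsPair p a b ↔ IsPair p.1 a.1 b.1 := by
  constructor
  · intro h z
    constructor
    · intro hz
      rcases (h ⟨z, hX _ _ p.2 hz⟩).1 hz with h | h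
      · exact Or.inl (congrArg Subtype.val h)
      · exact Or.inr (congrArg Subtype.val h)
    · rintro (rfl | rfl)
      · exact (h a).2 (Or.inl rfl)
      · exact (h b).2 (Or.inr rfl)
  · intro h z
    refine (h z.1).trans ?_
    simp only [Subtype.ext_iff]

theorem El.isOPair {p a b : El X} : IsOPair p a b ↔ IsOPair p.1 a.1 b.1 := by
  constructor
  · rintro ⟨u, v, hu, hv, hp⟩
    exact ⟨u.1, v.1, (El.isPair hX).1 hu, (El.isPair hX).1 hv, (El.isPair hX).1 hp⟩
  · rintro ⟨u, v, hu, hv, hp⟩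
    have hu' := hX _ _ p.2 ((hp u).2 (Or.inl rfl))
    have hv' := hX _ _ p.2 ((hp v).2 (Or.inr rfl))
    exact ⟨⟨u, hu'⟩, ⟨v, hv'⟩, (El.isPair hX).2 hu, (El.isPair hX).2 hv, (El.isPair hX).2 hp⟩

theorem El.isSucc {p a : El X} : IsSucc p a ↔ IsSucc p.1 a.1 := by
  constructor
  · intro h z
    constructor
    · intro hz
      rcases (h ⟨z, hX _ _ p.2 hz⟩).1 hz with h | h
      · exact Or.inl h
      · exact Or.inr (congrArg Subtype.val h)
    · rintro (hz | rfl)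
      · exact (h ⟨z, hX _ _ a.2 hz⟩).2 (Or.inl hz)
      · exact (h a).2 (Or.inr rfl)
  · intro h z
    refine (h z.1).trans ?_
    simp only [Subtype.ext_iff]
    exact Iff.rfl

theorem El.app {f a b : El X} : App f a b ↔ App f.1 a.1 b.1 := by
  constructor
  · rintro ⟨p, hp, h⟩
    exact ⟨p.1, (El.isOPair hX).1 hp, h⟩
  · rintro ⟨p, hp, h⟩
    exact ⟨⟨p, hX _ _ f.2 h⟩, (El.isOPair hX).2 hp, h⟩

theorem IsTrans.of_op {a b : M} (h : op a b ε X) : a ε X ∧ b ε X := by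
  obtain ⟨u, v, hu, hv, hp⟩ := isOPair_iff.2 (rfl : op a b = op a b)
  have hv' := hX _ _ h ((hp v).2 (Or.inr rfl))
  exact ⟨hX _ _ hv' ((hv a).2 (Or.inl rfl)), hX _ _ hv' ((hv b).2 (Or.inr rfl))⟩

theorem IsTrans.of_app {f a b : M} (hf : f ε X) (h : App f a b) : a ε X ∧ b ε X :=
  IsTrans.of_op hX (hX _ _ hf (app_iff.1 h))

theorem El.shift {s x : El X} : Shift s x ↔ Shift s.1 x.1 := by
  constructor
  · intro h n v
    constructor
    · intro hv
      have := IsTrans.of_app hX x.2 hv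
      obtain ⟨n', h1, h2⟩ := (h ⟨n, this.1⟩ ⟨v, this.2⟩).1 ((El.app hX).2 hv)
      exact ⟨n'.1, (El.isSucc hX).1 h1, (El.app hX).1 h2⟩
    · rintro ⟨n', h1, h2⟩
      have := IsTrans.of_app hX s.2 h2
      have hn := hX _ _ this.1 ((h1 n).2 (Or.inr rfl))
      exact (El.app hX).1 ((h ⟨n, hn⟩ ⟨v, this.2⟩).2
        ⟨⟨n', this.1⟩, (El.isSucc hX).2 h1, (El.app hX).2 h2⟩)
  · intro h n v
    rw [El.app hX, h]
    constructor
    · rintro ⟨n', h1, h2⟩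
      have := IsTrans.of_app hX s.2 h2
      exact ⟨⟨n', this.1⟩, (El.isSucc hX).2 h1, (El.app hX).2 h2⟩
    · rintro ⟨n', h1, h2⟩
      exact ⟨n'.1, (El.isSucc hX).1 h1, (El.app hX).1 h2⟩

theorem El.first {s w : El X} : First s w ↔ First s.1 w.1 := by
  constructor
  · rintro ⟨z, h1, h2⟩
    exact ⟨z.1, (El.isEmp hX).1 h1, (El.app hX).1 h2⟩
  · rintro ⟨z, h1, h2⟩
    have := IsTrans.of_app hX s.2 h2
    exact ⟨⟨z, this.1⟩, (El.isEmp hX).2 h1, (El.app hX).2 h2⟩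

end Shift

/-! ### The stages of the middle Chang model -/

section LStage
variable {M : Type u} [SetStructure M]

/-- `X` is a stage of the hierarchy over `𝓗 ∩ (γ × γ)` and `γ ^ ω` whose union is the class `C_γ`.
-/
def IsLStage (γ X : M) : Prop :=
  ∃ h s a, IsColl h (fun p => ∃ α β, α ε γ ∧ β ε γ ∧ IsOPair p α β ∧ HH α β) ∧
    IsColl s (fun y => IsSeq y γ) ∧ IsOPair a h s ∧ ∃ T, IsTrCl T a ∧ ∃ β,
    IsStage (fun y => y ε T) (fun _ Y y => IsDef Y NoPred y) β X

variable {γ X : M}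

theorem cMid_iff {x : M} : CMid γ x ↔ ∃ X, IsLStage γ X ∧ x ε X := by
  constructor
  · rintro ⟨h, s, a, hh, hs, ha, T, hT, β, X, hX, hx⟩
    exact ⟨X, ⟨h, s, a, hh, hs, ha, T, hT, β, hX⟩, hx⟩
  · rintro ⟨X, ⟨h, s, a, hh, hs, ha, T, hT, β, hX⟩, hx⟩
    exact ⟨h, s, a, hh, hs, ha, T, hT, β, X, hX, hx⟩

variable [hZ : ZF M]

theorem IsDef.sub {Y y : M} {H : M → M → Prop} (h : IsDef Y H y) : Sub y Y := by
  obtain ⟨e, q, -, -, h⟩ := h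
  exact fun z hz => ((h z).1 hz).1

theorem isDef_of_mem {Y y : M} (hY : IsTrans Y) (hy : y ε Y) : IsDef Y NoPred y := by
  have : Nonempty (El Y) := ⟨⟨y, hy⟩⟩
  exact isDef_of_dfn (fun z : El Y => z ε (⟨y, hy⟩ : El Y)) fun z =>
    ⟨fun hz => ⟨hY _ _ hy hz, hz⟩, fun ⟨_, hz⟩ => hz⟩

theorem isTrans_lstage {T β : M} (hT : IsTrans T)
    (hX : IsStage (fun y => y ε T) (fun _ Y y => IsDef Y NoPred y) β X) : IsTrans X := by
  refine stage_induction (base := fun y => y ε T) (Step := fun _ Y y => IsDef Y NoPred y)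
    (fun _ X => IsTrans X) ?_ ?_ ?_ hX
  · intro X h
    rwa [ext (x := X) (y := T) h]
  · intro β Y X _ hY hX y z hy hz
    exact (hX z).2 (isDef_of_mem hY (((hX y).1 hy).sub z hz))
  · intro η X _ ih hX y z hy hz
    obtain ⟨γ, Y, hγ, hY, hy⟩ := (hX y).1 hy
    exact (hX z).2 ⟨γ, Y, hγ, hY, ih γ Y hγ hY _ _ hy hz⟩

theorem lstage_mono {T β β' X' : M} (hT : IsTrans T)
    (hX : IsStage (fun y => y ε T) (fun _ Y y => IsDef Y NoPred y) β X)
    (hX' : IsStage (fun y => y ε T) (fun _ Y y => IsDef Y NoPred y) β' X')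
    (h : β = β' ∨ β ε β') : Sub X X' :=
  stage_mono (base := fun y => y ε T) (Step := fun _ Y y => IsDef Y NoPred y)
    (fun _ _ _ hY hx => isDef_of_mem (isTrans_lstage hT hY) hx) hX hX' h

theorem exists_lstage (T : M) {β : M} (hβ : IsOrd β) :
    ∃ X, IsStage (fun y => y ε T) (fun _ Y y => IsDef Y NoPred y) β X :=
  exists_stage (base := fun y => y ε T) (Step := fun _ Y y => IsDef Y NoPred y)
    ⟨T, fun _ => Iff.rfl⟩ (fun β Y _ => by
      obtain ⟨P, hP⟩ := exists_powerset Y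
      obtain ⟨X, hX⟩ := exists_sep (fun y => IsDef Y NoPred y) P
      exact ⟨X, fun x => (hX x).trans ⟨fun h => h.2, fun h => ⟨(hP x).2 h.sub, h⟩⟩⟩) hβ

namespace IsLStage

theorem trans (h : IsLStage γ X) : IsTrans X := by
  obtain ⟨h, s, a, hh, hs, ha, T, hT, β, hX⟩ := h
  exact isTrans_lstage hT.1 hX

theorem exists_seqs (h : IsLStage γ X) : ∃ s, s ε X ∧ ∀ y, y ε s ↔ IsSeq y γ := by
  obtain ⟨h, s, a, hh, hs, ha, T, hT, β, hX⟩ := h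
  refine ⟨s, ?_, hs⟩
  obtain ⟨X0, h0⟩ := exists_lstage T isOrd_emp
  have hsub : Sub X0 X := lstage_mono hT.1 h0 hX (by
    rcases ord_tri isOrd_emp hX.ord with h | h | h
    · exact Or.inr h
    · exact Or.inl h
    · exact (not_mem_emp _ h).elim)
  refine hsub _ ((stage_zero h0 s).2 (IsTrans.of_op hT.1 (a := h) ?_).2)
  rw [← isOPair_iff.1 ha]
  exact hT.2.1

theorem seq_mem (h : IsLStage γ X) {s : M} (hs : IsSeq s γ) : s ε X := by
  obtain ⟨S, hS, hS'⟩ := h.exists_seqs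
  exact h.trans _ _ hS ((hS' s).2 hs)

theorem exists_next (h : IsLStage γ X) : ∃ X', IsLStage γ X' ∧ Sub X X' ∧
    ∀ y, IsDef X NoPred y → y ε X' := by
  obtain ⟨h, s, a, hh, hs, ha, T, hT, β, hX⟩ := h
  obtain ⟨X', hX'⟩ := exists_lstage T hX.ord.sc
  exact ⟨X', ⟨h, s, a, hh, hs, ha, T, hT, _, hX'⟩,
    lstage_mono hT.1 hX hX' (Or.inr (mem_sc_self _)),
    fun y hy => (stage_succ hX hX' y).2 hy⟩

theorem exists_pairs (h : IsLStage γ X) : ∃ X', IsLStage γ X' ∧ Sub X X' ∧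
    ∀ x y p, x ε X → y ε X → IsPair p x y → p ε X' := by
  obtain ⟨X', hX', hs, hd⟩ := h.exists_next
  refine ⟨X', hX', hs, fun x y p hx hy hp => hd p ?_⟩
  have : Nonempty (El X) := ⟨⟨x, hx⟩⟩
  refine isDef_of_dfn (fun z : El X => z = ⟨x, hx⟩ ∨ z = ⟨y, hy⟩) fun z => ?_
  simp only [Subtype.mk.injEq]
  rw [hp]
  exact ⟨by rintro (rfl | rfl) <;> simp [hx, hy], fun h => h.2⟩

theorem exists_opairs (h : IsLStage γ X) : ∃ X', IsLStage γ X' ∧ Sub X X' ∧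
    ∀ x y, x ε X → y ε X → op x y ε X' := by
  obtain ⟨X', hX', hs, hd⟩ := h.exists_pairs
  obtain ⟨X'', hX'', hs', hd'⟩ := hX'.exists_pairs
  refine ⟨X'', hX'', fun z hz => hs' z (hs z hz), fun x y hx hy => ?_⟩
  obtain ⟨u, v, hu, hv, hp⟩ := isOPair_iff.2 (rfl : op x y = op x y)
  exact hd' _ _ _ (hd _ _ _ hx hx hu) (hd _ _ _ hx hy hv) hp

end IsLStage
end LStage

namespace ChangPair
variable {M : Type u} [SetStructure M] [hZ : ZF M] {lam κ : M}

theorem seq_of_real (J : ChangPair lam κ) {x : M} (h : IsReal x) : IsSeq x κ :=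
  ⟨h.1, h.2.1, fun n v hv => J.nat_κ (h.2.2 n v hv)⟩

theorem seq_lam (J : ChangPair lam κ) {s : M} (h : IsSeq s κ) : IsSeq s lam :=
  h.mono fun n v hv => J.κ_sub (h.2.2 n v hv)

theorem cMid_of_sdl (J : ChangPair lam κ) {A : M} (hA : SDL lam A) (h : ∀ s, s ε A → IsSeq s κ) :
    CMid lam A :=
  (J.mid A h).2 (cPlus_of_subset J.ord J.nat_lam hA fun s hs =>
    Or.inr (Or.inr (Or.inr (J.seq_lam (h s hs)))))

/-- `Θ` of the middle Chang model bounds the maps on the reals that are definable from ordinals and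
elements of `λ ^ ω`: such a map onto `κ + 1` can be coded by a subset of `κ ^ ω`, which lies in the
middle model. -/
theorem not_surj (J : ChangPair lam κ) {g : M} (hg : SDL lam g)
    (hs : IsSurj g IsReal (fun y => y ε sc κ)) : False := by
  have hκ := J.regular.1.1
  have := J.cst_mem J.κ_mem
  have := hg.cst
  obtain ⟨S, hS⟩ := exists_mapsNat κ
  obtain ⟨A, hA⟩ := exists_sep (fun s => IsSeq s κ ∧ ∃ x w y, IsReal x ∧ Shift s x ∧ First s w ∧
    App g x y ∧ Sub w y) S
  replace hA : ∀ s, s ε A ↔ IsSeq s κ ∧ ∃ x w y, IsReal x ∧ Shift s x ∧ First s w ∧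
    App g x y ∧ Sub w y := fun s => (hA s).trans ⟨fun h => h.2, fun h => ⟨(hS s).2 h.1, h⟩⟩
  have hAs : SDL lam A := SD.of_unique (fun A => ∀ s, s ε A ↔ IsSeq s κ ∧ ∃ x w y, IsReal x ∧
    Shift s x ∧ First s w ∧ App g x y ∧ Sub w y) hA fun B hB =>
      ext fun s => (hB s).trans (hA s).symm
  obtain ⟨X, hX, hAX⟩ := cMid_iff.1 (J.cMid_of_sdl hAs fun s hs => ((hA s).1 hs).1)
  have hAs' : ∀ x w y, IsReal x → App g x y → w ε κ → Sub w y →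
      ∃ s, s ε A ∧ Shift s x ∧ First s w := by
    intro x w y hx hxy hw hwy
    obtain ⟨s, hs, h1, h2⟩ := exists_cons hw (J.seq_of_real hx)
    exact ⟨s, (hA s).2 ⟨hs, x, w, y, hx, h2, h1, hxy, hwy⟩, h2, h1⟩
  -- the value of `g` at `x` is the union of the first values of the `s ∈ A` with tail `x`
  have hgA : ∀ x y, IsReal x → (App g x y ↔
      ∀ ξ, ξ ε y ↔ ∃ s, s ε A ∧ Shift s x ∧ ∃ w, First s w ∧ ξ ε w) := by
    intro x y hx
    obtain ⟨y', hy'⟩ := (hs.1.2.1 x).2 hx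
    have hyκ := hs.1.2.2 _ _ hy'
    have hy'o : IsOrd y' := hκ.sc.mem hyκ
    have key : ∀ ξ, ξ ε y' ↔ ∃ s, s ε A ∧ Shift s x ∧ ∃ w, First s w ∧ ξ ε w := by
      intro ξ
      constructor
      · intro hξ
        rcases mem_sc.1 hyκ with h | h
        · obtain ⟨s, h1, h2, h3⟩ := hAs' x y' y' hx hy' h fun _ h => h
          exact ⟨s, h1, h2, y', h3, hξ⟩
        · have h1 : sc ξ ε κ := J.limit_κ.sc_mem (h ▸ hξ)
          have h2 : Sub (sc ξ) y' := by
            rw [h]; exact fun z hz => hκ.trans hz h1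
          obtain ⟨s, h1, h2, h3⟩ := hAs' x _ y' hx hy' h1 h2
          exact ⟨s, h1, h2, _, h3, mem_sc_self ξ⟩
      · rintro ⟨s, h1, h2, w, h3, h4⟩
        obtain ⟨h5, x', w', y, hx', h6, h7, h8, h9⟩ := (hA s).1 h1
        obtain rfl := h2.unique hx.1 hx'.1 h6
        obtain rfl := h3.unique h5.1 h7
        obtain rfl := hs.1.1.2 _ _ _ h8 hy'
        exact h9 _ h4
    constructor
    · intro hy
      rwa [hs.1.1.2 _ _ _ hy hy']
    · intro h
      rwa [ext (x := y) (y := y') fun ξ => (h ξ).trans (key ξ).symm]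
  have hgA' : ∀ x, IsReal x ↔ ∃ s, s ε A ∧ Shift s x ∧ IsFunction x := by
    intro x
    constructor
    · intro hx
      obtain ⟨y, hy⟩ := (hs.1.2.1 x).2 hx
      obtain ⟨s, h1, h2, -⟩ := hAs' x emp y hx hy (J.nat_κ isNat_emp)
        fun z hz => (not_mem_emp z hz).elim
      exact ⟨s, h1, h2, hx.1⟩
    · rintro ⟨s, h1, h2, h3⟩
      obtain ⟨-, x', w', y, hx', h6, -⟩ := (hA s).1 h1
      rwa [h2.unique h3 hx'.1 h6]
  obtain ⟨X1, hX1, hs1, hd1⟩ := hX.exists_next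
  obtain ⟨X2, hX2, hs2, hd2⟩ := hX1.exists_opairs
  obtain ⟨X3, hX3, hs3, hd3⟩ := hX2.exists_next
  have hval : ∀ x y, App g x y → op x y ε X2 := by
    intro x y hxy
    have hx := (hs.1.2.1 x).1 ⟨y, hxy⟩
    have hxX := hX.seq_mem (J.seq_lam (J.seq_of_real hx))
    refine hd2 _ _ (hs1 _ hxX) (hd1 _ ?_)
    have : Nonempty (El X) := ⟨⟨x, hxX⟩⟩
    refine isDef_of_dfn (fun ξ : El X => ∃ s, s ε (⟨A, hAX⟩ : El X) ∧ Shift s ⟨x, hxX⟩ ∧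
      ∃ w, First s w ∧ ξ ε w) fun ξ => ((hgA x y hx).1 hxy ξ).trans ?_
    constructor
    · rintro ⟨s, h1, h2, w, h3, h4⟩
      have hsX := hX.trans _ _ hAX h1
      have hw := (IsTrans.of_app hX.trans hsX (first_iff.1 h3)).2
      exact ⟨hX.trans _ _ hw h4, ⟨s, hsX⟩, h1, (El.shift hX.trans).2 h2, ⟨w, hw⟩,
        (El.first hX.trans).2 h3, h4⟩
    · rintro ⟨hξ, s, h1, h2, w, h3, h4⟩
      exact ⟨s.1, h1, (El.shift hX.trans).1 h2, w.1, (El.first hX.trans).1 h3, h4⟩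
  have hAX2 := hs2 _ (hs1 _ hAX)
  obtain ⟨R, hRX, hR⟩ := hX2.exists_seqs
  have hgX : g ε X3 := by
    refine hd3 g ?_
    have : Nonempty (El X2) := ⟨⟨A, hAX2⟩⟩
    refine isDef_of_dfn (fun p : El X2 => ∃ x y, IsOPair p x y ∧ x ε (⟨R, hRX⟩ : El X2) ∧
      (∃ s, s ε (⟨A, hAX2⟩ : El X2) ∧ Shift s x) ∧
      ∀ ξ, ξ ε y ↔ ∃ s, s ε (⟨A, hAX2⟩ : El X2) ∧ Shift s x ∧ ∃ w, First s w ∧ ξ ε w)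
      fun p => ?_
    constructor
    · intro hp
      obtain ⟨x, y, hxy⟩ := hs.1.1.1 p hp
      have hxy' : App g x y := ⟨p, hxy, hp⟩
      have hpX := hval x y hxy'
      have hxyX := IsTrans.of_op hX2.trans hpX
      have hx := (hs.1.2.1 x).1 ⟨y, hxy'⟩
      obtain ⟨s, h1, h2, -⟩ := (hgA' x).1 hx
      refine ⟨isOPair_iff.1 hxy ▸ hpX, ⟨x, hxyX.1⟩, ⟨y, hxyX.2⟩, (El.isOPair hX2.trans).2 hxy,
        (hR x).2 (J.seq_lam (J.seq_of_real hx)), ⟨⟨s, hX2.trans _ _ hAX2 h1⟩, h1,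
        (El.shift hX2.trans).2 h2⟩, fun ξ => ((hgA x y hx).1 hxy' ξ.1).trans ?_⟩
      constructor
      · rintro ⟨s, h1, h2, w, h3, h4⟩
        have hsX := hX2.trans _ _ hAX2 h1
        have hw := (IsTrans.of_app hX2.trans hsX (first_iff.1 h3)).2
        exact ⟨⟨s, hsX⟩, h1, (El.shift hX2.trans).2 h2, ⟨w, hw⟩, (El.first hX2.trans).2 h3, h4⟩
      · rintro ⟨s, h1, h2, w, h3, h4⟩
        exact ⟨s.1, h1, (El.shift hX2.trans).1 h2, w.1, (El.first hX2.trans).1 h3, h4⟩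
    · rintro ⟨hpX, x, y, hp, hx, ⟨s, h1, h2⟩, h⟩
      have hxr : IsReal x.1 := (hgA' x.1).2
        ⟨s.1, h1, (El.shift hX2.trans).1 h2, ((hR x.1).1 hx).1⟩
      have : App g x.1 y.1 := by
        refine (hgA _ _ hxr).2 fun ξ => ?_
        constructor
        · intro hξ
          obtain ⟨s, h1, h2, w, h3, h4⟩ := (h ⟨ξ, hX2.trans _ _ y.2 hξ⟩).1 hξ
          exact ⟨s.1, h1, (El.shift hX2.trans).1 h2, w.1, (El.first hX2.trans).1 h3, h4⟩
        · rintro ⟨s, h1, h2, w, h3, h4⟩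
          have hsX := hX2.trans _ _ hAX2 h1
          have hw := (IsTrans.of_app hX2.trans hsX (first_iff.1 h3)).2
          exact (h ⟨ξ, hX2.trans _ _ hw h4⟩).2 ⟨⟨s, hsX⟩, h1, (El.shift hX2.trans).2 h2,
            ⟨w, hw⟩, (El.first hX2.trans).2 h3, h4⟩
      have hp' := (El.isOPair hX2.trans).1 hp
      obtain rfl : p = op x.1 y.1 := isOPair_iff.1 hp'
      exact app_iff.1 this
  refine mem_irrefl κ ((J.theta.2 κ).2 ⟨sc κ, ⟨hκ.sc, g, cMid_iff.2 ⟨X3, hX3, hgX⟩, ?_⟩,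
    mem_sc_self κ⟩)
  refine ⟨⟨hs.1.1, fun x => (hs.1.2.1 x).trans ⟨fun hx => ⟨?_, hx⟩, fun h => h.2⟩, hs.1.2.2⟩, hs.2⟩
  exact cMid_iff.2 ⟨X, hX, hX.seq_mem (J.seq_lam (J.seq_of_real hx))⟩

end ChangPair

/-! ### Countable choice for sets of reals -/

section CC
variable {M : Type u} [SetStructure M] [hZ : ZF M]

theorem isReal_iff {x : M} : IsReal x ↔ IsSeq x om := by simp only [IsReal, IsSeq, mem_om]

theorem isRealSeq_iff {R : M} (hR : ∀ x, x ε R ↔ IsReal x) {b : M} : IsRealSeq b ↔ IsSeq b R := by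
  simp only [IsRealSeq, IsSeq, hR]

theorem exists_restr {a R : M} (ha : IsSeq a R) (n : M) : ∃ s, IsRestr s a n := by
  obtain ⟨s, hs, h⟩ := exists_fun n (fun i v => App a i v) fun i v v' _ h h' => ha.1.2 _ _ _ h h'
  exact ⟨s, hs, h⟩

theorem IsRestr.unique {a n s s' : M} (h : IsRestr s a n) (h' : IsRestr s' a n) : s = s' :=
  fun_ext h.1 h'.1 fun i v => (h.2 i v).trans (h'.2 i v).symm

theorem IsRestr.finSeq {a n s : M} (ha : IsRealSeq a) (hn : IsNat n) (h : IsRestr s a n) :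
    IsFinSeq s IsReal := by
  refine ⟨n, hn, h.1, fun i => ⟨fun ⟨v, hv⟩ => ((h.2 i v).1 hv).1, fun hi => ?_⟩,
    fun i v hv => ha.2.2 _ _ ((h.2 i v).1 hv).2⟩
  obtain ⟨v, hv⟩ := (ha.2.1 i).2 (hn.mem hi)
  exact ⟨v, (h.2 i v).2 ⟨hi, hv⟩⟩

/-- Countable choice for sets of reals, from the game in which player I names a natural number `n`
by the first value of the first move, and player II has to answer with a first move in the `n`-th
set. -/
theorem countable_choice (adr : ModelsADR M) (Q : M → M → Prop) [Dfn2 Univ (fun _ => Q)]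
    (h : ∀ n, IsNat n → ∃ y, IsReal y ∧ Q n y) :
    ∃ c, IsRealSeq c ∧ ∀ n y, App c n y → Q n y := by
  obtain ⟨R, hR⟩ : ∃ R : M, ∀ x, x ε R ↔ IsReal x := by
    obtain ⟨R, hR⟩ := exists_mapsNat (om : M)
    exact ⟨R, fun x => (hR x).trans isReal_iff.symm⟩
  obtain ⟨S, hS⟩ := exists_mapsNat R
  obtain ⟨P, hP⟩ := exists_prod S S
  obtain ⟨A, hA⟩ := exists_sep (fun p => ∃ a b x n y, IsOPair p a b ∧ First a x ∧ First x n ∧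
    First b y ∧ ¬ Q n y) P
  rcases adr A with ⟨σ, hσ, hw⟩ | ⟨τ, hτ, hw⟩
  · exfalso
    obtain ⟨e, he, he'⟩ := exists_fun (emp : M) (fun _ y : M => y = y)
      fun x _ _ hx => (not_mem_emp x hx).elim
    have he'' : ∀ i v, ¬ App e i v := fun i v h => not_mem_emp i ((he' i v).1 h).1
    obtain ⟨x, hx⟩ := (hσ.2.1 e).2 ⟨emp, isNat_emp, he, fun i => iff_of_false
      (fun ⟨v, hv⟩ => he'' i v hv) (not_mem_emp i), fun i v hv => (he'' i v hv).elim⟩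
    have hxr := hσ.2.2 _ _ hx
    obtain ⟨n, hn, hxn⟩ := (isReal_iff.1 hxr).val isNat_emp
    obtain ⟨y, hy, hQ⟩ := h n (mem_om.1 hn)
    obtain ⟨b, hb, hb'⟩ := exists_const ((hR y).2 hy)
    have hbr := (isRealSeq_iff hR).2 hb
    obtain ⟨a, ha, ha'⟩ := exists_seq R (fun n v => ∃ s, IsRestr s b n ∧ App σ s v) (by
      rintro n v v' _ ⟨s, hs, hv⟩ ⟨s', hs', hv'⟩
      obtain rfl := hs.unique hs'
      exact hσ.1.2 _ _ _ hv hv') (by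
      intro n hn
      obtain ⟨s, hs⟩ := exists_restr hb n
      obtain ⟨v, hv⟩ := (hσ.2.1 s).2 (hs.finSeq hbr hn)
      exact ⟨v, (hR v).2 (hσ.2.2 _ _ hv), s, hs, hv⟩)
    obtain ⟨p, hp, hpA⟩ := hw a b ((isRealSeq_iff hR).2 ha) hbr fun n s v hn hs hv =>
      (ha' n v).2 ⟨hn, s, hs, hv⟩
    obtain ⟨-, a', b', x', n', y', hp', h1, h2, h3, h4⟩ := (hA p).1 hpA
    obtain ⟨rfl, rfl⟩ := hp.inj hp'
    obtain rfl := ((hb' _ _).1 (first_iff.1 h3)).2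
    obtain ⟨-, s, hs, hx'⟩ := (ha' _ _).1 (first_iff.1 h1)
    obtain rfl : s = e := fun_ext hs.1 he fun i v => iff_of_false
      (fun h => not_mem_emp i ((hs.2 i v).1 h).1) (he'' i v)
    obtain rfl := hσ.1.2 _ _ _ hx hx'
    obtain rfl := hxr.1.2 _ _ _ hxn (first_iff.1 h2)
    exact h4 hQ
  · have hτ' : ∀ n, IsNat n → ∃ x s y, (∀ i w, App x i w ↔ IsNat i ∧ w = n) ∧ IsFunction s ∧
        IsFunction x ∧
        (∀ i w, App s i w ↔ IsEmp i ∧ w = x) ∧ App τ s y ∧ IsReal y ∧ Q n y := by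
      intro n hn
      obtain ⟨x, hx, hx'⟩ := exists_const (mem_om.2 hn)
      obtain ⟨a, ha, ha'⟩ := exists_const ((hR x).2 (isReal_iff.2 hx))
      have har := (isRealSeq_iff hR).2 ha
      obtain ⟨b, hb, hb'⟩ := exists_seq R
        (fun n v => ∃ n' s, IsSucc n' n ∧ IsRestr s a n' ∧ App τ s v) (by
        rintro n v v' _ ⟨m, s, hm, hs, hv⟩ ⟨m', s', hm', hs', hv'⟩
        obtain rfl := isSucc_iff.1 hm
        obtain rfl := isSucc_iff.1 hm'
        obtain rfl := hs.unique hs'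
        exact hτ.1.2 _ _ _ hv hv') (by
        intro n hn
        obtain ⟨s, hs⟩ := exists_restr ha (sc n)
        obtain ⟨v, hv⟩ := (hτ.2.1 s).2 (hs.finSeq har hn.sc)
        exact ⟨v, (hR v).2 (hτ.2.2 _ _ hv), _, s, isSucc_iff.2 rfl, hs, hv⟩)
      have := hw a b har ((isRealSeq_iff hR).2 hb) fun n n' s v hn hn' hs hv =>
        (hb' n v).2 ⟨hn, n', s, hn', hs, hv⟩
      obtain ⟨y, hy, hby⟩ := hb.val isNat_emp
      obtain ⟨-, n', s, hn', hs, hv⟩ := (hb' _ _).1 hby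
      refine ⟨x, s, y, hx', hs.1, hx.1, fun i w => ?_, hv, (hR y).1 hy, ?_⟩
      · rw [hs.2, isSucc_iff.1 hn', mem_sc, ha', isEmp_iff]
        constructor
        · rintro ⟨h | h, -, h'⟩
          · exact (not_mem_emp _ h).elim
          · exact ⟨h, h'⟩
        · rintro ⟨rfl, h'⟩
          exact ⟨Or.inr rfl, isNat_emp, h'⟩
      · by_contra hQ
        refine this ⟨op a b, isOPair_iff.2 rfl, (hA _).2 ⟨(hP _).2
          ⟨a, b, (hS a).2 ha, (hS b).2 hb, rfl⟩, a, b, x, n, y, isOPair_iff.2 rfl, ?_, ?_, ?_, hQ⟩⟩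
        · exact first_iff.2 ((ha' _ _).2 ⟨isNat_emp, rfl⟩)
        · exact first_iff.2 ((hx' _ _).2 ⟨isNat_emp, rfl⟩)
        · exact first_iff.2 hby
    obtain ⟨c, hc, hc'⟩ := exists_seq R (fun n y => ∃ x s, (∀ i w, App x i w ↔ IsNat i ∧ w = n) ∧
        IsFunction s ∧ IsFunction x ∧ (∀ i w, App s i w ↔ IsEmp i ∧ w = x) ∧ App τ s y ∧
        IsReal y ∧ Q n y) (by
      rintro n y y' _ ⟨x, s, h1, h2, h3, h4, h5, -⟩ ⟨x', s', h1', h2', h3', h4', h5', -⟩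
      obtain rfl := fun_ext h3 h3' fun i w => (h1 i w).trans (h1' i w).symm
      obtain rfl := fun_ext h2 h2' fun i w => (h4 i w).trans (h4' i w).symm
      exact hτ.1.2 _ _ _ h5 h5') (by
      intro n hn
      obtain ⟨x, s, y, h⟩ := hτ' n hn
      exact ⟨y, (hR y).2 h.2.2.2.2.2.1, x, s, h⟩)
    exact ⟨c, (isRealSeq_iff hR).2 hc, fun n y hy => by
      obtain ⟨-, x, s, h⟩ := (hc' n y).1 hy
      exact h.2.2.2.2.2.2⟩

end CC

/-! ### Coding sequences of ordinals below `κ` by reals -/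

/-- The elements of `A`, seen as pairs consisting of a first value `w` and a tail, which is a real
`x`. -/
def Codes {M : Type u} [SetStructure M] (A x w : M) : Prop :=
  ∃ s, s ε A ∧ IsReal x ∧ Shift s x ∧ First s w

/-- The rows of the real `x` code, through `A`, the values of `s`. -/
def CodesSeq {M : Type u} [SetStructure M] (A w x s : M) : Prop :=
  IsReal x ∧ ∀ n v, App s n v → ∃ r, Row w x n r ∧ Codes A r v

section
variable {M : Type u} [SetStructure M] {C : M → Prop} [Inhab C]
variable (f g h k : (ℕ → M) → M) [Trm C f] [Trm C g] [Trm C h] [Trm C k]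
instance : Dfn C (fun v => Codes (f v) (g v) (h v)) := by unfold Codes; infer_instance
instance : Dfn C (fun v => CodesSeq (f v) (g v) (h v) (k v)) := by unfold CodesSeq; infer_instance
end

section
variable {M : Type u} [SetStructure M] [hZ : ZF M]

/-- The codes of the values of `s` are selected by countable choice. -/
theorem exists_codesSeq (adr : ModelsADR M) {η A s : M} (hA : ∀ w, w ε η → ∃ x, Codes A x w)
    (hs : IsSeq s η) : ∃ x, CodesSeq A om x s := by
  obtain ⟨c, hc, hc'⟩ := countable_choice adr (fun n x => ∃ v, App s n v ∧ Codes A x v) (by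
    intro n hn
    obtain ⟨v, hv, hv'⟩ := hs.val hn
    obtain ⟨x, hx⟩ := hA v hv
    exact ⟨x, by obtain ⟨s, -, hx, -⟩ := hx; exact hx, v, hv', hx⟩)
  obtain ⟨x, hx, h⟩ := exists_rows om (fun n r => App c n r)
    (fun i r r' _ h h' => hc.1.2 _ _ _ h h')
    (fun i hi => by
      obtain ⟨r, hr⟩ := (hc.2.1 i).2 hi
      exact ⟨r, isReal_iff.1 (hc.2.2 _ _ hr), hr⟩)
  refine ⟨x, isReal_iff.2 hx, fun n v hv => ?_⟩
  obtain ⟨r, hr⟩ := (hc.2.1 n).2 (hs.nat hv)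
  obtain ⟨v', hv', hr'⟩ := hc' n r hr
  obtain rfl := hs.1.2 _ _ _ hv hv'
  exact ⟨r, h n r (hs.nat hv) hr, hr'⟩

theorem CodesSeq.unique {η η' A s s' x : M} (hA : ∀ x w w', Codes A x w → Codes A x w' → w = w')
    (hs : IsSeq s η) (hs' : IsSeq s' η') (h : CodesSeq A om x s) (h' : CodesSeq A om x s') :
    s = s' := by
  refine hs.ext hs' fun n v hn hv => ?_
  obtain ⟨v', -, hv'⟩ := hs'.val hn
  obtain ⟨r, hr, hc⟩ := h.2 n v hv
  obtain ⟨r', hr', hc'⟩ := h'.2 n v' hv'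
  obtain rfl := hr.unique hn hr'
  rwa [hA _ _ _ hc hc']

end

namespace ChangPair
variable {M : Type u} [SetStructure M] [hZ : ZF M] {lam κ : M}

/-- The form of `not_surj` for a definable relation that covers `κ + 1` on the reals. -/
theorem not_surj_rel (J : ChangPair lam κ) (R : M → M → Prop) [hd : Dfn2 (SDL lam) (fun _ => R)]
    (hf : ∀ x y y', IsReal x → R x y → R x y' → y = y')
    (hs : ∀ y, y ε sc κ → ∃ x, IsReal x ∧ R x y) : False := by
  have := hd.univ
  have := (SD.of_ord (P := fun s => IsSeq s lam) J.limit_κ.1.sc).cst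
  obtain ⟨S, hS⟩ := exists_mapsNat (om : M)
  obtain ⟨g, hg, hg'⟩ := exists_map S
    (fun x y => (R x y ∧ y ε sc κ) ∨ (¬ (∃ y, R x y ∧ y ε sc κ) ∧ IsEmp y)) (fun y => y ε sc κ) (by
      rintro x y y' hx (h1 | ⟨h1, h2⟩) (h3 | ⟨h3, h4⟩)
      · exact hf x y y' (isReal_iff.2 ((hS x).1 hx)) h1.1 h3.1
      · exact (h3 ⟨_, h1⟩).elim
      · exact (h1 ⟨_, h3⟩).elim
      · rw [isEmp_iff.1 h2, isEmp_iff.1 h4]) (by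
      intro x hx
      by_cases h : ∃ y, R x y ∧ y ε sc κ
      · exact h.imp fun _ h => Or.inl h
      · exact ⟨emp, Or.inr ⟨h, isEmp_iff.2 rfl⟩⟩) (by
      rintro x y hx (h | ⟨-, h⟩)
      · exact h.2
      · rw [isEmp_iff.1 h]; exact mem_sc.2 (Or.inl (J.nat_κ isNat_emp)))
  simp only [hS, ← isReal_iff] at hg hg'
  have hgs : SDL lam g := SD.of_unique (fun g => IsFunction g ∧ ∀ x y, App g x y ↔ IsReal x ∧
    ((R x y ∧ y ε sc κ) ∨ (¬ (∃ y, R x y ∧ y ε sc κ) ∧ IsEmp y))) ⟨hg.1, hg'⟩ fun y hy =>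
      fun_ext hy.1 hg.1 fun a b => (hy.2 a b).trans (hg' a b).symm
  refine J.not_surj hgs ⟨hg, fun y hy => ?_⟩
  obtain ⟨x, hx, h⟩ := hs y hy
  exact ⟨x, (hg' x y).2 ⟨hx, Or.inl ⟨h, hy⟩⟩⟩

/-- `κ` is uncountable, as `ℝ` maps onto `ω + 1`. -/
theorem om_mem (J : ChangPair lam κ) : om ε κ := by
  rcases ord_tri isOrd_om J.limit_κ.1 with h | h | h
  · exact h
  · exfalso
    have := J.cst_mem J.κ_mem
    refine J.not_surj_rel (fun x y => ∃ n, First x n ∧ ((IsEmp n ∧ y = κ) ∨ IsSucc n y ∧ IsOrd y))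
      ?_ ?_
    · rintro x y y' hx ⟨n, hn, h1⟩ ⟨n', hn', h2⟩
      obtain rfl := hn.unique hx.1 hn'
      rcases h1 with ⟨h1, h1'⟩ | h1 <;> rcases h2 with ⟨h2, h2'⟩ | h2
      · rw [h1', h2']
      · exact (h1 y' ((h2.1 y').2 (Or.inr rfl))).elim
      · exact (h2 y ((h1.1 y).2 (Or.inr rfl))).elim
      · exact sc_inj h1.2 h2.2 ((isSucc_iff.1 h1.1).symm.trans (isSucc_iff.1 h2.1))
    · have key : ∀ n : M, IsNat n → ∃ x, IsReal x ∧ First x n := by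
        intro n hn
        obtain ⟨x, hx, hx'⟩ := exists_const (mem_om.2 hn)
        exact ⟨x, isReal_iff.2 hx, first_iff.2 ((hx' _ _).2 ⟨isNat_emp, rfl⟩)⟩
      intro y hy
      rcases mem_sc.1 hy with hy | rfl
      · have hy' : IsNat y := mem_om.1 (h ▸ hy)
        obtain ⟨x, hx, hx'⟩ := key _ hy'.sc
        exact ⟨x, hx, _, hx', Or.inr ⟨isSucc_iff.2 rfl, hy'.1⟩⟩
      · obtain ⟨x, hx, hx'⟩ := key _ isNat_emp
        exact ⟨x, hx, _, hx', Or.inl ⟨isEmp_iff.2 rfl, rfl⟩⟩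
  · exact (mem_irrefl _ (om_sub_limit J.limit_κ (mem_om.1 h))).elim

theorem seq_bounded (J : ChangPair lam κ) {s : M} (hs : IsSeq s κ) : ∃ η, η ε κ ∧ IsSeq s η := by
  by_contra hn
  have hm : IsMap s (fun x => x ε om) (fun y => y ε κ) := by
    simp only [mem_om]; exact hs
  refine J.regular.2.2.2 om s J.om_mem trivial ⟨hm, fun ξ hξ => ?_⟩
  by_contra hn'
  refine hn ⟨ξ, hξ, hs.mono fun n v hv => ?_⟩
  by_contra h
  rw [not_mem_iff (J.limit_κ.1.mem hξ) (J.limit_κ.1.mem (hs.2.2 _ _ hv))] at h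
  exact hn' ⟨n, v, hv, h⟩

/-- Every `η < κ` is covered by a map on the reals that is definable from ordinals and elements of
`λ ^ ω`: by the definition of `κ` there is one in the middle model, and it is coded by a subset of
`κ ^ ω`. -/
theorem exists_codes (J : ChangPair lam κ) {η : M} (hη : η ε κ) :
    ∃ A, SDL lam A ∧ (∀ x w w', Codes A x w → Codes A x w' → w = w') ∧
      ∀ w, w ε η → ∃ x, Codes A x w := by
  obtain ⟨α, ⟨hα, g, hg, hgs⟩, hηα⟩ := (J.theta.2 η).1 hη
  have hακ : ∀ w, w ε α → w ε κ := fun w hw => (J.theta.2 w).2 ⟨α, ⟨hα, g, hg, hgs⟩, hw⟩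
  obtain ⟨X, hX, hgX⟩ := cMid_iff.1 hg
  obtain ⟨S, hSX, hS⟩ := hX.exists_seqs
  obtain ⟨A, hA⟩ := exists_sep (fun s => ∃ x w, App g x w ∧ Shift s x ∧ First s w) S
  obtain ⟨X', hX', -, hd⟩ := hX.exists_next
  have hAX : A ε X' := by
    refine hd _ ?_
    have : Nonempty (El X) := ⟨⟨g, hgX⟩⟩
    refine isDef_of_dfn (fun s : El X => s ε (⟨S, hSX⟩ : El X) ∧
      ∃ x w, App ⟨g, hgX⟩ x w ∧ Shift s x ∧ First s w) fun s => (hA s).trans ?_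
    constructor
    · rintro ⟨hs, x, w, h1, h2, h3⟩
      have := IsTrans.of_app hX.trans hgX h1
      exact ⟨hX.trans _ _ hSX hs, hs, ⟨x, this.1⟩, ⟨w, this.2⟩, (El.app hX.trans).2 h1,
        (El.shift hX.trans).2 h2, (El.first hX.trans).2 h3⟩
    · rintro ⟨_, hs, x, w, h1, h2, h3⟩
      exact ⟨hs, x.1, w.1, (El.app hX.trans).1 h1, (El.shift hX.trans).1 h2,
        (El.first hX.trans).1 h3⟩
  have hcodes : ∀ x w, Codes A x w → App g x w := by
    rintro x w ⟨s, hs, hx, h1, h2⟩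
    obtain ⟨hs, x', w', h3, h4, h5⟩ := (hA s).1 hs
    rw [h1.unique hx.1 ((hgs.1.2.1 x').1 ⟨_, h3⟩).2.1 h4, h2.unique ((hS s).1 hs).1 h5]
    exact h3
  have hAκ : ∀ s, s ε A → IsSeq s κ := by
    intro s hs
    obtain ⟨hs, x, w, h3, h4, h5⟩ := (hA s).1 hs
    have hs' := (hS s).1 hs
    refine hs'.mono fun n v hv => ?_
    rcases (hs'.nat hv).cases with rfl | ⟨m, hm, rfl⟩
    · rw [First.unique hs'.1 (first_iff.2 hv) h5]
      exact hακ w (hgs.1.2.2 _ _ h3)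
    · exact J.nat_κ (((hgs.1.2.1 x).1 ⟨w, h3⟩).2.2.2 m v ((h4 m v).2 ⟨_, isSucc_iff.2 rfl, hv⟩))
  have hC : CPlus lam A := (J.mid A hAκ).1 (cMid_iff.2 ⟨X', hX', hAX⟩)
  have hOD : OD (fun s => IsSeq s lam) A := by
    obtain ⟨T, -, hT, h⟩ := hC
    exact h A hT
  have := J.cst_mem (J.κ_sub hη)
  refine exists_sd J.ord J.nat_lam (fun A => (∀ x w w', Codes A x w → Codes A x w' → w = w') ∧
      ∀ w, w ε η → ∃ x, Codes A x w) ⟨A, hOD, fun x w w' h h' =>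
        hgs.1.1.2 _ _ _ (hcodes _ _ h) (hcodes _ _ h'), fun w hw => ?_⟩
  have hwα := hα.trans hw hηα
  obtain ⟨x, hx⟩ := hgs.2 w hwα
  have hxr := ((hgs.1.2.1 x).1 ⟨w, hx⟩).2
  obtain ⟨s, hs, h1, h2⟩ := exists_cons (hακ w hwα) (J.seq_of_real hxr)
  exact ⟨x, s, (hA s).2 ⟨(hS s).2 (J.seq_lam hs), x, w, hx, h2, h1⟩, hxr, h2, h1⟩

end ChangPair

/-! ### Bounds for definable maps on sequences -/

/-- `z` is the least element of the class `Z` of ordinals that is not in the ordinal `Y`. -/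
def LeastAbove {M : Type u} [SetStructure M] (Z : M → Prop) (Y z : M) : Prop :=
  Z z ∧ ¬ z ε Y ∧ ∀ w, w ε z → Z w → w ε Y

/-- The step of the hierarchy that exhausts the class of ordinals `Z` in increasing order. -/
def EnumStep {M : Type u} [SetStructure M] (Z : M → Prop) (Y x : M) : Prop :=
  x ε Y ∨ ∃ z, LeastAbove Z Y z ∧ (x ε z ∨ x = z)

section
variable {M : Type u} [SetStructure M] {C : M → Prop} [Inhab C]
variable (f g : (ℕ → M) → M) [Trm C f] [Trm C g]
instance (A : (ℕ → M) → M → Prop) [Dfn1 C A] : Dfn C (fun v => LeastAbove (A v) (f v) (g v)) := by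
  unfold LeastAbove; infer_instance
instance (A : (ℕ → M) → M → Prop) [Dfn1 C A] : Dfn C (fun v => EnumStep (A v) (f v) (g v)) := by
  unfold EnumStep; infer_instance
end

theorem LeastAbove.unique {M : Type u} [SetStructure M] [ZF M] {Z : M → Prop}
    (hZ : ∀ z, Z z → IsOrd z) {Y z z' : M}
    (h : LeastAbove Z Y z) (h' : LeastAbove Z Y z') : z = z' := by
  rcases ord_tri (hZ z h.1) (hZ z' h'.1) with h1 | h1 | h1
  · exact (h.2.1 (h'.2.2 z h1 h.1)).elim
  · exact h1
  · exact (h'.2.1 (h.2.2 z' h1 h'.1)).elim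

namespace ChangPair
variable {M : Type u} [SetStructure M] [hZ : ZF M] {lam κ : M}

/-- The increasing enumeration of an unbounded definable subclass of `λ`. -/
theorem exists_enum (J : ChangPair lam κ) (Z : M → Prop) [hd : Dfn1 (SDL lam) (fun _ => Z)]
    (hz : ∀ z, Z z → z ε lam) (hu : ∀ γ, γ ε lam → ∃ z, Z z ∧ ¬ z ε γ) :
    ∃ N : M → M → Prop, Dfn2 (SDL lam) (fun _ => N) ∧ (∀ β, β ε lam → ∃ z, N β z) ∧
      (∀ β z, N β z → IsOrd β ∧ Z z) ∧ ∀ β β' z, N β z → N β' z → β = β' := by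
  have := hd.univ
  have := J.cst_lam
  have hzo : ∀ z, Z z → IsOrd z := fun z h => J.ord.mem (hz z h)
  have hex : ∀ {β}, IsOrd β → ∃ X, IsStage (fun _ : M => False) (fun _ => EnumStep Z) β X := by
    intro β hβ
    refine exists_stage (base := fun _ : M => False) (Step := fun _ => EnumStep Z)
      ⟨emp, fun x => iff_of_false (not_mem_emp x) id⟩ (fun β Y _ => ?_) hβ
    by_cases h : ∃ z, LeastAbove Z Y z
    · obtain ⟨z, hz⟩ := h
      obtain ⟨X, hX⟩ := exists_bunion Y (sc z)
      refine ⟨X, fun x => ?_⟩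
      rw [hX, mem_sc]
      exact or_congr Iff.rfl ⟨fun h => ⟨z, hz, h⟩, fun ⟨z', hz', h⟩ =>
        hz'.unique hzo hz ▸ h⟩
    · exact ⟨Y, fun x => ⟨Or.inl, fun hx => hx.resolve_right fun ⟨z, hz, _⟩ => h ⟨z, hz⟩⟩⟩
  have hla : ∀ Y, Y ε lam → ∃ z, LeastAbove Z Y z := by
    intro Y hY
    obtain ⟨z, h1, h2⟩ := hu Y hY
    have := J.cst_mem hY
    obtain ⟨β, -, ⟨h3, h4⟩, h5⟩ := ord_min (fun z => Z z ∧ ¬ z ε Y) (hzo z h1) ⟨h1, h2⟩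
    refine ⟨β, h3, h4, fun w hw hZw => ?_⟩
    by_contra hn
    exact h5 w hw ⟨hZw, hn⟩
  have hmem : ∀ β Y, IsStage (fun _ : M => False) (fun _ => EnumStep Z) β Y → β ε lam →
      Y ε lam := by
    intro β Y h
    refine stage_induction (base := fun _ : M => False) (Step := fun _ => EnumStep Z)
      (fun β Y => β ε lam → Y ε lam) ?_ ?_ ?_ h
    · intro X hX _
      obtain rfl : X = emp := isEmp_iff.1 fun y hy => (hX y).1 hy
      exact J.nat_lam _ isNat_emp
    · intro β Y X hY ih hX hβ
      have hYl := ih (J.ord.trans (mem_sc_self β) hβ)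
      obtain ⟨z, hz'⟩ := hla Y hYl
      obtain rfl : X = sc z := by
        refine ext fun x => (hX x).trans ?_
        rw [mem_sc]
        constructor
        · rintro (h | ⟨z', h, h'⟩)
          · rcases (not_mem_iff (J.ord.mem hYl) (hzo z hz'.1)).1 hz'.2.1 with rfl | h'
            · exact Or.inl h
            · exact Or.inl ((hzo z hz'.1).trans h h')
          · exact h.unique hzo hz' ▸ h'
        · exact fun h => Or.inr ⟨z, hz', h⟩
      exact J.limit_lam.sc_mem (hz z hz'.1)
    · intro η X hη ih hX hηl
      obtain ⟨b, hb, hb'⟩ := J.exists_bound_of_mem hηl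
        (fun β Y => IsStage (fun _ : M => False) (fun _ => EnumStep Z) β Y)
        (fun x y y' _ h h' => h.unique h')
        (fun x y hx h => ih x y hx h (J.ord.trans hx hηl))
      have hbo := J.ord.mem hb
      have hXo : IsOrd X := by
        refine ⟨fun y z hy hz => ?_, fun y hy => ?_⟩
        · obtain ⟨γ, Y, h1, h2, h3⟩ := (hX y).1 hy
          exact (hX z).2 ⟨γ, Y, h1, h2, (hbo.mem (hb' _ _ h1 h2)).trans hz h3⟩
        · obtain ⟨γ, Y, h1, h2, h3⟩ := (hX y).1 hy
          exact (hbo.mem (hb' _ _ h1 h2)).2 y h3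
      have : ¬ b ε X := by
        intro h
        obtain ⟨γ, Y, h1, h2, h3⟩ := (hX b).1 h
        exact mem_asymm h3 (hb' _ _ h1 h2)
      rcases (not_mem_iff hXo hbo).1 this with rfl | h
      · exact hb
      · exact J.ord.trans h hb
  have hmono : ∀ β β' z Y, IsStage (fun _ : M => False) (fun _ => EnumStep Z) β Y →
      LeastAbove Z Y z → β ε β' → ∀ Y', IsStage (fun _ : M => False) (fun _ => EnumStep Z) β' Y' →
      z ε Y' := by
    intro β β' z Y hY hz hββ Y' hY'
    obtain ⟨X, hX⟩ := hex hY.ord.sc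
    have h1 : z ε X := (stage_succ hY hX z).2 (Or.inr ⟨z, hz, Or.inr rfl⟩)
    have h2 : sc β = β' ∨ sc β ε β' := by
      rcases sc_sub hY'.ord hββ with h | h
      · exact Or.inl h.symm
      · exact Or.inr h
    exact stage_mono (base := fun _ : M => False) (Step := fun _ => EnumStep Z)
      (fun _ _ _ _ h => Or.inl h) hX hY' h2 z h1
  refine ⟨fun β z => ∃ Y, IsStage (fun _ => False) (fun _ => EnumStep Z) β Y ∧ LeastAbove Z Y z,
    inferInstance, fun β hβ => ?_, ?_, ?_⟩
  · obtain ⟨Y, hY⟩ := hex (J.ord.mem hβ)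
    obtain ⟨z, hz⟩ := hla Y (hmem β Y hY hβ)
    exact ⟨z, Y, hY, hz⟩
  · rintro β z ⟨Y, hY, hz⟩
    exact ⟨hY.ord, hz.1⟩
  · rintro β β' z ⟨Y, hY, hz⟩ ⟨Y', hY', hz'⟩
    rcases ord_tri hY.ord hY'.ord with h | h | h
    · exact (hz'.2.1 (hmono β β' z Y hY hz h Y' hY')).elim
    · exact h
    · exact (hz.2.1 (hmono β' β z Y' hY' hz' h Y hY)).elim

/-- Every definable map from `ℝ` to `λ` is bounded: composed with the increasing enumeration of its
values, an unbounded one would map a part of `ℝ` onto `λ > κ`. -/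
theorem exists_bound_of_real (J : ChangPair lam κ) (R : M → M → Prop)
    [hd : Dfn2 (SDL lam) (fun _ => R)] (hf : ∀ x y y', IsReal x → R x y → R x y' → y = y')
    (hR : ∀ x y, IsReal x → R x y → y ε lam) :
    ∃ γ, γ ε lam ∧ ∀ x y, IsReal x → R x y → y ε γ := by
  by_contra hn
  obtain ⟨N, hN, h1, h2, h3⟩ := J.exists_enum (fun z => ∃ x, IsReal x ∧ R x z)
    (fun z ⟨x, hx, h⟩ => hR x z hx h) (fun γ hγ => by
      by_contra h
      refine hn ⟨γ, hγ, fun x y hx hxy => ?_⟩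
      by_contra h'
      exact h ⟨y, ⟨x, hx, hxy⟩, h'⟩)
  refine J.not_surj_rel (fun x β => ∃ z, R x z ∧ N β z) ?_ fun β hβ => ?_
  · rintro x β β' hx ⟨z, hz, hβ⟩ ⟨z', hz', hβ'⟩
    obtain rfl := hf x z z' hx hz hz'
    exact h3 _ _ _ hβ hβ'
  · obtain ⟨z, hz⟩ := h1 β (J.ord.trans hβ (J.limit_lam.sc_mem J.κ_mem))
    obtain ⟨-, x, hx, hxz⟩ := h2 β z hz
    exact ⟨x, hx, z, hxz, hz⟩

/-- Every definable map from `κ ^ ω` to `λ` is bounded. Since `κ` is regular, `κ ^ ω` is the union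
of the sets `η ^ ω` for `η < κ`, and `λ` is regular in `C⁺`, so it is enough to bound the map on
each `η ^ ω`. But `η ^ ω` is a definable image of `ℝ`, by countable choice for sets of reals. -/
theorem exists_bound_of_seq (J : ChangPair lam κ) (adr : ModelsADR M) (R : M → M → Prop)
    [hd : Dfn2 (SDL lam) (fun _ => R)] (hf : ∀ s y y', IsSeq s κ → R s y → R s y' → y = y')
    (hR : ∀ s y, IsSeq s κ → R s y → y ε lam) :
    ∃ γ, γ ε lam ∧ ∀ s y, IsSeq s κ → R s y → y ε γ := by
  have := hd.univ
  have hmono : ∀ {s η}, η ε κ → IsSeq s η → IsSeq s κ := fun hη hs =>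
    hs.mono fun n v hv => J.limit_κ.1.trans (hs.2.2 _ _ hv) hη
  by_cases h : ∀ η, η ε κ → ∃ γ, γ ε lam ∧ ∀ s y, IsSeq s η → R s y → y ε γ
  · have key : ∀ η, η ε κ → ∃ γ, γ ε lam ∧ (IsOrd γ ∧ (∀ s y, IsSeq s η → R s y → y ε γ) ∧
        ∀ δ, δ ε γ → ¬ ∀ s y, IsSeq s η → R s y → y ε δ) := by
      intro η hη
      obtain ⟨γ, hγ, hb⟩ := h η hη
      obtain ⟨δ, hδ, h1, h2⟩ := ord_min (fun γ => ∀ s y, IsSeq s η → R s y → y ε γ)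
        (J.ord.mem hγ) hb
      refine ⟨δ, ?_, hδ, h1, h2⟩
      rcases ord_tri hδ (J.ord.mem hγ) with h | rfl | h
      · exact J.ord.trans h hγ
      · exact hγ
      · exact (h2 γ h hb).elim
    have hu : ∀ η γ γ', (IsOrd γ ∧ (∀ s y, IsSeq s η → R s y → y ε γ) ∧
        ∀ δ, δ ε γ → ¬ ∀ s y, IsSeq s η → R s y → y ε δ) →
        (IsOrd γ' ∧ (∀ s y, IsSeq s η → R s y → y ε γ') ∧
        ∀ δ, δ ε γ' → ¬ ∀ s y, IsSeq s η → R s y → y ε δ) → γ = γ' := by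
      rintro η γ γ' ⟨h1, h2, h3⟩ ⟨h1', h2', h3'⟩
      rcases ord_tri h1 h1' with h | h | h
      · exact (h3' γ h h2).elim
      · exact h
      · exact (h3 γ' h h2').elim
    obtain ⟨γ, hγ, hb⟩ := J.exists_bound_of_mem J.κ_mem
      (fun η γ => IsOrd γ ∧ (∀ s y, IsSeq s η → R s y → y ε γ) ∧
        ∀ δ, δ ε γ → ¬ ∀ s y, IsSeq s η → R s y → y ε δ) (fun η γ γ' _ => hu η γ γ')
      (fun η γ hη hγ => by
        obtain ⟨γ', h1, h2⟩ := key η hη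
        rwa [hu η γ γ' hγ h2])
    refine ⟨γ, hγ, fun s y hs hy => ?_⟩
    obtain ⟨η, hη, hs'⟩ := J.seq_bounded hs
    obtain ⟨γ', h1, h2⟩ := key η hη
    exact (J.ord.mem hγ).trans (h2.2.1 s y hs' hy) (hb η γ' hη h2)
  · obtain ⟨η, hη, h⟩ : ∃ η, η ε κ ∧ ¬ ∃ γ, γ ε lam ∧ ∀ s y, IsSeq s η → R s y → y ε γ := by
      push Not at h ⊢; exact h
    obtain ⟨A, hA, hA1, hA2⟩ := J.exists_codes hη
    have := hA.cst
    have := J.cst_mem (J.κ_sub hη)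
    have := (SD.of_ord (P := fun s => IsSeq s lam) (isOrd_om (M := M))).cst
    obtain ⟨γ, hγ, hb⟩ := J.exists_bound_of_real
      (fun x y => ∃ s, IsSeq s η ∧ CodesSeq A om x s ∧ R s y)
      (by
        rintro x y y' - ⟨s, h1, h2, h3⟩ ⟨s', h1', h2', h3'⟩
        obtain rfl := h2.unique hA1 h1 h1' h2'
        exact hf s y y' (hmono hη h1) h3 h3')
      (by
        rintro x y - ⟨s, h1, h2, h3⟩
        exact hR s y (hmono hη h1) h3)
    refine (h ⟨γ, hγ, fun s y hs hy => ?_⟩).elim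
    obtain ⟨x, hx⟩ := exists_codesSeq adr hA2 hs
    exact hb x y hx.1 ⟨s, hs, hx, hy⟩

/-- Every `δ < λ` has a definable injection into `κ`: otherwise the least `δ` without an injection
into `κ` in `C⁺` would be a cardinal of `C⁺` strictly between `κ` and `λ = κ⁺`. -/
theorem exists_inj (J : ChangPair lam κ) {δ : M} (hδ : δ ε lam) :
    ∃ j, SDL lam j ∧ IsMap j (fun x => x ε δ) (fun y => y ε κ) ∧
      ∀ x x' y, App j x y → App j x' y → x = x' := by
  have := J.cst_mem hδ
  have := J.cst_mem J.κ_mem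
  refine exists_sd J.ord J.nat_lam (fun j => IsMap j (fun x => x ε δ) (fun y => y ε κ) ∧
      ∀ x x' y, App j x y → App j x' y → x = x') ?_
  by_contra hn
  obtain ⟨β, hβ, ⟨hβl, h⟩, hmin⟩ := ord_min (fun δ => δ ε lam ∧ ¬ ∃ j, OD (fun s => IsSeq s lam) j ∧
    IsMap j (fun x => x ε δ) (fun y => y ε κ) ∧ ∀ x x' y, App j x y → App j x' y → x = x')
    (J.ord.mem hδ) ⟨hδ, hn⟩
  have := J.cst_mem hβl
  have hκβ : κ ε β := by
    by_contra hκ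
    obtain ⟨j, hj, hj'⟩ := exists_map β (fun x y => y = x) (fun y => y ε κ)
      (fun x y y' _ h h' => h.trans h'.symm) (fun x _ => ⟨x, rfl⟩) (fun x y hx hy => by
        rw [hy]
        rcases (not_mem_iff hβ J.limit_κ.1).1 hκ with rfl | h
        · exact hx
        · exact J.limit_κ.1.trans hx h)
    have hs : SDL lam j := SD.of_unique (fun j => IsFunction j ∧ ∀ x y, App j x y ↔ x ε β ∧ y = x)
      ⟨hj.1, hj'⟩ fun y hy => fun_ext hy.1 hj.1 fun a b => (hy.2 a b).trans (hj' a b).symm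
    exact h ⟨j, hs.od, hj, fun x x' y h1 h2 => ((hj' _ _).1 h1).2.symm.trans ((hj' _ _).1 h2).2⟩
  have hc := J.succ.2.2 β hβl hκβ
  obtain ⟨γ, f, hγ, hf, hb⟩ : ∃ γ f, γ ε β ∧ CPlus lam f ∧ IsBij f (fun x => x ε γ)
      (fun y => y ε β) := by
    by_contra h
    exact hc ⟨hβ, fun γ f h1 h2 h3 => h ⟨γ, f, h1, h2, h3⟩⟩
  have hfo : OD (fun s => IsSeq s lam) f := by
    obtain ⟨T, -, hT, h⟩ := hf
    exact h f hT
  have hγl := J.ord.trans hγ hβl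
  have := J.cst_mem hγl
  have hj : ∃ j, OD (fun s => IsSeq s lam) j ∧ IsMap j (fun x => x ε γ) (fun y => y ε κ) ∧
      ∀ x x' y, App j x y → App j x' y → x = x' := by
    by_contra h
    exact hmin γ hγ ⟨hγl, h⟩
  obtain ⟨j, hj, hjm, hji⟩ := exists_sd J.ord J.nat_lam (fun j => IsMap j (fun x => x ε γ)
    (fun y => y ε κ) ∧ ∀ x x' y, App j x y → App j x' y → x = x') hj
  obtain ⟨g, hg, hgb⟩ := exists_sd J.ord J.nat_lam
    (fun f => IsBij f (fun x => x ε γ) (fun y => y ε β)) ⟨f, hfo, hb⟩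
  have := hj.cst
  have := hg.cst
  obtain ⟨k, hk, hk'⟩ := exists_map β (fun x y => ∃ z, App g z x ∧ App j z y) (fun y => y ε κ) (by
    rintro x y y' - ⟨z, h1, h2⟩ ⟨z', h1', h2'⟩
    obtain rfl := hgb.2 _ _ _ h1 h1'
    exact hjm.1.2 _ _ _ h2 h2') (by
    intro x hx
    obtain ⟨z, hz⟩ := hgb.1.2 x hx
    obtain ⟨y, hy⟩ := (hjm.2.1 z).2 ((hgb.1.1.2.1 z).1 ⟨x, hz⟩)
    exact ⟨y, z, hz, hy⟩) (by
    rintro x y - ⟨z, -, h⟩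
    exact hjm.2.2 _ _ h)
  have hs : SDL lam k := SD.of_unique (fun k => IsFunction k ∧ ∀ x y, App k x y ↔ x ε β ∧
    ∃ z, App g z x ∧ App j z y) ⟨hk.1, hk'⟩ fun y hy =>
      fun_ext hy.1 hk.1 fun a b => (hy.2 a b).trans (hk' a b).symm
  refine h ⟨k, hs.od, hk, fun x x' y h1 h2 => ?_⟩
  obtain ⟨-, z, h3, h4⟩ := (hk' _ _).1 h1
  obtain ⟨-, z', h3', h4'⟩ := (hk' _ _).1 h2
  obtain rfl := hji _ _ _ h4 h4'
  exact hgb.1.1.1.2 _ _ _ h3 h3'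

end ChangPair

/-! ### Coding the lower Chang model by sequences of ordinals -/

/-- The step of the hierarchy whose `γ`-th stage is `C⁻_γ`. -/
def CStep {M : Type u} [SetStructure M] (β Y y : M) : Prop := y ε Y ∨ IsDef Y HH y ∨ IsSeq y β

/-- `s ∈ δ ^ ω` codes a set `y` that is new in stage `β + 1` of the hierarchy of `C⁻`, where the
relation `Y` between codes and sets covers the stage `β`. The row `0` of `s` starts with `β` and a
tag. For the tag `0`, the row `1` is the sequence `y ∈ β ^ ω`; for the tag `1`, the row `1` codes a
formula and the row `2` codes parameters that define `y` over the stage `β`. -/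
def CodesNew {M : Type u} [SetStructure M] (δ β Y s y : M) : Prop :=
  ∃ z o t r, IsNum 0 z ∧ IsNum 1 o ∧ IsNum 2 t ∧ Row δ s z r ∧ App r z β ∧
    ((App r o z ∧ Row δ s o y ∧ IsSeq y β) ∨
      (App r o o ∧ ∃ r₁ r₂ e q A, Row δ s o r₁ ∧ Row δ s t r₂ ∧ FinCode δ InstrOf r₁ e ∧
        FinCode δ (fun r v => App Y r v) r₂ q ∧ (∀ v, v ε A ↔ ∃ r, App Y r v) ∧ IsCode e ∧
        IsFinSeq q (fun v => v ε A) ∧ DefinesSet A HH e q y))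

/-- The step of the hierarchy of relations between elements of `δ ^ ω` and the sets that they
code. -/
def CodeStep {M : Type u} [SetStructure M] (δ β Y x : M) : Prop :=
  x ε Y ∨ ∃ s y, IsOPair x s y ∧ CodesNew δ β Y s y

/-- `G` is a function from a part of `δ ^ ω` onto `J`; row `0` of each argument starts with an
element of `β`. -/
def Covers {M : Type u} [SetStructure M] (δ β G J : M) : Prop :=
  (∀ x, x ε G → ∃ s y, IsOPair x s y ∧ y ε J ∧
    ∃ z r γ, IsEmp z ∧ Row δ s z r ∧ App r z γ ∧ γ ε β) ∧
  (∀ s y y', App G s y → App G s y' → y = y') ∧ ∀ y, y ε J → ∃ s, App G s y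

section
variable {M : Type u} [SetStructure M] {C : M → Prop} [Inhab C]
variable (f g h k l : (ℕ → M) → M) [Trm C f] [Trm C g] [Trm C h] [Trm C k] [Trm C l]
instance : Dfn C (fun v => CStep (f v) (g v) (h v)) := by unfold CStep; infer_instance
instance : Dfn C (fun v => CodesNew (f v) (g v) (h v) (k v) (l v)) := by
  unfold CodesNew; infer_instance
instance : Dfn C (fun v => CodeStep (f v) (g v) (h v) (k v)) := by unfold CodeStep; infer_instance
instance : Dfn C (fun v => Covers (f v) (g v) (h v) (k v)) := by unfold Covers; infer_instance
end

section
variable {M : Type u} [SetStructure M] [hZ : ZF M]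

theorem exists_range (Y : M) : ∃ A, ∀ v, v ε A ↔ ∃ r, App Y r v := by
  obtain ⟨U, hU⟩ := exists_union Y
  obtain ⟨W, hW⟩ := exists_union U
  obtain ⟨A, hA⟩ := exists_sep (fun v => ∃ r, App Y r v) W
  refine ⟨A, fun v => (hA v).trans ⟨fun h => h.2, fun h => ⟨?_, h⟩⟩⟩
  obtain ⟨r, p, ⟨u, w, hu, hw, hp⟩, hpY⟩ := h
  exact (hW v).2 ⟨w, (hU w).2 ⟨p, hpY, (hp w).2 (Or.inr rfl)⟩, (hw v).2 (Or.inr rfl)⟩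

theorem exists_cStage {β : M} (hβ : IsOrd β) : ∃ X, IsStage (fun _ => False) CStep β X :=
  exists_stage (base := fun _ : M => False) (Step := CStep)
    ⟨emp, fun x => iff_of_false (not_mem_emp x) id⟩ (fun β Y _ => by
      obtain ⟨P, hP⟩ := exists_powerset Y
      obtain ⟨X, hX⟩ := exists_sep (fun y => IsDef Y HH y) P
      obtain ⟨S, hS⟩ := exists_mapsNat β
      obtain ⟨U, hU⟩ := exists_bunion X S
      obtain ⟨W, hW⟩ := exists_bunion Y U
      refine ⟨W, fun x => ?_⟩
      rw [hW, hU, hX, hS]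
      exact or_congr Iff.rfl (or_congr ⟨fun h => h.2, fun h => ⟨(hP x).2 h.sub, h⟩⟩ Iff.rfl)) hβ

theorem exists_codeStage (δ : M) {β : M} (hβ : IsOrd β) :
    ∃ X, IsStage (fun _ => False) (CodeStep δ) β X :=
  exists_stage (base := fun _ : M => False) (Step := CodeStep δ)
    ⟨emp, fun x => iff_of_false (not_mem_emp x) id⟩ (fun β Y _ => by
      obtain ⟨A, hA⟩ := exists_range Y
      obtain ⟨P, hP⟩ := exists_powerset A
      obtain ⟨S, hS⟩ := exists_mapsNat δ
      obtain ⟨U, hU⟩ := exists_bunion P S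
      obtain ⟨R, hR⟩ := exists_prod S U
      obtain ⟨X, hX⟩ := exists_sep (fun x => ∃ s y, IsOPair x s y ∧ CodesNew δ β Y s y) R
      obtain ⟨W, hW⟩ := exists_bunion Y X
      refine ⟨W, fun x => ?_⟩
      rw [hW, hX]
      refine or_congr Iff.rfl ⟨fun h => h.2, fun h => ⟨?_, h⟩⟩
      obtain ⟨s, y, hx, z, o, t, r, -, -, -, hr, -, h⟩ := h
      refine (hR x).2 ⟨s, y, (hS s).2 hr.1, (hU y).2 ?_, isOPair_iff.1 hx⟩
      rcases h with ⟨-, h, -⟩ | ⟨-, r1, r2, e, q, A', -, -, -, -, hA', -, -, hd⟩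
      · exact Or.inr ((hS y).2 h.2.1)
      · refine Or.inl ((hP y).2 fun v hv => ?_)
        exact (hA v).2 ((hA' v).1 ((hd v).1 hv).1)) hβ

theorem CodesNew.unique {δ β Y s y y' : M} (hY : ∀ s y y', App Y s y → App Y s y' → y = y')
    (h : CodesNew δ β Y s y) (h' : CodesNew δ β Y s y') : y = y' := by
  obtain ⟨z, o, t, r, hz, ho, ht, hr, hrβ, h⟩ := h
  obtain ⟨z', o', t', r', hz', ho', ht', hr', hrβ', h'⟩ := h'
  rw [isNum_iff] at hz ho ht hz' ho' ht'
  subst hz ho ht hz' ho' ht'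
  obtain rfl := hr.unique (isNat_num 0) hr'
  rcases h with ⟨h1, h2, h3⟩ | ⟨h1, r1, r2, e, q, A, k1, k2, k3, k4, k5, -, -, k6⟩ <;>
  rcases h' with ⟨h1', h2', h3'⟩ | ⟨h1', r1', r2', e', q', A', k1', k2', k3', k4', k5', -, -, k6'⟩
  · exact h2.unique (isNat_num 1) h2'
  · have := num_inj.1 (hr.2.1.1.2 _ _ _ h1 h1'); omega
  · have := num_inj.1 (hr.2.1.1.2 _ _ _ h1 h1'); omega
  · obtain rfl := k1.unique (isNat_num 1) k1'
    obtain rfl := k2.unique (isNat_num 2) k2'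
    obtain rfl := k3.unique (fun r v v' hr h h' => h.unique hr.1 h') k3'
    obtain rfl := k4.unique (fun r v v' _ h h' => hY r v v' h h') k4'
    obtain rfl : A = A' := ext fun v => (k5 v).trans (k5' v).symm
    exact ext fun v => (k6 v).trans (k6' v).symm

/-- Three sequences are the first rows of one sequence. -/
theorem exists_three_rows {δ r₀ r₁ r₂ : M} (h0 : IsSeq r₀ δ) (h1 : IsSeq r₁ δ) (h2 : IsSeq r₂ δ) :
    ∃ s, IsSeq s δ ∧ Row δ s (num 0) r₀ ∧ Row δ s (num 1) r₁ ∧ Row δ s (num 2) r₂ := by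
  obtain ⟨s, hs, h⟩ := exists_rows δ (Three r₀ r₁ r₂) (fun _ _ _ _ h h' => h.unique h')
    fun i _ => exists_three (fun r => IsSeq r δ) h0 h1 h2 i
  exact ⟨s, hs, h _ _ (isNat_num 0) (three_zero _ _ _), h _ _ (isNat_num 1) (three_one _ _ _),
    h _ _ (isNat_num 2) (three_two _ _ _)⟩

theorem Covers.mem {δ β G J s y : M} (h : Covers δ β G J) (hy : App G s y) :
    y ε J ∧ ∃ r γ, Row δ s emp r ∧ App r emp γ ∧ γ ε β := by
  obtain ⟨p, hp, hpG⟩ := hy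
  obtain ⟨s', y', hp', h1, z, r, γ, hz, h2, h3, h4⟩ := h.1 p hpG
  obtain ⟨rfl, rfl⟩ := hp.inj hp'
  obtain rfl := isEmp_iff.1 hz
  exact ⟨h1, r, γ, h2, h3, h4⟩

/-- The successor step of `codeStage_covers`: a new set is an element of `β ^ ω`, which is its own
code, or it is defined over the previous stage by a formula and finitely many parameters, for which
codes are at hand. The tag `β` in row `0` keeps new codes apart from old ones. -/
theorem Covers.step {δ β G J G' J' : M} (hδ : ∀ n, IsNat n → n ε δ) (hβ : β ε δ) (hδo : IsOrd δ)
    (h : Covers δ β G J) (hG : ∀ x, x ε G' ↔ CodeStep δ β G x) (hJ : ∀ x, x ε J' ↔ CStep β J x) :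
    Covers δ (sc β) G' J' := by
  have happ : ∀ s y, App G' s y ↔ App G s y ∨ CodesNew δ β G s y := by
    intro s y
    rw [app_iff, app_iff, hG]
    refine or_congr Iff.rfl ⟨?_, fun h => ⟨s, y, isOPair_iff.2 rfl, h⟩⟩
    rintro ⟨s', y', hp, h⟩
    obtain ⟨rfl, rfl⟩ := op_inj.1 (isOPair_iff.1 hp)
    exact h
  have hA : ∀ {A}, (∀ v, v ε A ↔ ∃ r, App G r v) → A = J := fun hA =>
    ext fun v => (hA v).trans ⟨fun ⟨r, hr⟩ => (h.mem hr).1, h.2.2 v⟩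
  have hnew : ∀ s y, CodesNew δ β G s y → y ε J' ∧ ∃ r, Row δ s emp r ∧ App r emp β := by
    rintro s y ⟨z, o, t, r, hz, ho, ht, hr, hrβ, hc⟩
    obtain rfl := isEmp_iff.1 hz
    refine ⟨(hJ y).2 (Or.inr ?_), r, hr, hrβ⟩
    rcases hc with ⟨-, -, h3⟩ | ⟨-, r1, r2, e, q, A, -, -, -, -, k5, k6, k7, k8⟩
    · exact Or.inr h3
    · obtain rfl := hA k5
      exact Or.inl ⟨e, q, k6, k7, k8⟩
  refine ⟨fun x hx => ?_, fun s y y' hy hy' => ?_, fun y hy => ?_⟩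
  · rcases (hG x).1 hx with hx | ⟨s, y, hp, hc⟩
    · obtain ⟨s, y, hp, hy, z, r, γ, hz, h1, h2, h3⟩ := h.1 x hx
      exact ⟨s, y, hp, (hJ y).2 (Or.inl hy), z, r, γ, hz, h1, h2, mem_sc.2 (Or.inl h3)⟩
    · obtain ⟨h1, r, h2, h3⟩ := hnew s y hc
      exact ⟨s, y, hp, h1, emp, r, β, isEmp_iff.2 rfl, h2, h3, mem_sc_self β⟩
  · -- an old code starts with an element of `β`, a new one starts with `β`
    have hcon : ∀ y y', App G s y → ¬ CodesNew δ β G s y' := by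
      intro y y' hy hy'
      obtain ⟨-, r, γ, h1, h2, h3⟩ := h.mem hy
      obtain ⟨-, r', h1', h2'⟩ := hnew s y' hy'
      obtain rfl := h1.unique isNat_emp h1'
      obtain rfl := h1.2.1.1.2 _ _ _ h2 h2'
      exact mem_irrefl _ h3
    rcases (happ s y).1 hy with h1 | h1 <;> rcases (happ s y').1 hy' with h2 | h2
    · exact h.2.1 s y y' h1 h2
    · exact (hcon _ _ h1 h2).elim
    · exact (hcon _ _ h2 h1).elim
    · exact h1.unique h.2.1 h2
  · simp only [happ]
    rcases (hJ y).1 hy with hy | hy | hy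
    · exact (h.2.2 y hy).imp fun _ h => Or.inl h
    · obtain ⟨e, q, he, hq, hd⟩ := hy
      obtain ⟨r0, h0, h0', h0'', -⟩ :=
        exists_seq_three hβ (hδ _ (isNat_num 1)) hβ
      obtain ⟨r1, h1, h1'⟩ := exists_code_row hδ he
      obtain ⟨n, hn, hqm⟩ := id hq
      obtain ⟨r2, h2, h2'⟩ := exists_finCode (fun r v => App G r v) hδ hn hqm.1 hqm.2.1
        (fun i v hv => by
          obtain ⟨s, hs⟩ := h.2.2 v (hqm.2.2 _ _ hv)
          obtain ⟨-, r, γ, hr, -⟩ := h.mem hs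
          exact ⟨s, hr.1, hs⟩)
      obtain ⟨s, hs, k0, k1, k2⟩ := exists_three_rows h0 h1 h2
      exact ⟨s, Or.inr ⟨_, _, _, r0, isNum_iff.2 rfl, isNum_iff.2 rfl, isNum_iff.2 rfl, k0, h0',
        Or.inr ⟨h0'', r1, r2, e, q, J, k1, k2, h1', h2',
          fun v => ⟨h.2.2 v, fun ⟨r, hr⟩ => (h.mem hr).1⟩, he, hq, hd⟩⟩⟩
    · obtain ⟨r0, h0, h0', h0'', -⟩ :=
        exists_seq_three hβ (hδ _ (isNat_num 0)) hβ
      have hyδ : IsSeq y δ := hy.mono fun n v hv => hδo.trans (hy.2.2 _ _ hv) hβ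
      obtain ⟨s, hs, k0, k1, -⟩ := exists_three_rows h0 hyδ hyδ
      exact ⟨s, Or.inr ⟨_, _, _, r0, isNum_iff.2 rfl, isNum_iff.2 rfl, isNum_iff.2 rfl, k0, h0',
        Or.inl ⟨h0'', k1, hy⟩⟩⟩

/-- For `β ≤ δ`, the `β`-th stage of the hierarchy of `C⁻` is the image of a part of `δ ^ ω` under a
map that is uniformly definable from `δ` and `β`. -/
theorem codeStage_covers {δ : M} (hδo : IsOrd δ) (hδ : ∀ n, IsNat n → n ε δ) {β G J : M}
    (hβ : β = δ ∨ β ε δ) (hG : IsStage (fun _ => False) (CodeStep δ) β G)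
    (hJ : IsStage (fun _ => False) CStep β J) : Covers δ β G J := by
  refine stage_induction (base := fun _ : M => False) (Step := CodeStep δ)
    (fun β G => (β = δ ∨ β ε δ) → ∀ J, IsStage (fun _ => False) CStep β J → Covers δ β G J)
    ?_ ?_ ?_ hG hβ J hJ
  · intro X hX _ J hJ
    have h : ∀ s y, ¬ App X s y := fun s y ⟨p, _, hp⟩ => (hX p).1 hp
    exact ⟨fun x hx => ((hX x).1 hx).elim, fun s y y' hy => (h s y hy).elim,
      fun y hy => ((stage_zero hJ y).1 hy).elim⟩
  · intro β Y X hY ih hX hβ J hJ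
    have hβδ : β ε δ := by
      rcases hβ with h | h
      · exact h ▸ mem_sc_self β
      · exact hδo.trans (mem_sc_self β) h
    obtain ⟨J0, hJ0⟩ := exists_cStage hY.ord
    exact (ih (Or.inr hβδ) J0 hJ0).step hδ hβδ hδo hX (stage_succ hJ0 hJ)
  · intro η X hη ih hX hβ J hJ
    have hin : ∀ γ, γ ε η → γ ε δ := by
      rcases hβ with rfl | h
      · exact fun _ h => h
      · exact fun γ hγ => hδo.trans hγ h
    have hmono : ∀ {γ γ' Y Y'}, IsStage (fun _ : M => False) (CodeStep δ) γ Y →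
        IsStage (fun _ : M => False) (CodeStep δ) γ' Y' → (γ = γ' ∨ γ ε γ') → Sub Y Y' :=
      fun h h' hγ => stage_mono (base := fun _ : M => False) (Step := CodeStep δ)
        (fun _ _ _ _ h => Or.inl h) h h' hγ
    refine ⟨fun x hx => ?_, fun s y y' ⟨p, hp, hpX⟩ ⟨p', hp', hpX'⟩ => ?_, fun y hy => ?_⟩
    · obtain ⟨γ, Y, hγ, hY, hx⟩ := (hX x).1 hx
      obtain ⟨J0, hJ0⟩ := exists_cStage hY.ord
      obtain ⟨s, y, hp, hy, z, r, γ', hz, h1, h2, h3⟩ :=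
        (ih γ Y hγ hY (Or.inr (hin γ hγ)) J0 hJ0).1 x hx
      exact ⟨s, y, hp, (stage_limit hη hJ y).2 ⟨γ, J0, hγ, hJ0, hy⟩, z, r, γ', hz, h1, h2,
        hη.1.trans h3 hγ⟩
    · obtain ⟨γ, Y, hγ, hY, hx⟩ := (hX p).1 hpX
      obtain ⟨γ', Y', hγ', hY', hx'⟩ := (hX p').1 hpX'
      obtain ⟨J0, hJ0⟩ := exists_cStage hY.ord
      obtain ⟨J0', hJ0'⟩ := exists_cStage hY'.ord
      have c := ih γ Y hγ hY (Or.inr (hin γ hγ)) J0 hJ0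
      have c' := ih γ' Y' hγ' hY' (Or.inr (hin γ' hγ')) J0' hJ0'
      rcases ord_tri hY.ord hY'.ord with h | h | h
      · exact c'.2.1 s y y' ⟨p, hp, hmono hY hY' (Or.inr h) _ hx⟩ ⟨p', hp', hx'⟩
      · exact c'.2.1 s y y' ⟨p, hp, hmono hY hY' (Or.inl h) _ hx⟩ ⟨p', hp', hx'⟩
      · exact c.2.1 s y y' ⟨p, hp, hx⟩ ⟨p', hp', hmono hY' hY (Or.inr h) _ hx'⟩
    · obtain ⟨γ, J0, hγ, hJ0, hy⟩ := (stage_limit hη hJ y).1 hy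
      obtain ⟨Y, hY⟩ := exists_codeStage δ hJ0.ord
      obtain ⟨s, p, hp, hpY⟩ := (ih γ Y hγ hY (Or.inr (hin γ hγ)) J0 hJ0).2.2 y hy
      exact ⟨s, p, hp, (hX p).2 ⟨γ, Y, hγ, hY, hpY⟩⟩

end

/-! ### Bounds for maps on the lower Chang model -/

namespace ChangPair
variable {M : Type u} [SetStructure M] [hZ : ZF M] {lam κ : M}

/-- Every definable map from `δ ^ ω` to `λ`, where `δ < λ`, is bounded. -/
theorem exists_bound_of_seq_mem (J : ChangPair lam κ) (adr : ModelsADR M) {δ : M} (hδ : δ ε lam)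
    (R : M → M → Prop) [hd : Dfn2 (SDL lam) (fun _ => R)]
    (hf : ∀ s y y', IsSeq s δ → R s y → R s y' → y = y')
    (hR : ∀ s y, IsSeq s δ → R s y → y ε lam) :
    ∃ γ, γ ε lam ∧ ∀ s y, IsSeq s δ → R s y → y ε γ := by
  obtain ⟨j, hj, hjm, hji⟩ := J.exists_inj hδ
  have := hj.cst
  have := J.cst_mem hδ
  obtain ⟨γ, hγ, hb⟩ := J.exists_bound_of_seq adr (fun t y => ∃ s, IsSeq s δ ∧
    (∀ n v, App s n v → ∃ w, App j v w ∧ App t n w) ∧ R s y) (by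
    rintro t y y' ht ⟨s, h1, h2, h3⟩ ⟨s', h1', h2', h3'⟩
    obtain rfl := h1.ext h1' fun n v hn hv => by
      obtain ⟨v', -, hv'⟩ := h1'.val hn
      obtain ⟨w, hw, hw'⟩ := h2 n v hv
      obtain ⟨u, hu, hu'⟩ := h2' n v' hv'
      obtain rfl := ht.1.2 _ _ _ hw' hu'
      rwa [hji _ _ _ hw hu]
    exact hf s y y' h1 h3 h3') (by
    rintro t y - ⟨s, h1, -, h3⟩
    exact hR s y h1 h3)
  refine ⟨γ, hγ, fun s y hs hy => ?_⟩
  obtain ⟨t, ht, ht'⟩ := exists_seq κ (fun n w => ∃ v, App s n v ∧ App j v w) (by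
    rintro n w w' - ⟨v, h1, h2⟩ ⟨v', h1', h2'⟩
    obtain rfl := hs.1.2 _ _ _ h1 h1'
    exact hjm.1.2 _ _ _ h2 h2') (by
    intro n hn
    obtain ⟨v, hv, hv'⟩ := hs.val hn
    obtain ⟨w, hw⟩ := (hjm.2.1 v).2 hv
    exact ⟨w, hjm.2.2 _ _ hw, v, hv', hw⟩)
  refine hb t y ht ⟨s, hs, fun n v hv => ?_, hy⟩
  obtain ⟨w, hw⟩ := (hjm.2.1 v).2 (hs.2.2 _ _ hv)
  exact ⟨w, hw, (ht' _ _).2 ⟨hs.nat hv, v, hv, hw⟩⟩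

/-- A definable map from a set of elements of some stage before `λ` to `λ` is bounded. -/
theorem exists_bound_of_sub (J : ChangPair lam κ) (adr : ModelsADR M) {β X b f : M} (hβ : β ε lam)
    (hX : IsStage (fun _ => False) CStep β X) (hbX : Sub b X) (hb : SDL lam b) (hf : SDL lam f)
    (hm : IsMap f (fun x => x ε b) (fun y => y ε lam)) :
    ∃ γ, γ ε lam ∧ ∀ x y, App f x y → y ε γ := by
  obtain ⟨δ, hδ, hβδ, hω⟩ : ∃ δ, δ ε lam ∧ (β = δ ∨ β ε δ) ∧ ∀ n, IsNat n → n ε δ := by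
    rcases ord_tri hX.ord J.limit_κ.1 with h | h | h
    · exact ⟨κ, J.κ_mem, Or.inr h, fun n hn => J.nat_κ hn⟩
    · exact ⟨κ, J.κ_mem, Or.inl h, fun n hn => J.nat_κ hn⟩
    · exact ⟨β, hβ, Or.inl rfl, fun n hn => hX.ord.trans (J.nat_κ hn) h⟩
  have := J.cst_mem hδ
  have := J.cst_mem hβ
  have := hf.cst
  obtain ⟨G, hG⟩ := exists_codeStage δ hX.ord
  have hc := codeStage_covers (J.ord.mem hδ) hω hβδ hG hX
  obtain ⟨γ, hγ, h⟩ := J.exists_bound_of_seq_mem adr hδ (fun s y =>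
    ∃ v, (∃ G, IsStage (fun _ => False) (fun β Y x => CodeStep δ β Y x) β G ∧ App G s v) ∧
      App f v y) (by
    rintro s y y' - ⟨v, ⟨G', h1, h2⟩, h3⟩ ⟨v', ⟨G'', h1', h2'⟩, h3'⟩
    obtain rfl := h1.unique h1'
    obtain rfl := h1.unique hG
    obtain rfl := hc.2.1 _ _ _ h2 h2'
    exact hm.1.2 _ _ _ h3 h3') (by
    rintro s y - ⟨v, -, h3⟩
    exact hm.2.2 _ _ h3)
  refine ⟨γ, hγ, fun x y hxy => ?_⟩
  obtain ⟨s, hs⟩ := hc.2.2 x (hbX x ((hm.2.1 x).1 ⟨y, hxy⟩))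
  obtain ⟨-, r, -, hr, -⟩ := hc.mem hs
  exact h s y hr.1 ⟨x, ⟨G, hG, hs⟩, hxy⟩

/-- A definable map to `λ` is bounded if its domain is an element of `β ^ ω`, which is a countable
set of pairs. -/
theorem exists_bound_of_isSeq (J : ChangPair lam κ) {β b f : M} (hbs : IsSeq b β)
    (hb : SDL lam b) (hf : SDL lam f) (hm : IsMap f (fun x => x ε b) (fun y => y ε lam)) :
    ∃ γ, γ ε lam ∧ ∀ x y, App f x y → y ε γ := by
  have := hb.cst
  have := hf.cst
  obtain ⟨γ, hγ, h⟩ := J.exists_bound_of_mem (J.κ_sub J.om_mem)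
    (fun n y => ∃ p v, IsOPair p n v ∧ p ε b ∧ App f p y) (by
    rintro n y y' - ⟨p, v, h1, h2, h3⟩ ⟨p', v', h1', h2', h3'⟩
    obtain rfl := hbs.1.2 _ _ _ ⟨p, h1, h2⟩ ⟨p', h1', h2'⟩
    obtain rfl := h1.unique h1'
    exact hm.1.2 _ _ _ h3 h3') (by
    rintro n y - ⟨p, v, h1, h2, h3⟩
    exact hm.2.2 _ _ h3)
  refine ⟨γ, hγ, fun x y hxy => ?_⟩
  have hx := (hm.2.1 x).1 ⟨y, hxy⟩
  obtain ⟨n, v, hp⟩ := hbs.1.1 x hx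
  exact h n y (mem_om.2 (hbs.nat ⟨x, hp, hx⟩)) ⟨x, v, hp, hx, hxy⟩

/-- A counterexample `f ∈ C⁺` is in general only definable in the internal sense of `C⁺`. But if
there is one, then there is one that is definable by a formula of the metatheory, and its domain has
a first stage in which it appears. -/
theorem exists_bound (J : ChangPair lam κ) (adr : ModelsADR M) {b f : M} (hb : CMinus lam b)
    (hf : CPlus lam f) (hm : IsMap f (fun x => x ε b) (fun y => y ε lam)) :
    ∃ γ, γ ε lam ∧ ∀ x y, App f x y → y ε γ := by
  by_contra hn
  have := J.cst_lam
  have hfo : OD (fun s => IsSeq s lam) f := by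
    obtain ⟨T, -, hT, h⟩ := hf
    exact h f hT
  obtain ⟨g, hg, c, hc, hgm, hgn⟩ := exists_sd J.ord J.nat_lam (fun f => ∃ b, CMinus lam b ∧
    IsMap f (fun x => x ε b) (fun y => y ε lam) ∧ ¬ ∃ γ, γ ε lam ∧ ∀ x y, App f x y → y ε γ)
    ⟨f, hfo, b, hb, hm, hn⟩
  have := hg.cst
  have hcs : SDL lam c := SD.of_unique (fun c => ∀ x, x ε c ↔ ∃ y, App g x y)
    (fun x => (hgm.2.1 x).symm) fun c' hc' => ext fun x => (hc' x).trans (hgm.2.1 x)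
  obtain ⟨X, hX, hcX⟩ := hc
  obtain ⟨α, Y, hα, hY, hcY⟩ := (stage_limit (Step := CStep) J.limit_lam hX c).1 hcX
  obtain ⟨η, hη, ⟨Z, hZ', hcZ⟩, hmin⟩ := ord_min
    (fun η => ∃ Z, IsStage (fun _ => False) (fun β Y y => CStep β Y y) η Z ∧ c ε Z) hY.ord
    ⟨Y, hY, hcY⟩
  have hηl : η ε lam := by
    rcases ord_tri hη hY.ord with h | rfl | h
    · exact J.ord.trans h hα
    · exact hα
    · exact (hmin α h ⟨Y, hY, hcY⟩).elim
  rcases zero_succ_limit hη with rfl | ⟨β, hβ, rfl⟩ | hl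
  · exact (stage_zero hZ' c).1 hcZ
  · obtain ⟨W, hW⟩ := exists_cStage hβ
    rcases (stage_succ (Step := CStep) hW hZ' c).1 hcZ with h | h | h
    · exact hmin β (mem_sc_self β) ⟨W, hW, h⟩
    · exact hgn (J.exists_bound_of_sub adr (J.ord.trans (mem_sc_self β) hηl) hW h.sub hcs hg hgm)
    · exact hgn (J.exists_bound_of_isSeq h hcs hg hgm)
  · obtain ⟨γ, W, hγ, hW, h⟩ := (stage_limit (Step := CStep) hl hZ' c).1 hcZ
    exact hmin γ hγ ⟨W, hW, h⟩

end ChangPair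

end SetStructure

theorem lemma4p1 {M : Type u} [SetStructure M] (hM : SetStructure.ModelsDagger M)
    (lam : M) (hJ : SetStructure.Join lam)
    (b f : M) (hb : SetStructure.CMinus lam b) (hf : SetStructure.CPlus lam f)
    (hmap : SetStructure.IsMap f (fun x => x ε b) (fun y => y ε lam)) :
    ∃ γ, γ ε lam ∧ ∀ x y, x ε b → SetStructure.App f x y → y ε γ := by
  have : SetStructure.ZF M := ⟨hM.zf⟩
  obtain ⟨hl, κ, hκ, ⟨hr, -⟩, ⟨hs, hc⟩, -, hmid, -⟩ := hJ
  have J : SetStructure.ChangPair lam κ := ⟨hl, hκ, hr, hs, hc, hmid⟩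
  obtain ⟨γ, hγ, h⟩ := J.exists_bound hM.adr hb hf hmap
  exact ⟨γ, hγ, fun x y _ hxy => h x y hxy⟩
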